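/- Let $n \ge 2$. View $\mathbb{C}S_n$ as a superalgebra in which even permutations are even and odd permutations are odd; superspaces are $\mathbb{Z}/2$-graded complex vector spaces, $\Pi$ is the parity shift, and $\cong$ denotes isomorphism of supermodules by an even map. For a partition $\lambda$ of $m$ let $\lambda'$ be the conjugate partition and $S^\lambda$ the Specht module of $\mathbb{C}S_m$. Write $\mu \prec \lambda$ if the Young diagram of $\mu$ is obtained from that of $\lambda$ by removing one box, and let $\operatorname{res}(\lambda/\mu) = j - i$ if this box lies in row $i$ and column $j$. There exist linear maps $\phi^\lambda : S^\lambda \to S^{\lambda'}$, for all partitions $\lambda$ (of all $m$), such that (i) $\phi^\lambda(\sigma v) = \operatorname{sgn}(\sigma)\, \sigma \phi^\lambda(v)$ for all $\sigma \in S_m$ and $v \in S^\lambda$; (ii) $\phi^{\lambda'} \circ \phi^\lambda = \mathrm{id}$; (iii) if $\mu \prec \lambda$, $\mu = \mu'$ and $\lambda = \lambda'$, then $\phi^\lambda \circ \iota = \iota \circ \phi^\mu$ for each $\mathbb{C}S_{m-1}$-module homomorphism $\iota : S^\mu \to S^\lambda$, where $\lambda$ is a partition of $m$. Fix any such maps and,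 for each $m$, any set $\overline{\mathcal{P}}(m)$ of representatives for the classes $\{\lambda,\lambda'\}$ of partitions of $m$. For $\lambda \in \overline{\mathcal{P}}(m)$ define a $\mathbb{C}S_m$-supermodule $W^\lambda$ as follows, and put $W^{\lambda'} = W^{\lambda}$: - if $\lambda \ne \lambda'$, then $W^\lambda = S^\lambda \oplus S^{\lambda'}$ as a module, with even part $\{u + \phi^\lambda(u) : u \in S^\lambda\}$ and odd part $\{u - \phi^\lambda(u) : u \in S^\lambda\}$; - if $\lambda = \lambda'$, then $W^\lambda = S^\lambda$ as a module, with even and odd parts the $+1$- and $-1$-eigenspaces of $\phi^\lambda$. Then for every $\lambda \in \overline{\mathcal{P}}(n)$ the restriction of $W^\lambda$ to $\mathbb{C}S_{n-1}$ (the sums being over partitions $\mu$ of $n-1$) is $$W^\lambda\big|_{\mathbb{C}S_{n-1}} \cong \begin{cases} \Big[\bigoplus_{\mu \prec \lambda,\ \mu \ne \mu'} W^\mu\Big] \oplus \Big[\bigoplus_{\mu \prec \lambda,\ \mu = \mu'} W^\mu \oplus \Pi(W^\mu)\Big] & \text{if } \lambda \ne \lambda',\\[1ex] \bigoplus_{\mu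 \prec \lambda,\ \operatorname{res}(\lambda/\mu) \ge 0} W^\mu & \text{if } \lambda = \lambda'.\end{cases}$$ In particular the restriction is multiplicity-free when a supermodule is distinguished from its parity shift, that is, it is a direct sum of simple supermodules no two of which are isomorphic by an even isomorphism. If $\lambda = \lambda'$, it is even a direct sum of simple supermodules no two of which are isomorphic by an even or an odd isomorphism. -/

import Mathlib

open scoped DirectSum

noncomputable section

namespace SuperSym

/-! ### Supermodules over the group superalgebra of a finite supergroup

A supergroup is a group `G` with a homomorphism `ε : G →* ℤˣ`; the elements with `ε g = 1` are even
and those with `ε g = -1` are odd. The group algebra `ℂG` is graded accordingly. A `ℂG`-supermodule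
is a `ℂG`-module (a complex representation of `G`) with a decomposition `V = V₀ ⊕ V₁` such that a
group element of parity `p` maps `V_i` into `V_{i+p}`. -/

/-- The parity of a sign: `1 ↦ 0` and `-1 ↦ 1`. -/
def parity (u : ℤˣ) : ZMod 2 := if u = 1 then 0 else 1

/-- A supermodule over the group superalgebra `ℂG`. -/
structure Supermodule {G : Type} [Group G] (ε : G →* ℤˣ) where
  V : Type
  [addCommGroup : AddCommGroup V]
  [module : Module ℂ V]
  ρ : Representation ℂ G V
  grade : ZMod 2 → Submodule ℂ V
  isCompl : IsCompl (grade 0) (grade 1)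
  map_grade : ∀ (g : G) (i : ZMod 2) (v : V), v ∈ grade i → ρ g v ∈ grade (i + parity (ε g))

attribute [instance] Supermodule.addCommGroup Supermodule.module

namespace Supermodule

variable {G : Type} [Group G] {ε : G →* ℤˣ}

/-- An even isomorphism of supermodules. -/
structure Iso (M N : Supermodule ε) where
  toLinearEquiv : M.V ≃ₗ[ℂ] N.V
  map_smul : ∀ (g : G) (v : M.V), toLinearEquiv (M.ρ g v) = N.ρ g (toLinearEquiv v)
  map_grade : ∀ (i : ZMod 2) (v : M.V), v ∈ M.grade i → toLinearEquiv v ∈ N.grade i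

/-- The parity shift `Π(M)`: the same module, with the two homogeneous components exchanged. -/
def shift (M : Supermodule ε) : Supermodule ε where
  V := M.V
  ρ := M.ρ
  grade i := M.grade (i + 1)
  isCompl := by
    have h : (1 + 1 : ZMod 2) = 0 := by decide
    rw [zero_add, h]
    exact M.isCompl.symm
  map_grade g i v hv := by
    have := M.map_grade g _ v hv
    rwa [add_right_comm] at this

/-- The direct sum of two supermodules. -/
def prod (M N : Supermodule ε) : Supermodule ε where
  V := M.V × N.V
  ρ := M.ρ.prod N.ρ
  grade i := (M.grade i).prod (N.grade i)
  isCompl := by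
    have hM := M.isCompl
    have hN := N.isCompl
    constructor
    · rw [disjoint_iff, Submodule.prod_inf_prod, hM.inf_eq_bot, hN.inf_eq_bot, Submodule.prod_bot]
    · rw [codisjoint_iff, Submodule.prod_sup_prod, hM.sup_eq_top, hN.sup_eq_top,
        Submodule.prod_top]
  map_grade g i v hv := ⟨M.map_grade g i _ hv.1, N.map_grade g i _ hv.2⟩

/-- The direct sum of a family of supermodules. -/
def directSum {ι : Type} (M : ι → Supermodule ε) : Supermodule ε where
  V := ⨁ i, (M i).V
  ρ :=
    { toFun := fun g => DirectSum.lmap (fun i => (M i).ρ g)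
      map_one' := by
        classical
        refine LinearMap.ext fun x => DFinsupp.ext fun i => ?_
        simp
      map_mul' := fun g h => by
        classical
        refine LinearMap.ext fun x => DFinsupp.ext fun i => ?_
        simp }
  grade p := ⨅ i, ((M i).grade p).comap (DirectSum.component ℂ ι (fun i => (M i).V) i)
  isCompl := by
    classical
    constructor
    · rw [Submodule.disjoint_def]
      intro x h0 h1
      simp only [Submodule.mem_iInf, Submodule.mem_comap] at h0 h1
      refine DFinsupp.ext fun i => ?_
      exact Submodule.disjoint_def.1 (M i).isCompl.disjoint _ (h0 i) (h1 i)
    · rw [codisjoint_iff, eq_top_iff]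
      intro x _
      induction x using DirectSum.induction_on with
      | zero => exact Submodule.zero_mem _
      | add x y hx hy => exact Submodule.add_mem _ (hx trivial) (hy trivial)
      | of i v =>
        have hv : v ∈ (M i).grade 0 ⊔ (M i).grade 1 := by
          rw [(M i).isCompl.sup_eq_top]; trivial
        obtain ⟨a, ha, b, hb, rfl⟩ := Submodule.mem_sup.1 hv
        have key : ∀ (p : ZMod 2) (c : (M i).V), c ∈ (M i).grade p →
            DirectSum.of (fun i => (M i).V) i c ∈
              ⨅ j, ((M j).grade p).comap (DirectSum.component ℂ ι (fun i => (M i).V) j) := by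
          intro p c hc
          simp only [Submodule.mem_iInf, Submodule.mem_comap]
          intro j
          by_cases hij : i = j
          · subst hij
            have : DirectSum.component ℂ ι (fun i => (M i).V) i
                (DirectSum.of (fun i => (M i).V) i c) = c :=
              DirectSum.of_eq_same (β := fun i => (M i).V) i c
            rwa [this]
          · have : DirectSum.component ℂ ι (fun i => (M i).V) j
                (DirectSum.of (fun i => (M i).V) i c) = 0 :=
              DirectSum.of_eq_of_ne _ _ _ (Ne.symm hij)
            rw [this]
            exact Submodule.zero_mem _
        rw [map_add]
        exact Submodule.add_mem_sup (key 0 a ha) (key 1 b hb)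
  map_grade g p x hx := by
    simp only [Submodule.mem_iInf, Submodule.mem_comap] at hx ⊢
    intro i
    exact (M i).map_grade g p _ (hx i)

/-- Restriction along a homomorphism of supergroups (a parity-preserving homomorphism). -/
def restrict {H : Type} [Group H] {δ : H →* ℤˣ} (f : H →* G) (hf : ∀ h, ε (f h) = δ h)
    (M : Supermodule ε) : Supermodule δ where
  V := M.V
  ρ := M.ρ.comp f
  grade := M.grade
  isCompl := M.isCompl
  map_grade h i v hv := by
    rw [← hf h]
    exact M.map_grade (f h) i v hv

/-- A subspace `U` is a subsupermodule if it is stable under the action and is the sum of its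
intersections with the two homogeneous components. -/
def IsSub (M : Supermodule ε) (U : Submodule ℂ M.V) : Prop :=
  (∀ (g : G) (v : M.V), v ∈ U → M.ρ g v ∈ U) ∧ U = (U ⊓ M.grade 0) ⊔ (U ⊓ M.grade 1)

/-- A nonzero supermodule without proper nonzero subsupermodules. -/
def IsSimple (M : Supermodule ε) : Prop :=
  Nontrivial M.V ∧ ∀ U : Submodule ℂ M.V, M.IsSub U → U = ⊥ ∨ U = ⊤

/-- `M` is a direct sum of simple supermodules, no two of which are isomorphic by an even
isomorphism (a supermodule and its parity shift are thus counted as different). -/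
def IsMultiplicityFree (M : Supermodule ε) : Prop :=
  ∃ (ι : Type) (N : ι → Supermodule ε), (∀ i, (N i).IsSimple) ∧
    (∀ i j, i ≠ j → IsEmpty (Iso (N i) (N j))) ∧ Nonempty (Iso M (directSum N))

/-- `M` is a direct sum of simple supermodules, no two of which are isomorphic by a homogeneous
(even or odd) isomorphism. An odd isomorphism onto `N` is an even isomorphism onto `Π(N)`. -/
def IsHomogeneouslyMultiplicityFree (M : Supermodule ε) : Prop :=
  ∃ (ι : Type) (N : ι → Supermodule ε), (∀ i, (N i).IsSimple) ∧
    (∀ i j, i ≠ j → IsEmpty (Iso (N i) (N j)) ∧ IsEmpty (Iso (N i) (N j).shift)) ∧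
    Nonempty (Iso M (directSum N))

end Supermodule

/-! ### Partitions -/

/-- Partitions of `n`, as Young diagrams with `n` cells; the cell `(i, j)` is in row `i` and
column `j`. -/
abbrev Shape (n : ℕ) : Type := {d : YoungDiagram // d.card = n}

/-- The conjugate partition. -/
def Shape.conj {n : ℕ} (lam : Shape n) : Shape n :=
  ⟨lam.1.transpose, by
    have h : lam.1.transpose.card = lam.1.card := by simp [YoungDiagram.card, YoungDiagram.transpose]
    exact h.trans lam.2⟩

theorem Shape.conj_conj {n : ℕ} (lam : Shape n) : lam.conj.conj = lam :=
  Subtype.ext (YoungDiagram.transpose_transpose _)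

/-- `mu ≺ lam`: the diagram of `mu` is obtained from that of `lam` by removing one cell. -/
def Precedes {n : ℕ} (mu : Shape n) (lam : Shape (n + 1)) : Prop :=
  ∃ c ∈ lam.1.cells, mu.1.cells = lam.1.cells.erase c

/-- The residue `j - i` of the cell removed from `lam` to obtain `mu`, when `mu ≺ lam`. -/
def res {n : ℕ} (mu : Shape n) (lam : Shape (n + 1)) : ℤ :=
  ∑ c ∈ lam.1.cells \ mu.1.cells, ((c.2 : ℤ) - (c.1 : ℤ))

/-- `R` contains exactly one element of each class `{lam, lam'}`. -/
def IsTransversal {n : ℕ} (R : Set (Shape n)) : Prop :=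
  ∀ lam : Shape n, ∃! kap : Shape n, kap ∈ R ∧ (kap = lam ∨ kap = lam.conj)

/-! ### Specht modules -/

/-- The inclusion of `S_n` in `S_{n+1}` as the stabilizer of the last letter. -/
def inclusion (n : ℕ) : Equiv.Perm (Fin n) →* Equiv.Perm (Fin (n + 1)) :=
  Equiv.Perm.viaEmbeddingHom Fin.castSuccEmb

theorem sign_inclusion (n : ℕ) (σ : Equiv.Perm (Fin n)) :
    Equiv.Perm.sign (inclusion n σ) = Equiv.Perm.sign σ := by
  classical
  rw [inclusion, Equiv.Perm.viaEmbeddingHom_apply]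
  unfold Equiv.Perm.viaEmbedding
  convert Equiv.Perm.sign_extendDomain σ
    (Equiv.ofInjective (Fin.castSuccEmb : Fin n ↪ Fin (n + 1)).1 Fin.castSuccEmb.2)

/-- A tableau of shape `lam`: a bijective filling of the cells of `lam` by the letters. -/
abbrev Tableau {n : ℕ} (lam : Shape n) : Type := {c // c ∈ lam.1.cells} ≃ Fin n

/-- The row of `t` that contains a given letter. The function `t.row` is the tabloid of `t`. -/
def Tableau.row {n : ℕ} {lam : Shape n} (t : Tableau lam) (k : Fin n) : ℕ := (t.symm k).1.1

/-- The column of `t` that contains a given letter. -/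
def Tableau.col {n : ℕ} {lam : Shape n} (t : Tableau lam) (k : Fin n) : ℕ := (t.symm k).1.2

/-- The column stabilizer of a tableau. -/
def Tableau.colStab {n : ℕ} {lam : Shape n} (t : Tableau lam) : Finset (Equiv.Perm (Fin n)) :=
  {σ | ∀ k, t.col (σ k) = t.col k}

/-- The space of complex functions on the set of all maps from letters to rows. A tabloid `{t}` is
identified with the map `t.row` that sends each letter to its row, and then with the indicator
function of this map; so this space contains the permutation modules spanned by the tabloids. -/
abbrev TabloidSpace (n : ℕ) : Type := (Fin n → ℕ) → ℂ

/-- The tabloid `{t}`. -/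
def Tableau.tabloid {n : ℕ} {lam : Shape n} (t : Tableau lam) : TabloidSpace n := Pi.single t.row 1

/-- The action of `S_n` on tabloids by permutation of the letters: `σ{t} = {σt}`. -/
def tabloidRep (n : ℕ) : Representation ℂ (Equiv.Perm (Fin n)) (TabloidSpace n) where
  toFun σ := LinearMap.funLeft ℂ ℂ (fun f : Fin n → ℕ => f ∘ ⇑σ)
  map_one' := rfl
  map_mul' _ _ := rfl

theorem tabloidRep_tabloid {n : ℕ} {lam : Shape n} (σ : Equiv.Perm (Fin n)) (t : Tableau lam) :
    tabloidRep n σ t.tabloid = Tableau.tabloid (t.trans σ : Tableau lam) := by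
  classical
  have hrow : Tableau.row (t.trans σ : Tableau lam) = t.row ∘ ⇑σ⁻¹ := rfl
  funext f
  show t.tabloid (f ∘ ⇑σ) = _
  have h : f ∘ ⇑σ = t.row ↔ f = t.row ∘ ⇑σ⁻¹ := by
    constructor
    · intro h
      rw [← h]
      funext k
      simp
    · intro h
      rw [h]
      funext k
      simp
  simp only [Tableau.tabloid, hrow, Pi.single_apply, h]

/-- The polytabloid `e_t`, the sum of `sgn(σ) σ{t}` over the column stabilizer of `t`. -/
def polytabloid {n : ℕ} {lam : Shape n} (t : Tableau lam) : TabloidSpace n :=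
  ∑ σ ∈ t.colStab,
    (((Equiv.Perm.sign σ : ℤˣ) : ℤ) : ℂ) • tabloidRep n σ t.tabloid

/-- The Specht module `S^lam`, spanned by the polytabloids of shape `lam`. -/
def Specht {n : ℕ} (lam : Shape n) : Submodule ℂ (TabloidSpace n) :=
  Submodule.span ℂ (Set.range (polytabloid (lam := lam)))

theorem tabloidRep_polytabloid {n : ℕ} {lam : Shape n} (σ : Equiv.Perm (Fin n)) (t : Tableau lam) :
    tabloidRep n σ (polytabloid t) = polytabloid (t.trans σ : Tableau lam) := by
  have hcol : Tableau.col (t.trans σ : Tableau lam) = t.col ∘ ⇑σ⁻¹ := rfl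
  unfold polytabloid
  rw [map_sum]
  refine Finset.sum_equiv (MulAut.conj σ).toEquiv ?_ ?_
  · intro τ
    simp only [Tableau.colStab, Finset.mem_filter, Finset.mem_univ, true_and, hcol]
    constructor
    · intro h k
      simpa [MulAut.conj_apply] using h (σ⁻¹ k)
    · intro h k
      simpa [MulAut.conj_apply] using h (σ k)
  · intro τ _
    have hs : Equiv.Perm.sign ((MulAut.conj σ).toEquiv τ) = Equiv.Perm.sign τ := by
      simp [MulAut.conj_apply, mul_right_comm]
    rw [hs, map_smul, ← tabloidRep_tabloid, ← Module.End.mul_apply, ← Module.End.mul_apply,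
      ← map_mul, ← map_mul]
    simp [MulAut.conj_apply]

theorem specht_le_comap {n : ℕ} (lam : Shape n) (σ : Equiv.Perm (Fin n)) :
    Specht lam ≤ (Specht lam).comap (tabloidRep n σ) := by
  refine Submodule.span_le.2 ?_
  rintro _ ⟨t, rfl⟩
  show tabloidRep n σ (polytabloid t) ∈ Specht lam
  rw [tabloidRep_polytabloid]
  exact Submodule.subset_span ⟨_, rfl⟩

/-- The action of `S_n` on the Specht module. -/
def spechtRep {n : ℕ} (lam : Shape n) : Representation ℂ (Equiv.Perm (Fin n)) (Specht lam) :=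
  (tabloidRep n).subrepresentation (Specht lam) (specht_le_comap lam)

/-! ### The associators and the supermodules `W^lam` -/

/-- A choice of linear maps `φ^lam : S^lam → S^lam'` for all partitions `lam`, such that
* `φ^lam (σ v) = sgn(σ) σ φ^lam(v)`;
* `φ^lam' ∘ φ^lam = id`;
* whenever `mu ≺ lam` and both are symmetric, `φ^lam` restricts to `φ^mu` on the copy of `S^mu` in
  `S^lam`.
The elements are compared in the space of tabloids because `lam'' = lam` (and `lam' = lam` in the
third condition) are not definitional equalities. -/
structure Associators where
  φ : ∀ {n : ℕ} (lam : Shape n), Specht lam →ₗ[ℂ] Specht lam.conj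
  intertwine : ∀ {n : ℕ} (lam : Shape n) (σ : Equiv.Perm (Fin n)) (v : Specht lam),
    φ lam (spechtRep lam σ v) =
      (((Equiv.Perm.sign σ : ℤˣ) : ℤ) : ℂ) • spechtRep lam.conj σ (φ lam v)
  inverse : ∀ {n : ℕ} (lam : Shape n) (v : Specht lam),
    (φ lam.conj (φ lam v) : TabloidSpace n) = v
  compatible : ∀ {n : ℕ} (mu : Shape n) (lam : Shape (n + 1)),
    Precedes mu lam → mu = mu.conj → lam = lam.conj →
    ∀ j : Specht mu →ₗ[ℂ] Specht lam,
      (∀ σ v, j (spechtRep mu σ v) = spechtRep lam (inclusion n σ) (j v)) →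
      ∀ v w : Specht mu, (φ mu v : TabloidSpace n) = w →
        (φ lam (j v) : TabloidSpace (n + 1)) = j w

/-- The scalar `(-1) ^ i`. -/
def eps (i : ZMod 2) : ℂ := if i = 0 then 1 else -1

theorem eps_add_parity (i : ZMod 2) (u : ℤˣ) : eps (i + parity u) = ((u : ℤ) : ℂ) * eps i := by
  rcases Int.units_eq_one_or u with rfl | rfl
  · simp [parity]
  · have h : parity (-1) = 1 := by decide
    have h1 : ∀ i : ZMod 2, (i + 1 = 0 ↔ ¬ i = 0) := by decide
    rw [h, eps, eps]
    by_cases hi : i = 0 <;> simp [h1, hi]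

namespace Associators

variable (Φ : Associators)

theorem surj {n : ℕ} (lam kap : Shape n) (h : lam.conj = kap) (w : Specht kap) :
    ∃ x : Specht lam, (Φ.φ lam x : TabloidSpace n) = w := by
  subst h
  have key : ∀ nu : Shape n, nu = lam → ∀ y : Specht nu, (Φ.φ nu y : TabloidSpace n) = w →
      ∃ x : Specht lam, (Φ.φ lam x : TabloidSpace n) = w := by
    rintro nu rfl y hy
    exact ⟨y, hy⟩
  exact key _ lam.conj_conj (Φ.φ lam.conj w) (Φ.inverse lam.conj w)

theorem inj {n : ℕ} (lam : Shape n) (v : Specht lam) (h : Φ.φ lam v = 0) : v = 0 := by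
  have := Φ.inverse lam v
  rw [h, map_zero] at this
  exact Subtype.ext this.symm

theorem isCompl_eigenspaces {n : ℕ} (lam : Shape n) (h : lam = lam.conj) :
    IsCompl
      (LinearMap.ker ((Specht lam.conj).subtype ∘ₗ Φ.φ lam - eps 0 • (Specht lam).subtype))
      (LinearMap.ker ((Specht lam.conj).subtype ∘ₗ Φ.φ lam - eps 1 • (Specht lam).subtype)) := by
  constructor
  · rw [Submodule.disjoint_def]
    intro v h0 h1
    simp only [eps, LinearMap.mem_ker, LinearMap.sub_apply, LinearMap.comp_apply,
      Submodule.subtype_apply, LinearMap.smul_apply, sub_eq_zero] at h0 h1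
    rw [h0] at h1
    simp only [if_true, one_smul, one_ne_zero, if_false, neg_smul] at h1
    exact Subtype.ext (self_eq_neg.1 h1)
  · rw [codisjoint_iff, eq_top_iff]
    intro v _
    -- `w` is `φ v`, seen as an element of `S^lam`
    obtain ⟨w, hw⟩ : ∃ w : Specht lam, (w : TabloidSpace n) = Φ.φ lam v :=
      ⟨⟨Φ.φ lam v, (congrArg Specht h).ge (Φ.φ lam v).2⟩, rfl⟩
    have hφw : (Φ.φ lam w : TabloidSpace n) = v := by
      have key : ∀ nu : Shape n, nu = lam → ∀ y : Specht nu, (y : TabloidSpace n) = w →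
          (Φ.φ nu y : TabloidSpace n) = Φ.φ lam w := by
        rintro nu rfl y hy
        rw [Subtype.ext hy]
      rw [← key lam.conj h.symm (Φ.φ lam v) hw.symm]
      exact Φ.inverse lam v
    refine Submodule.mem_sup.2 ⟨(1 / 2 : ℂ) • (v + w), ?_, (1 / 2 : ℂ) • (v - w), ?_, ?_⟩
    · simp only [eps, LinearMap.mem_ker, LinearMap.sub_apply, LinearMap.comp_apply,
        Submodule.subtype_apply, map_smul, map_add, hφw, hw, if_true, one_smul]
      module
    · simp only [eps, LinearMap.mem_ker, LinearMap.sub_apply, LinearMap.comp_apply,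
        Submodule.subtype_apply, LinearMap.smul_apply, map_smul, map_sub,
        Submodule.coe_smul, Submodule.coe_sub, hφw, hw, one_ne_zero, if_false, neg_smul, one_smul]
      module
    · rw [← smul_add]
      have : v + w + (v - w) = (2 : ℂ) • v := by rw [two_smul]; abel
      rw [this, smul_smul]
      norm_num

/-- For `lam = lam'`: the module `S^lam`, whose even and odd components are the eigenspaces of
`φ^lam` for the eigenvalues `1` and `-1`. -/
def typeM {n : ℕ} (lam : Shape n) (h : lam = lam.conj) :
    Supermodule (Equiv.Perm.sign (α := Fin n)) where
  V := Specht lam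
  ρ := spechtRep lam
  grade i := LinearMap.ker ((Specht lam.conj).subtype ∘ₗ Φ.φ lam - eps i • (Specht lam).subtype)
  isCompl := Φ.isCompl_eigenspaces lam h
  map_grade σ i v hv := by
    simp only [LinearMap.mem_ker, LinearMap.sub_apply, LinearMap.comp_apply,
      Submodule.subtype_apply, LinearMap.smul_apply, sub_eq_zero] at hv ⊢
    have h2 : (spechtRep lam.conj σ (Φ.φ lam v) : TabloidSpace n) =
        eps i • (spechtRep lam σ v : TabloidSpace n) := by
      show tabloidRep n σ (Φ.φ lam v : TabloidSpace n) = eps i • tabloidRep n σ (v : TabloidSpace n)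
      rw [hv, map_smul]
    rw [Φ.intertwine, Submodule.coe_smul, h2, smul_smul, eps_add_parity]

theorem isCompl_graphs {n : ℕ} (lam : Shape n) :
    IsCompl (LinearMap.graph (eps 0 • Φ.φ lam)) (LinearMap.graph (eps 1 • Φ.φ lam)) := by
  constructor
  · rw [Submodule.disjoint_def]
    rintro ⟨u, w⟩ h0 h1
    simp only [eps, LinearMap.mem_graph_iff, LinearMap.smul_apply, if_true, one_smul,
      one_ne_zero, if_false, neg_smul] at h0 h1
    have h2 : Φ.φ lam u = 0 := by
      rw [h0] at h1
      exact Subtype.ext (self_eq_neg.1 (congrArg Subtype.val h1))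
    rw [h2] at h0
    rw [h0, Φ.inj lam u h2]
    rfl
  · rw [codisjoint_iff, eq_top_iff]
    rintro ⟨u, w⟩ _
    obtain ⟨x, hx⟩ := Φ.surj lam _ rfl w
    have hx : Φ.φ lam x = w := Subtype.ext hx
    refine Submodule.mem_sup.2 ⟨((1 / 2 : ℂ) • (u + x), (1 / 2 : ℂ) • Φ.φ lam (u + x)), ?_,
      ((1 / 2 : ℂ) • (u - x), -((1 / 2 : ℂ) • Φ.φ lam (u - x))), ?_, ?_⟩
    · simp only [LinearMap.mem_graph_iff, eps, LinearMap.smul_apply, map_smul, if_true, one_smul]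
    · simp only [LinearMap.mem_graph_iff, eps, LinearMap.smul_apply, map_smul, one_ne_zero, if_false,
        neg_smul, one_smul]
      rw [smul_neg]
    · refine Prod.ext ?_ ?_
      · show (1 / 2 : ℂ) • (u + x) + (1 / 2 : ℂ) • (u - x) = u
        module
      · show (1 / 2 : ℂ) • Φ.φ lam (u + x) + -((1 / 2 : ℂ) • Φ.φ lam (u - x)) = w
        rw [map_add, map_sub, hx]
        module

/-- For `lam ≠ lam'`: the module `S^lam ⊕ S^lam'`, whose even component is `{u + φ^lam(u)}` and
whose odd component is `{u - φ^lam(u)}`, for `u` in `S^lam`. -/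
def typeQ {n : ℕ} (lam : Shape n) : Supermodule (Equiv.Perm.sign (α := Fin n)) where
  V := Specht lam × Specht lam.conj
  ρ := (spechtRep lam).prod (spechtRep lam.conj)
  grade i := LinearMap.graph (eps i • Φ.φ lam)
  isCompl := Φ.isCompl_graphs lam
  map_grade σ i v hv := by
    rw [LinearMap.mem_graph_iff] at hv ⊢
    show spechtRep lam.conj σ v.2 = eps (i + parity (Equiv.Perm.sign σ)) •
      Φ.φ lam (spechtRep lam σ v.1)
    rw [hv, Φ.intertwine, LinearMap.smul_apply, map_smul, eps_add_parity, smul_smul]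
    have hs : ((((Equiv.Perm.sign σ : ℤˣ) : ℤ) : ℂ) * eps i *
        (((Equiv.Perm.sign σ : ℤˣ) : ℤ) : ℂ)) = eps i := by
      rcases Int.units_eq_one_or (Equiv.Perm.sign σ) with h | h <;> simp [h]
    rw [hs]

open Classical in
/-- The construction of `W^lam` from the partition `lam`. -/
def ofPartition {n : ℕ} (lam : Shape n) : Supermodule (Equiv.Perm.sign (α := Fin n)) :=
  if h : lam = lam.conj then Φ.typeM lam h else Φ.typeQ lam

open Classical in
/-- The supermodule `W^lam` attached to the class `{lam, lam'}`, constructed from the member of the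
class that lies in the set `R` of representatives. -/
def W {n : ℕ} (R : Set (Shape n)) (lam : Shape n) : Supermodule (Equiv.Perm.sign (α := Fin n)) :=
  if lam ∈ R then Φ.ofPartition lam else Φ.ofPartition lam.conj

end Associators

/-- The restriction of a `ℂS_{n+1}`-supermodule to `ℂS_n`. -/
def down {n : ℕ} (M : Supermodule (Equiv.Perm.sign (α := Fin (n + 1)))) :
    Supermodule (Equiv.Perm.sign (α := Fin n)) :=
  M.restrict (inclusion n) (sign_inclusion n)

end SuperSym

end

/-!
A `ℂS_n`-supermodule is a representation together with an involution that commutes with the even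
permutations and anticommutes with the odd ones, its parity involution. An even homomorphism out of
`W^mu` therefore needs only one equivariant embedding `j` of `S^mu`, since the parity involutions
determine its value on `S^mu'` (or force `j` to commute with the associators, when `mu = mu'`).
Restricting `S^lam` to `ℂS_{n-1}` gives every `S^mu` with `mu ≺ lam` exactly once, so in this way
every summand on the right-hand side maps to the restriction of `W^lam`. The summands are simple
and pairwise not isomorphic, hence their images are independent, and they span because they contain
all the Specht submodules of the restriction. For `lam = lam'`, the self-conjugate `mu ≺ lam` has
residue `0`, and conjugation exchanges the signs of the residues of the others, so the condition
`res(lam/mu) ≥ 0` selects one representative of each class `{mu, mu'}`.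
-/

noncomputable section

namespace SuperSym

open scoped MonoidAlgebra

/-! ### Simple modules -/

section SimpleModules

variable {R ι N : Type*} {M : ι → Type*} [Ring R] [∀ i, AddCommGroup (M i)]
  [∀ i, Module R (M i)] [AddCommGroup N] [Module R N]

theorem iSupIndep_range_of_isEmpty_linearEquiv [∀ i, IsSimpleModule R (M i)]
    {f : ∀ i, M i →ₗ[R] N} (hf : ∀ i, f i ≠ 0)
    (hM : Pairwise fun i j => IsEmpty (M i ≃ₗ[R] M j)) :
    iSupIndep fun i => LinearMap.range (f i) := by
  let e i : M i ≃ₗ[R] LinearMap.range (f i) :=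
    .ofInjective (f i) ((LinearMap.injective_or_eq_zero (f i)).resolve_right (hf i))
  have simple i : IsSimpleModule R (LinearMap.range (f i)) := .congr (e i).symm
  let c i : isotypicComponents R N :=
    ⟨isotypicComponent R N (LinearMap.range (f i)), _, simple i, rfl⟩
  have c_injective : Function.Injective c := fun i j hij => by
    by_contra hne
    have le : LinearMap.range (f i) ≤ isotypicComponent R N (LinearMap.range (f j)) :=
      (Submodule.le_isotypicComponent _).trans_eq (congrArg Subtype.val hij)
    obtain ⟨e'⟩ := isIsotypicOfType_submodule_iff.mp (.isotypicComponent R N _) _ le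
    exact (hM hne).false ((e i).trans (e'.trans (e j).symm))
  exact (((sSupIndep_iff _).mp (sSupIndep_isotypicComponents R N)).comp c_injective).mono
    fun i => Submodule.le_isotypicComponent _

theorem toModule_injective_of_iSupIndep [DecidableEq ι] {f : ∀ i, M i →ₗ[R] N}
    (hf : ∀ i, Function.Injective (f i)) (h : iSupIndep fun i => LinearMap.range (f i)) :
    Function.Injective (DirectSum.toModule R ι N f) := by
  have factor : DirectSum.toModule R ι N f =
      DFinsupp.lsum ℕ (fun i => (LinearMap.range (f i)).subtype) ∘ₗ
        DFinsupp.mapRange.linearMap (fun i => (f i).rangeRestrict) := by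
    refine DFinsupp.lhom_ext fun i x => ?_
    rw [LinearMap.comp_apply, DFinsupp.mapRange.linearMap_apply, DFinsupp.mapRange_single]
    rw [DFinsupp.lsum_single]
    exact DirectSum.toModule_lof R i x
  rw [factor, LinearMap.coe_comp]
  exact h.dfinsupp_lsum_injective.comp <| (DFinsupp.mapRange_injective _ fun i => map_zero _).2
    fun i => (LinearMap.injective_rangeRestrict_iff _).2 (hf i)

end SimpleModules

section Representations

variable {k G ι W : Type*} {V : ι → Type*} [Field k] [Monoid G] [DecidableEq ι]
  [∀ i, AddCommGroup (V i)] [∀ i, Module k (V i)] [AddCommGroup W] [Module k W]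
  {ρ : ∀ i, Representation k G (V i)} {τ : Representation k G W}

theorem toModule_injective_of_isIrreducible [∀ i, (ρ i).IsIrreducible]
    {f : ∀ i, (ρ i).IntertwiningMap τ} (hf : ∀ i, f i ≠ 0)
    (hρ : Pairwise fun i j => IsEmpty ((ρ i).Equiv (ρ j))) :
    Function.Injective (DirectSum.toModule k ι W fun i => (f i).toLinearMap) := by
  let F i : (ρ i).asModule →ₗ[k[G]] τ.asModule :=
    Representation.IntertwiningMap.equivLinearMapAsModule (ρ i) τ (f i)
  have F_ne i : F i ≠ 0 := fun h => hf i ((LinearEquiv.map_eq_zero_iff _).1 h)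
  have nonisomorphic : Pairwise fun i j => IsEmpty ((ρ i).asModule ≃ₗ[k[G]] (ρ j).asModule) :=
    fun i j hij => ⟨fun e => (hρ hij).false <|
      ((Representation.IntertwiningMap.equivLinearMapAsModule (ρ i) (ρ j)).symm
        (e : (ρ i).asModule →ₗ[k[G]] (ρ j).asModule)).ofBijective e.bijective⟩
  exact toModule_injective_of_iSupIndep (f := F)
    (fun i => (LinearMap.injective_or_eq_zero (F i)).resolve_right (F_ne i))
    (iSupIndep_range_of_isEmpty_linearEquiv F_ne nonisomorphic)

end Representations

section Maschke

variable {k G V W : Type*} [Field k] [Group G] [Finite G] [NeZero (Nat.card G : k)]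
  [AddCommGroup V] [Module k V] [AddCommGroup W] [Module k W]
  {ρ : Representation k G V} {τ : Representation k G W}

theorem exists_comp_comp_eq (f : ρ.IntertwiningMap τ) :
    ∃ g : τ.IntertwiningMap ρ, f.comp (g.comp f) = f := by
  let F := Representation.IntertwiningMap.equivLinearMapAsModule ρ τ f
  have : Module.Projective k[G] (LinearMap.range F) := Module.projective_of_isSemisimpleRing ..
  obtain ⟨S, hS⟩ := F.rangeRestrict.exists_rightInverse_of_surjective F.range_rangeRestrict
  obtain ⟨C, hC⟩ := exists_isCompl (LinearMap.range F)
  refine ⟨(Representation.IntertwiningMap.equivLinearMapAsModule τ ρ).symm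
    (S ∘ₗ (LinearMap.range F).projectionOnto C hC), ?_⟩
  ext v
  have proj_F : (LinearMap.range F).projectionOnto C hC (F v) = F.rangeRestrict v :=
    Submodule.projectionOnto_apply_left hC (F.rangeRestrict v)
  have F_S : F (S (F.rangeRestrict v)) = F v :=
    congrArg Subtype.val (LinearMap.congr_fun hS (F.rangeRestrict v))
  exact (congrArg (fun w => F (S w)) proj_F).trans F_S

theorem exists_projection_subrepresentation (U : Subrepresentation ρ) :
    ∃ q : ρ.IntertwiningMap ρ, (∀ v, q v ∈ U.toSubmodule) ∧ ∀ v ∈ U.toSubmodule, q v = v := by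
  let f : U.toRepresentation.IntertwiningMap ρ := ⟨U.toSubmodule.subtype, fun _ => rfl⟩
  obtain ⟨g, hg⟩ := exists_comp_comp_eq f
  exact ⟨f.comp g, fun v => (g v).2, fun v hv => DFunLike.congr_fun hg ⟨v, hv⟩⟩

end Maschke

/-! ### Specht modules -/

/-- The sign of a permutation as a complex number. -/
abbrev sgn {n : ℕ} (σ : Equiv.Perm (Fin n)) : ℂ := (((Equiv.Perm.sign σ : ℤˣ) : ℤ) : ℂ)

theorem sgn_mul {n : ℕ} (σ τ : Equiv.Perm (Fin n)) : sgn (σ * τ) = sgn σ * sgn τ := by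
  simp [sgn]

theorem sgn_mul_self {n : ℕ} (σ : Equiv.Perm (Fin n)) : sgn σ * sgn σ = 1 := by
  rcases Int.units_eq_one_or (Equiv.Perm.sign σ) with h | h <;> simp [sgn, h]

theorem tabloidRep_apply {n : ℕ} (σ : Equiv.Perm (Fin n)) (u : TabloidSpace n) (f : Fin n → ℕ) :
    tabloidRep n σ u f = u (f ∘ σ) := rfl

namespace Tableau

variable {n : ℕ} {lam mu : Shape n} {t : Tableau lam} {σ τ : Equiv.Perm (Fin n)}

instance : Nonempty (Tableau lam) := ⟨Finset.equivFinOfCardEq lam.2⟩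

theorem exists_eq_trans (t s : Tableau lam) : ∃ σ : Equiv.Perm (Fin n), s = t.trans σ :=
  ⟨t.symm.trans s, by ext; simp⟩

theorem ext_letter (t : Tableau lam) {k l : Fin n} (hrow : t.row k = t.row l)
    (hcol : t.col k = t.col l) : k = l :=
  t.symm.injective (Subtype.ext (Prod.ext hrow hcol))

@[simp] theorem row_apply (t : Tableau lam) (c : {c // c ∈ lam.1.cells}) :
    t.row (t c) = c.1.1 := by
  simp [row]

@[simp] theorem col_apply (t : Tableau lam) (c : {c // c ∈ lam.1.cells}) :
    t.col (t c) = c.1.2 := by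
  simp [col]

theorem row_trans (t : Tableau lam) (σ : Equiv.Perm (Fin n)) :
    Tableau.row (t.trans σ : Tableau lam) = t.row ∘ ⇑σ⁻¹ := rfl

theorem row_lt_colLen_col (t : Tableau lam) (k : Fin n) : t.row k < lam.1.colLen (t.col k) :=
  YoungDiagram.mem_iff_lt_colLen.1 ((YoungDiagram.mem_cells _).1 (t.symm k).2)

theorem exists_row_eq_col_eq (t : Tableau lam) {i j : ℕ} (h : i < lam.1.colLen j) :
    ∃ k, t.row k = i ∧ t.col k = j :=
  ⟨t ⟨(i, j), (YoungDiagram.mem_cells _).2 (YoungDiagram.mem_iff_lt_colLen.2 h)⟩, by simp⟩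

theorem mem_colStab : σ ∈ t.colStab ↔ t.col ∘ σ = t.col := by
  simp [colStab, funext_iff]

theorem one_mem_colStab (t : Tableau lam) : 1 ∈ t.colStab := mem_colStab.2 rfl

theorem card_colStab_ne_zero (t : Tableau lam) : (t.colStab.card : ℂ) ≠ 0 :=
  Nat.cast_ne_zero.2 (Finset.card_ne_zero_of_mem t.one_mem_colStab)

theorem mul_mem_colStab_iff (hσ : σ ∈ t.colStab) : σ * τ ∈ t.colStab ↔ τ ∈ t.colStab := by
  rw [mem_colStab, mem_colStab, Equiv.Perm.coe_mul, ← Function.comp_assoc, mem_colStab.1 hσ]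

/-- The signed sum over the column stabilizer of `t`, acting on a representation of `S_n`. -/
def antisymmetrizer {V : Type*} [AddCommGroup V] [Module ℂ V] (t : Tableau lam)
    (ρ : Representation ℂ (Equiv.Perm (Fin n)) V) : Module.End ℂ V :=
  ∑ σ ∈ t.colStab, sgn σ • ρ σ

theorem map_antisymmetrizer {V W : Type*} [AddCommGroup V] [Module ℂ V] [AddCommGroup W]
    [Module ℂ W] {ρ : Representation ℂ (Equiv.Perm (Fin n)) V}
    {τ : Representation ℂ (Equiv.Perm (Fin n)) W} (T : ρ.IntertwiningMap τ) (t : Tableau lam)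
    (v : V) : T (t.antisymmetrizer ρ v) = t.antisymmetrizer τ (T v) := by
  simp only [antisymmetrizer, LinearMap.sum_apply, LinearMap.smul_apply, map_sum, map_smul,
    T.isIntertwining]

theorem antisymmetrizer_tabloidRep_apply (t : Tableau lam) (u : TabloidSpace n)
    (f : Fin n → ℕ) :
    t.antisymmetrizer (tabloidRep n) u f = ∑ σ ∈ t.colStab, sgn σ * u (f ∘ σ) := by
  simp [antisymmetrizer, LinearMap.sum_apply, Finset.sum_apply, tabloidRep_apply]

theorem antisymmetrizer_tabloid (t : Tableau lam) :
    t.antisymmetrizer (tabloidRep n) t.tabloid = polytabloid t := by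
  simp [polytabloid, antisymmetrizer, LinearMap.sum_apply]

theorem antisymmetrizer_tabloidRep_apply_comp (t : Tableau lam) (u : TabloidSpace n)
    (f : Fin n → ℕ) (hσ : σ ∈ t.colStab) :
    t.antisymmetrizer (tabloidRep n) u (f ∘ σ) =
      sgn σ * t.antisymmetrizer (tabloidRep n) u f := by
  rw [antisymmetrizer_tabloidRep_apply, antisymmetrizer_tabloidRep_apply, Finset.mul_sum]
  refine Finset.sum_equiv (Equiv.mulLeft σ) (fun τ => (mul_mem_colStab_iff hσ).symm) fun τ _ => ?_
  rw [Equiv.coe_mulLeft, sgn_mul, ← mul_assoc, ← mul_assoc, sgn_mul_self, one_mul]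
  rfl

/-- Distinct letters in the same column of `t` have distinct values under `f`. -/
def ColInjective (t : Tableau lam) (f : Fin n → ℕ) : Prop :=
  ∀ ⦃k l⦄, t.col k = t.col l → f k = f l → k = l

/-- Otherwise a transposition in the column stabilizer fixes `f`, and forces the value at `f` to
equal its own negative. -/
theorem colInjective_of_antisymmetrizer_ne_zero {u : TabloidSpace n} {f : Fin n → ℕ}
    (h : t.antisymmetrizer (tabloidRep n) u f ≠ 0) : t.ColInjective f := by
  intro k l hcol hf
  by_contra hkl
  have comp_swap {g : Fin n → ℕ} (hg : g k = g l) : g ∘ Equiv.swap k l = g := by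
    simp [Equiv.comp_swap_eq_update, hg]
  have eq_neg := t.antisymmetrizer_tabloidRep_apply_comp u f (mem_colStab.2 (comp_swap hcol))
  rw [comp_swap hf, sgn, Equiv.Perm.sign_swap hkl] at eq_neg
  exact h (self_eq_neg.1 (by simpa using eq_neg))

end Tableau

/-- The number of cells in the first `r` rows: the partial sum `lam_1 + ... + lam_r` that defines
the dominance order. -/
def Shape.rowLenSum {n : ℕ} (lam : Shape n) (r : ℕ) : ℕ := ∑ i ∈ Finset.range r, lam.1.rowLen i

theorem Shape.ext_rowLenSum {n : ℕ} {lam mu : Shape n}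
    (h : ∀ r, lam.rowLenSum r = mu.rowLenSum r) : lam = mu := by
  have rowLen_eq (i : ℕ) : lam.1.rowLen i = mu.1.rowLen i := by
    have := h (i + 1)
    rwa [rowLenSum, rowLenSum, Finset.sum_range_succ, Finset.sum_range_succ, ← rowLenSum,
      ← rowLenSum, h, add_right_inj] at this
  refine Subtype.ext (YoungDiagram.ext (Finset.ext fun ⟨i, j⟩ => ?_))
  rw [YoungDiagram.mem_cells, YoungDiagram.mem_cells, YoungDiagram.mem_iff_lt_rowLen,
    YoungDiagram.mem_iff_lt_rowLen, rowLen_eq]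

namespace Tableau

variable {n : ℕ} {lam mu : Shape n}

theorem card_row_eq (t : Tableau lam) (i : ℕ) :
    (Finset.univ.filter fun k => t.row k = i).card = lam.1.rowLen i := by
  rw [YoungDiagram.rowLen_eq_card]
  refine Finset.card_bij (fun k _ => (t.symm k).1) (fun k hk => ?_)
    (fun k _ l _ h => t.symm.injective (Subtype.ext h)) fun c hc => ?_
  · exact YoungDiagram.mem_row_iff.2
      ⟨(YoungDiagram.mem_cells _).1 (t.symm k).2, (Finset.mem_filter.1 hk).2⟩
  · obtain ⟨hc, hrow⟩ := YoungDiagram.mem_row_iff.1 hc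
    exact ⟨t ⟨c, (YoungDiagram.mem_cells _).2 hc⟩, by simpa using hrow, by simp⟩

theorem card_row_lt (t : Tableau lam) (r : ℕ) :
    (Finset.univ.filter fun k => t.row k < r).card = lam.rowLenSum r := by
  rw [Finset.card_eq_sum_card_fiberwise (f := t.row) (t := Finset.range r) (by intro k; simp)]
  refine Finset.sum_congr rfl fun i hi => ?_
  rw [← t.card_row_eq, Finset.filter_filter]
  refine congrArg Finset.card (Finset.filter_congr fun k _ => ?_)
  rw [Finset.mem_range] at hi
  omega

theorem card_lt_eq_sum_col (t : Tableau lam) (f : Fin n → ℕ) (r : ℕ) :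
    (Finset.univ.filter fun k => f k < r).card = ∑ j ∈ Finset.univ.image t.col,
      (Finset.univ.filter fun k => t.col k = j ∧ f k < r).card := by
  rw [Finset.card_eq_sum_card_fiberwise (f := t.col) (t := Finset.univ.image t.col)
    fun k _ => Finset.mem_coe.2 (Finset.mem_image_of_mem _ (Finset.mem_univ k))]
  simp only [Finset.filter_filter, and_comm]

theorem card_col_lt_le (t : Tableau lam) {f : Fin n → ℕ} (hf : t.ColInjective f) (j r : ℕ) :
    (Finset.univ.filter fun k => t.col k = j ∧ f k < r).card ≤
      (Finset.univ.filter fun k => t.col k = j ∧ t.row k < r).card := by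
  rcases le_or_gt r (lam.1.colLen j) with hr | hr
  · calc (Finset.univ.filter fun k => t.col k = j ∧ f k < r).card
      _ ≤ (Finset.range r).card := by
        refine Finset.card_le_card_of_injOn f (fun k hk => ?_) fun k hk l hl h => ?_
        · simpa using (Finset.mem_filter.1 hk).2.2
        · exact hf ((Finset.mem_filter.1 hk).2.1.trans (Finset.mem_filter.1 hl).2.1.symm) h
      _ ≤ (Finset.univ.filter fun k => t.col k = j ∧ t.row k < r).card := by
        refine Finset.card_le_card_of_surjOn t.row fun i hi => ?_
        have hi : i < r := by simpa using hi
        obtain ⟨k, hrow, hcol⟩ := t.exists_row_eq_col_eq (hi.trans_le hr)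
        exact ⟨k, by simp [hrow, hcol, hi], hrow⟩
  · refine Finset.card_le_card (Finset.monotone_filter_right _ fun k _ hk => ⟨hk.1, ?_⟩)
    exact (hk.1 ▸ t.row_lt_colLen_col k).trans hr

theorem rowLenSum_le (t : Tableau lam) (s : Tableau mu) (h : t.ColInjective s.row) (r : ℕ) :
    mu.rowLenSum r ≤ lam.rowLenSum r := by
  rw [← s.card_row_lt, ← t.card_row_lt, t.card_lt_eq_sum_col, t.card_lt_eq_sum_col t.row]
  exact Finset.sum_le_sum fun j _ => t.card_col_lt_le h j r

theorem ColInjective.row_lt_colLen_col {t s : Tableau lam} (h : t.ColInjective s.row)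
    (k : Fin n) : s.row k < lam.1.colLen (t.col k) := by
  set r := lam.1.colLen (t.col k)
  have card_eq : (Finset.univ.filter fun l => t.col l = t.col k ∧ s.row l < r).card =
      (Finset.univ.filter fun l => t.col l = t.col k ∧ t.row l < r).card :=
    (Finset.sum_eq_sum_iff_of_le fun j _ => t.card_col_lt_le h j r).1
      (by rw [← t.card_lt_eq_sum_col, ← t.card_lt_eq_sum_col, s.card_row_lt, t.card_row_lt])
      (t.col k) (Finset.mem_image_of_mem _ (Finset.mem_univ k))
  have subset : (Finset.univ.filter fun l => t.col l = t.col k ∧ s.row l < r) ⊆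
      Finset.univ.filter fun l => t.col l = t.col k ∧ t.row l < r :=
    Finset.monotone_filter_right _ fun l _ hl =>
      ⟨hl.1, (t.row_lt_colLen_col l).trans_eq (by rw [hl.1])⟩
  have mem : k ∈ Finset.univ.filter fun l => t.col l = t.col k ∧ t.row l < r := by
    simp [r, t.row_lt_colLen_col k]
  rw [← Finset.eq_of_subset_of_card_le subset card_eq.ge] at mem
  exact (Finset.mem_filter.1 mem).2.2

theorem exists_mem_colStab_of_colInjective {t s : Tableau lam} (h : t.ColInjective s.row) :
    ∃ σ ∈ t.colStab, s.row = t.row ∘ σ := by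
  choose σ row_σ col_σ using fun k => t.exists_row_eq_col_eq (h.row_lt_colLen_col k)
  have σ_injective : Function.Injective σ := fun k l hkl =>
    h (by rw [← col_σ, hkl, col_σ]) (by rw [← row_σ, hkl, row_σ])
  exact ⟨.ofBijective σ (Finite.injective_iff_bijective.1 σ_injective),
    mem_colStab.2 (funext col_σ), (funext row_σ).symm⟩

end Tableau

section Specht

variable {n : ℕ} {lam mu : Shape n}

open Tableau

theorem polytabloid_mem_specht (t : Tableau lam) : polytabloid t ∈ Specht lam :=
  Submodule.subset_span ⟨t, rfl⟩

theorem exists_row_eq_of_mem_specht {u : TabloidSpace n} (hu : u ∈ Specht lam)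
    {f : Fin n → ℕ} (hf : u f ≠ 0) : ∃ s : Tableau lam, f = s.row := by
  induction hu using Submodule.span_induction with
  | mem u hu =>
    obtain ⟨t, rfl⟩ := hu
    rw [← antisymmetrizer_tabloid, antisymmetrizer_tabloidRep_apply] at hf
    obtain ⟨σ, -, hσ⟩ := Finset.exists_ne_zero_of_sum_ne_zero hf
    have comp_eq : f ∘ σ = t.row := by
      by_contra h
      exact hσ (by rw [tabloid, Pi.single_eq_of_ne h, mul_zero])
    exact ⟨t.trans σ, by rw [row_trans, ← comp_eq]; ext k; simp⟩
  | zero => exact (hf rfl).elim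
  | add u v _ _ hu hv =>
    by_cases h : u f = 0
    · exact hv fun h' => hf (by rw [Pi.add_apply, h, h', add_zero])
    · exact hu h
  | smul c u _ hu => exact hu fun h => hf (by rw [Pi.smul_apply, h, smul_zero])

theorem polytabloid_apply_row (t : Tableau lam) : polytabloid t t.row = 1 := by
  rw [← antisymmetrizer_tabloid, antisymmetrizer_tabloidRep_apply, Finset.sum_eq_single 1]
  · simp [tabloid, sgn]
  · intro σ hσ h1
    rw [tabloid, Pi.single_eq_of_ne, mul_zero]
    exact fun h => h1 (Equiv.ext fun k =>
      t.ext_letter (congrFun h k) (congrFun (mem_colStab.1 hσ) k))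
  · exact fun h => (h t.one_mem_colStab).elim

/-- By `exists_mem_colStab_of_colInjective`, an antisymmetrized element of the Specht module is
determined by its value at the tabloid of `t`. -/
theorem antisymmetrizer_eq_smul_polytabloid (t : Tableau lam) {u : TabloidSpace n}
    (hu : t.antisymmetrizer (tabloidRep n) u ∈ Specht lam) :
    t.antisymmetrizer (tabloidRep n) u =
      t.antisymmetrizer (tabloidRep n) u t.row • polytabloid t := by
  set c := t.antisymmetrizer (tabloidRep n) u t.row with hc
  rw [← sub_eq_zero, ← antisymmetrizer_tabloid, ← map_smul, ← map_sub]
  have mem : t.antisymmetrizer (tabloidRep n) (u - c • t.tabloid) ∈ Specht lam := by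
    rw [map_sub, map_smul, antisymmetrizer_tabloid]
    exact sub_mem hu (Submodule.smul_mem _ _ (polytabloid_mem_specht t))
  have row_eq_zero : t.antisymmetrizer (tabloidRep n) (u - c • t.tabloid) t.row = 0 := by
    rw [map_sub, map_smul, antisymmetrizer_tabloid, Pi.sub_apply, Pi.smul_apply,
      polytabloid_apply_row, smul_eq_mul, mul_one, ← hc, sub_self]
  ext f
  by_contra hf
  obtain ⟨s, rfl⟩ := exists_row_eq_of_mem_specht mem hf
  obtain ⟨σ, hσ, hs⟩ := exists_mem_colStab_of_colInjective
    (colInjective_of_antisymmetrizer_ne_zero hf)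
  rw [hs, antisymmetrizer_tabloidRep_apply_comp _ _ _ hσ, row_eq_zero, mul_zero] at hf
  exact hf rfl

/-- The polytabloid `e_t` as an element of the Specht module. -/
def spechtPolytabloid (t : Tableau lam) : Specht lam := ⟨polytabloid t, polytabloid_mem_specht t⟩

theorem spechtPolytabloid_ne_zero (t : Tableau lam) : spechtPolytabloid t ≠ 0 := fun h => by
  have := congrFun (congrArg Subtype.val h) t.row
  exact one_ne_zero ((polytabloid_apply_row t).symm.trans this)

instance : Nontrivial (Specht lam) := ⟨spechtPolytabloid (Classical.arbitrary (Tableau lam)), 0,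
  spechtPolytabloid_ne_zero _⟩

instance : FiniteDimensional ℂ (Specht lam) :=
  FiniteDimensional.span_of_finite ℂ (Set.finite_range _)

theorem spechtRep_spechtPolytabloid (σ : Equiv.Perm (Fin n)) (t : Tableau lam) :
    spechtRep lam σ (spechtPolytabloid t) = spechtPolytabloid (t.trans σ : Tableau lam) :=
  Subtype.ext (tabloidRep_polytabloid σ t)

theorem span_spechtPolytabloid (lam : Shape n) :
    Submodule.span ℂ (Set.range (spechtPolytabloid (lam := lam))) = ⊤ := by
  refine Submodule.map_injective_of_injective (Specht lam).injective_subtype ?_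
  rw [Submodule.map_span, ← Set.range_comp, Submodule.map_top, Submodule.range_subtype]
  rfl

theorem subrepresentation_eq_top_of_spechtPolytabloid_mem
    {U : Subrepresentation (spechtRep lam)} {t : Tableau lam} (h : spechtPolytabloid t ∈ U) :
    U = ⊤ := by
  have span_le : Submodule.span ℂ (Set.range (spechtPolytabloid (lam := lam))) ≤
      U.toSubmodule := by
    rw [Submodule.span_le]
    rintro _ ⟨s, rfl⟩
    obtain ⟨σ, rfl⟩ := t.exists_eq_trans s
    rw [← spechtRep_spechtPolytabloid]
    exact U.apply_mem_toSubmodule σ h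
  rw [span_spechtPolytabloid] at span_le
  exact SetLike.ext fun v => ⟨fun _ => trivial, fun _ => span_le trivial⟩

/-- The Specht module as a subrepresentation of the space of tabloids. -/
def spechtSubtype (lam : Shape n) : (spechtRep lam).IntertwiningMap (tabloidRep n) :=
  ⟨(Specht lam).subtype, fun _ => rfl⟩

theorem exists_antisymmetrizer_specht_eq_smul (t : Tableau lam) (v : Specht lam) :
    ∃ c : ℂ, t.antisymmetrizer (spechtRep lam) v = c • spechtPolytabloid t := by
  have coe : (t.antisymmetrizer (spechtRep lam) v : TabloidSpace n) =
      t.antisymmetrizer (tabloidRep n) (v : TabloidSpace n) :=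
    map_antisymmetrizer (spechtSubtype lam) t v
  refine ⟨_, Subtype.ext (coe.trans (antisymmetrizer_eq_smul_polytabloid t ?_))⟩
  rw [← coe]
  exact Subtype.prop _

theorem antisymmetrizer_spechtPolytabloid (t : Tableau lam) :
    t.antisymmetrizer (spechtRep lam) (spechtPolytabloid t) =
      (t.colStab.card : ℂ) • spechtPolytabloid t := by
  refine Subtype.ext ((map_antisymmetrizer (spechtSubtype lam) t _).trans ?_)
  change t.antisymmetrizer (tabloidRep n) (polytabloid t) = _ • polytabloid t
  have apply_row : t.antisymmetrizer (tabloidRep n) (polytabloid t) t.row = t.colStab.card := by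
    have term_eq_one : ∀ σ ∈ t.colStab, sgn σ * polytabloid t (t.row ∘ σ) = 1 := fun σ hσ => by
      rw [← antisymmetrizer_tabloid, antisymmetrizer_tabloidRep_apply_comp _ _ _ hσ,
        antisymmetrizer_tabloid, polytabloid_apply_row, mul_one, sgn_mul_self]
    rw [antisymmetrizer_tabloidRep_apply, Finset.sum_congr rfl term_eq_one, Finset.sum_const,
      nsmul_one]
  rw [antisymmetrizer_eq_smul_polytabloid, apply_row]
  exact (map_antisymmetrizer (spechtSubtype lam) t (spechtPolytabloid t)) ▸ Subtype.prop _

/-- Decompose `e_t = u + v` along `U` and a complement (Maschke). The antisymmetrizer of `t` maps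
`u` and `v` to multiples of `e_t`, and not both to zero. -/
instance isIrreducible_spechtRep : (spechtRep lam).IsIrreducible where
  exists_pair_ne := by
    obtain ⟨v, hv⟩ := exists_ne (0 : Specht lam)
    exact ⟨⊥, ⊤, fun h => hv ((h.symm ▸ trivial : v ∈ (⊥ : Subrepresentation (spechtRep lam))))⟩
  eq_bot_or_eq_top U := by
    obtain ⟨U', hU⟩ := exists_isCompl U
    obtain ⟨t⟩ := (inferInstance : Nonempty (Tableau lam))
    have eq_top_of_ne_zero {U : Subrepresentation (spechtRep lam)} {u : Specht lam} (hu : u ∈ U)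
        (h : t.antisymmetrizer (spechtRep lam) u ≠ 0) : U = ⊤ := by
      obtain ⟨c, hc⟩ := exists_antisymmetrizer_specht_eq_smul t u
      have c_ne_zero : c ≠ 0 := by rintro rfl; exact h (by rw [hc, zero_smul])
      have mem : t.antisymmetrizer (spechtRep lam) u ∈ U.toSubmodule := by
        rw [antisymmetrizer, LinearMap.sum_apply]
        exact sum_mem fun σ _ => Submodule.smul_mem _ _ (U.apply_mem_toSubmodule σ hu)
      rw [hc, Submodule.smul_mem_iff _ c_ne_zero] at mem
      exact subrepresentation_eq_top_of_spechtPolytabloid_mem mem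
    have mem_sup : spechtPolytabloid t ∈ U.toSubmodule ⊔ U'.toSubmodule := by
      rw [← Subrepresentation.toSubmodule_sup, hU.sup_eq_top]
      trivial
    obtain ⟨u, hu, v, hv, huv⟩ := Submodule.mem_sup.1 mem_sup
    by_cases hu0 : t.antisymmetrizer (spechtRep lam) u = 0
    · refine .inl (eq_bot_of_isCompl_top ((eq_top_of_ne_zero hv fun hv0 => ?_) ▸ hU))
      refine smul_ne_zero t.card_colStab_ne_zero (spechtPolytabloid_ne_zero t) ?_
      rw [← antisymmetrizer_spechtPolytabloid, ← huv, map_add, hu0, hv0, add_zero]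
    · exact .inr (eq_top_of_ne_zero hu hu0)

theorem rowLenSum_le_of_intertwiningMap_ne_zero
    {T : (spechtRep lam).IntertwiningMap (spechtRep mu)} (hT : T ≠ 0) (r : ℕ) :
    mu.rowLenSum r ≤ lam.rowLenSum r := by
  obtain ⟨t, ht⟩ : ∃ t, T (spechtPolytabloid t) ≠ 0 := by
    by_contra! h
    refine hT (Representation.IntertwiningMap.ext (LinearMap.ext_on_range
      (span_spechtPolytabloid lam) fun t => ?_))
    exact h t
  have ne_zero :
      t.antisymmetrizer (tabloidRep n) (T (spechtPolytabloid t) : TabloidSpace n) ≠ 0 := by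
    have eq := map_antisymmetrizer ((spechtSubtype mu).comp T) t (spechtPolytabloid t)
    rw [antisymmetrizer_spechtPolytabloid, map_smul] at eq
    exact eq ▸ smul_ne_zero t.card_colStab_ne_zero fun h => ht (Subtype.ext h)
  obtain ⟨f, hf⟩ := Function.ne_iff.1 ne_zero
  have mem : t.antisymmetrizer (tabloidRep n) (T (spechtPolytabloid t) : TabloidSpace n) ∈
      Specht mu :=
    (map_antisymmetrizer (spechtSubtype mu) t (T (spechtPolytabloid t))) ▸ Subtype.prop _
  obtain ⟨s, rfl⟩ := exists_row_eq_of_mem_specht mem hf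
  exact t.rowLenSum_le s (colInjective_of_antisymmetrizer_ne_zero hf) r

theorem eq_of_spechtRep_equiv (e : (spechtRep lam).Equiv (spechtRep mu)) : lam = mu := by
  have ne_zero {V W : Type} [AddCommGroup V] [Module ℂ V] [AddCommGroup W] [Module ℂ W]
      [Nontrivial V] {ρ : Representation ℂ (Equiv.Perm (Fin n)) V}
      {τ : Representation ℂ (Equiv.Perm (Fin n)) W} (e : ρ.Equiv τ) :
      e.toIntertwiningMap ≠ 0 := fun h => by
    obtain ⟨v, hv⟩ := exists_ne (0 : V)
    exact hv (e.toLinearEquiv.map_eq_zero_iff.1 (DFunLike.congr_fun h v))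
  exact Shape.ext_rowLenSum fun r =>
    le_antisymm (rowLenSum_le_of_intertwiningMap_ne_zero (ne_zero e.symm) r)
      (rowLenSum_le_of_intertwiningMap_ne_zero (ne_zero e) r)

theorem eq_of_intertwiningMap_ne_zero {T : (spechtRep lam).IntertwiningMap (spechtRep mu)}
    (hT : T ≠ 0) : lam = mu :=
  eq_of_spechtRep_equiv
    (T.ofBijective ((Representation.IsIrreducible.bijective_or_eq_zero T).resolve_right hT))

theorem exists_eq_smul_of_intertwiningMap (T : (spechtRep lam).IntertwiningMap (spechtRep lam)) :
    ∃ c : ℂ, ∀ v, T v = c • v := by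
  obtain ⟨c, rfl⟩ :=
    (Representation.IsIrreducible.algebraMap_intertwiningMap_bijective_of_isAlgClosed).2 T
  exact ⟨c, fun v => rfl⟩

end Specht

section Inclusion

variable {n : ℕ}

theorem inclusion_castSucc (σ : Equiv.Perm (Fin n)) (k : Fin n) :
    inclusion n σ k.castSucc = (σ k).castSucc :=
  Equiv.Perm.viaEmbedding_apply σ Fin.castSuccEmb k

theorem inclusion_last (σ : Equiv.Perm (Fin n)) : inclusion n σ (Fin.last n) = Fin.last n :=
  Equiv.Perm.viaEmbedding_apply_of_notMem σ Fin.castSuccEmb _ (by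
    rintro ⟨k, hk⟩
    exact Fin.castSucc_ne_last k hk)

theorem inclusion_injective : Function.Injective (inclusion n) :=
  Equiv.Perm.viaEmbeddingHom_injective Fin.castSuccEmb

theorem exists_inclusion_eq {σ : Equiv.Perm (Fin (n + 1))} (h : σ (Fin.last n) = Fin.last n) :
    ∃ τ : Equiv.Perm (Fin n), inclusion n τ = σ := by
  have ne_last (k : Fin n) : σ k.castSucc ≠ Fin.last n := fun hk =>
    Fin.castSucc_ne_last k (σ.injective (hk.trans h.symm))
  have injective : Function.Injective fun k : Fin n => (σ k.castSucc).castPred (ne_last k) :=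
    fun k l hkl => Fin.castSucc_injective n (σ.injective (Fin.castPred_inj.1 hkl))
  refine ⟨Equiv.ofBijective _ (Finite.injective_iff_bijective.1 injective), Equiv.ext fun k => ?_⟩
  induction k using Fin.lastCases with
  | last => rw [inclusion_last, h]
  | cast k => rw [inclusion_castSucc, Equiv.ofBijective_apply, Fin.castSucc_castPred]

theorem snoc_comp_inclusion (f : Fin n → ℕ) (r : ℕ) (σ : Equiv.Perm (Fin n)) :
    (Fin.snoc f r : Fin (n + 1) → ℕ) ∘ ⇑(inclusion n σ) = Fin.snoc (f ∘ ⇑σ) r := by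
  funext k
  induction k using Fin.lastCases with
  | last => simp only [Function.comp_apply, inclusion_last, Fin.snoc_last]
  | cast k => simp only [Function.comp_apply, inclusion_castSucc, Fin.snoc_castSucc]

/-- Taking the coefficients at the tabloids with the last letter in row `r`. -/
def lastRow (n r : ℕ) :
    Representation.IntertwiningMap ((tabloidRep (n + 1)).comp (inclusion n)) (tabloidRep n) where
  toLinearMap := LinearMap.funLeft ℂ ℂ fun f : Fin n → ℕ => (Fin.snoc f r : Fin (n + 1) → ℕ)
  isIntertwining' σ := LinearMap.ext fun u => funext fun f =>
    congrArg u (snoc_comp_inclusion f r σ)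

theorem lastRow_apply (r : ℕ) (u : TabloidSpace (n + 1)) (f : Fin n → ℕ) :
    lastRow n r u f = u (Fin.snoc f r : Fin (n + 1) → ℕ) := rfl

end Inclusion

namespace Tableau

variable {n : ℕ} {mu : Shape n} {lam : Shape (n + 1)} {c : ℕ × ℕ}

/-- The extension of a tableau by the last letter in an added cell `c`. -/
def extend (hc : c ∈ lam.1.cells) (h : mu.1.cells = lam.1.cells.erase c) (s : Tableau mu) :
    Tableau lam :=
  (Equiv.ofBijective
    (Fin.snoc (fun k => ⟨(s.symm k).1, Finset.mem_of_mem_erase (h.le (s.symm k).2)⟩) ⟨c, hc⟩ :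
      Fin (n + 1) → {d // d ∈ lam.1.cells}) <| by
    refine (Fintype.bijective_iff_injective_and_card _).2 ⟨Fin.snoc_injective_iff.2 ⟨?_, ?_⟩, ?_⟩
    · intro k l hkl
      exact s.symm.injective (Subtype.ext (congrArg Subtype.val hkl :))
    · rintro ⟨k, hk⟩
      exact Finset.ne_of_mem_erase (h.le (s.symm k).2) (congrArg Subtype.val hk)
    · rw [Fintype.card_coe, Fintype.card_fin]
      exact lam.2.symm).symm

variable (hc : c ∈ lam.1.cells) (h : mu.1.cells = lam.1.cells.erase c) (s : Tableau mu)

theorem extend_symm_last : ((extend hc h s).symm (Fin.last n)).1 = c := by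
  simp [extend]

theorem extend_symm_castSucc (k : Fin n) :
    ((extend hc h s).symm k.castSucc).1 = (s.symm k).1 := by
  simp [extend]

theorem row_extend : (extend hc h s).row = (Fin.snoc s.row c.1 : Fin (n + 1) → ℕ) := by
  funext k
  induction k using Fin.lastCases with
  | last => rw [row, extend_symm_last, Fin.snoc_last]
  | cast k => rw [row, extend_symm_castSucc, Fin.snoc_castSucc, row]

theorem col_extend : (extend hc h s).col = (Fin.snoc s.col c.2 : Fin (n + 1) → ℕ) := by
  funext k
  induction k using Fin.lastCases with
  | last => rw [col, extend_symm_last, Fin.snoc_last]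
  | cast k => rw [col, extend_symm_castSucc, Fin.snoc_castSucc, col]

theorem inclusion_mem_colStab_extend {τ : Equiv.Perm (Fin n)} :
    inclusion n τ ∈ (extend hc h s).colStab ↔ τ ∈ s.colStab := by
  rw [mem_colStab, mem_colStab, col_extend, snoc_comp_inclusion, Fin.snoc_inj,
    and_iff_left rfl]

theorem extend_trans_inclusion (σ : Equiv.Perm (Fin n)) :
    (extend hc h s).trans (inclusion n σ) = extend hc h (s.trans σ : Tableau mu) := by
  refine Equiv.symm_bijective.injective (Equiv.ext fun k => Subtype.ext ?_)
  obtain ⟨k, rfl⟩ := (inclusion n σ).surjective k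
  rw [Equiv.symm_trans_apply, Equiv.symm_apply_apply]
  induction k using Fin.lastCases with
  | last => rw [inclusion_last, extend_symm_last, extend_symm_last]
  | cast k =>
    rw [inclusion_castSucc, extend_symm_castSucc, extend_symm_castSucc, Equiv.symm_trans_apply,
      Equiv.symm_apply_apply]

/-- The column of the last letter meets row `c.1` only in that letter, so a permutation in the
column stabilizer that contributes to the coefficients with the last letter in row `c.1` fixes
this letter. -/
theorem lastRow_polytabloid_extend :
    lastRow n c.1 (polytabloid (extend hc h s)) = polytabloid s := by
  have tabloid_extend (f : Fin n → ℕ) :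
      (extend hc h s).tabloid (Fin.snoc f c.1 : Fin (n + 1) → ℕ) = s.tabloid f := by
    simp only [tabloid, Pi.single_apply, row_extend, Fin.snoc_inj, and_true]
  funext f
  rw [lastRow_apply, ← antisymmetrizer_tabloid, ← antisymmetrizer_tabloid,
    antisymmetrizer_tabloidRep_apply, antisymmetrizer_tabloidRep_apply]
  refine (Finset.sum_of_injOn (inclusion n) inclusion_injective.injOn
    (fun τ hτ => (inclusion_mem_colStab_extend hc h s).2 hτ) (fun σ hσ hσ_range => ?_)
    fun τ _ => ?_).symm
  · refine mul_eq_zero_of_right _ (Pi.single_eq_of_ne (fun row_eq => hσ_range ?_) _)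
    have apply_inv : σ (σ⁻¹ (Fin.last n)) = Fin.last n := by simp
    have inv_last : σ⁻¹ (Fin.last n) = Fin.last n := by
      refine (extend hc h s).ext_letter ?_ ?_
      · rw [← row_eq, Function.comp_apply, apply_inv, Fin.snoc_last, row_eq,
          row_extend, Fin.snoc_last]
      · have := congrFun (mem_colStab.1 hσ) (σ⁻¹ (Fin.last n))
        rwa [Function.comp_apply, apply_inv, eq_comm] at this
    obtain ⟨τ, rfl⟩ := exists_inclusion_eq (Equiv.Perm.inv_eq_iff_eq.1 inv_last).symm
    exact ⟨τ, (inclusion_mem_colStab_extend hc h s).1 hσ, rfl⟩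
  · rw [snoc_comp_inclusion, tabloid_extend, sgn, sgn, sign_inclusion]

end Tableau

section Restriction

variable {n : ℕ} {mu : Shape n} {lam : Shape (n + 1)}

/-- The restriction of a Specht module of `S_{n+1}` to `S_n`. -/
abbrev spechtRes (lam : Shape (n + 1)) : Representation ℂ (Equiv.Perm (Fin n)) (Specht lam) :=
  (spechtRep lam).comp (inclusion n)

/-- The polytabloids of the tableaux of shape `lam` with the last letter in the cell outside `mu`
span a subrepresentation that `lastRow` maps onto `S^mu`. -/
theorem exists_intertwiningMap_spechtRes_ne_zero (hml : Precedes mu lam) :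
    ∃ j : (spechtRep mu).IntertwiningMap (spechtRes lam), j ≠ 0 := by
  obtain ⟨c, hc, h⟩ := hml
  let e (s : Tableau mu) := spechtPolytabloid (s.extend hc h)
  let U : Subrepresentation (spechtRes lam) := ⟨Submodule.span ℂ (Set.range e), fun σ u hu => by
    refine (Submodule.span_le (p := (Submodule.span ℂ (Set.range e)).comap _)).2 ?_ hu
    rintro _ ⟨s, rfl⟩
    refine Submodule.subset_span ⟨s.trans σ, ?_⟩
    exact (congrArg spechtPolytabloid (s.extend_trans_inclusion hc h σ)).symm.trans
      (spechtRep_spechtPolytabloid (inclusion n σ) _).symm⟩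
  have lastRow_mem (u) (hu : u ∈ Submodule.span ℂ (Set.range e)) : lastRow n c.1 u ∈ Specht mu := by
    refine (Submodule.span_le
      (p := (Specht mu).comap ((lastRow n c.1).toLinearMap ∘ₗ (Specht lam).subtype))).2 ?_ hu
    rintro _ ⟨s, rfl⟩
    exact (congrArg (· ∈ Specht mu) (s.lastRow_polytabloid_extend hc h)).mpr
      (polytabloid_mem_specht s)
  let p : U.toRepresentation.IntertwiningMap (spechtRep mu) :=
    ⟨((lastRow n c.1).toLinearMap ∘ₗ (Specht lam).subtype ∘ₗ U.toSubmodule.subtype).codRestrict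
      (Specht mu) fun u => lastRow_mem u.1 u.2, fun σ => LinearMap.ext fun u => Subtype.ext <|
        LinearMap.congr_fun ((lastRow n c.1).isIntertwining' σ) u⟩
  obtain ⟨j, hj⟩ := exists_comp_comp_eq (V := U.toSubmodule) p
  refine ⟨⟨U.toSubmodule.subtype ∘ₗ j.toLinearMap, fun σ => LinearMap.ext fun v =>
    congrArg Subtype.val (LinearMap.congr_fun (j.isIntertwining' σ) v)⟩, fun j_eq_zero => ?_⟩
  let s : Tableau mu := Classical.arbitrary _
  let u : U.toSubmodule := ⟨e s, Submodule.subset_span ⟨s, rfl⟩⟩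
  have p_u : p u = spechtPolytabloid s := Subtype.ext (s.lastRow_polytabloid_extend hc h)
  have j_p_u : j (p u) = 0 := Subtype.ext (DFunLike.congr_fun j_eq_zero (p u))
  have p_j_p_u : p (j (p u)) = p u := DFunLike.congr_fun hj u
  exact spechtPolytabloid_ne_zero s (by rw [← p_u, ← p_j_p_u, j_p_u, map_zero])

end Restriction

/-! ### The branching graph -/

section RowEnds

variable {d : YoungDiagram} {r : ℕ}

theorem mem_cells_iff_lt_rowLen {i j : ℕ} : (i, j) ∈ d.cells ↔ j < d.rowLen i := by
  rw [YoungDiagram.mem_cells, YoungDiagram.mem_iff_lt_rowLen]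

theorem isLowerSet_erase_rowEnd (hr : d.rowLen (r + 1) < d.rowLen r) :
    IsLowerSet (d.cells.erase (r, d.rowLen r - 1) : Set (ℕ × ℕ)) := by
  rintro ⟨i, j⟩ ⟨i', j'⟩ ⟨hi, hj⟩ hmem
  dsimp only at hi hj
  simp only [Finset.mem_coe, Finset.mem_erase, mem_cells_iff_lt_rowLen, ne_eq,
    Prod.mk.injEq] at hmem ⊢
  have anti := d.rowLen_anti i' i hi
  refine ⟨?_, by omega⟩
  rintro ⟨rfl, rfl⟩
  rcases hi.eq_or_lt with rfl | hi
  · omega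
  · have := d.rowLen_anti (i' + 1) i hi
    omega

theorem isLowerSet_insert_rowEnd (hr : ∀ i < r, d.rowLen r < d.rowLen i) :
    IsLowerSet (↑(insert (r, d.rowLen r) d.cells) : Set (ℕ × ℕ)) := by
  rintro ⟨i, j⟩ ⟨i', j'⟩ ⟨hi, hj⟩ hmem
  dsimp only at hi hj
  simp only [Finset.mem_coe, Finset.mem_insert, mem_cells_iff_lt_rowLen,
    Prod.mk.injEq] at hmem ⊢
  have anti := d.rowLen_anti i' i hi
  rcases hmem with ⟨rfl, rfl⟩ | hmem
  · rcases hi.eq_or_lt with rfl | hi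
    · omega
    · have := hr i' hi
      omega
  · omega

theorem rowEnd_notMem_cells (d : YoungDiagram) (r : ℕ) : (r, d.rowLen r) ∉ d.cells := by
  rw [mem_cells_iff_lt_rowLen]
  exact lt_irrefl _

theorem rowEnd_mem_cells (hr : d.rowLen (r + 1) < d.rowLen r) :
    (r, d.rowLen r - 1) ∈ d.cells := by
  rw [mem_cells_iff_lt_rowLen]
  omega

end RowEnds

theorem fst_lt_card_of_mem_cells {d : YoungDiagram} {c : ℕ × ℕ} (hc : c ∈ d.cells) :
    c.1 < d.card := by
  have := YoungDiagram.mem_iff_lt_colLen.1 ((YoungDiagram.mem_cells c).1 hc)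
  rw [YoungDiagram.colLen_eq_card] at this
  exact this.trans_le (Finset.card_filter_le _ _)

theorem snd_lt_card_of_mem_cells {d : YoungDiagram} {c : ℕ × ℕ} (hc : c ∈ d.cells) :
    c.2 < d.card := by
  have := YoungDiagram.mem_iff_lt_rowLen.1 ((YoungDiagram.mem_cells c).1 hc)
  rw [YoungDiagram.rowLen_eq_card] at this
  exact this.trans_le (Finset.card_filter_le _ _)

theorem Shape.ext_cells {n : ℕ} {lam mu : Shape n} (h : lam.1.cells = mu.1.cells) : lam = mu :=
  Subtype.ext (YoungDiagram.ext h)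

theorem Shape.eq_of_cells_subset {n : ℕ} {lam mu : Shape n} (h : lam.1.cells ⊆ mu.1.cells) :
    lam = mu :=
  ext_cells (Finset.eq_of_subset_of_card_le h (mu.2.trans lam.2.symm).le)

instance (n : ℕ) : Finite (Shape n) := by
  refine Finite.of_injective (β := (Finset.range n ×ˢ Finset.range n).powerset)
    (fun lam => ⟨lam.1.cells, Finset.mem_powerset.2 fun c hc => ?_⟩)
    fun lam mu h => Shape.ext_cells (congrArg Subtype.val h)
  have fst_lt := fst_lt_card_of_mem_cells hc
  have snd_lt := snd_lt_card_of_mem_cells hc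
  rw [lam.2] at fst_lt snd_lt
  exact Finset.mem_product.2 ⟨Finset.mem_range.2 fst_lt, Finset.mem_range.2 snd_lt⟩

instance (n : ℕ) : Fintype (Shape n) := Fintype.ofFinite _

theorem precedes_iff_subset {n : ℕ} {mu : Shape n} {lam : Shape (n + 1)} :
    Precedes mu lam ↔ mu.1.cells ⊆ lam.1.cells := by
  constructor
  · rintro ⟨c, _, h⟩
    exact h ▸ Finset.erase_subset _ _
  · intro h
    have card_sdiff : (lam.1.cells \ mu.1.cells).card = 1 := by
      have hmu : mu.1.cells.card = n := mu.2
      have hlam : lam.1.cells.card = n + 1 := lam.2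
      rw [Finset.card_sdiff_of_subset h, hmu, hlam, Nat.add_sub_cancel_left]
    obtain ⟨c, hc⟩ := Finset.card_eq_one.1 card_sdiff
    have c_mem : c ∈ lam.1.cells \ mu.1.cells := hc ▸ Finset.mem_singleton_self c
    refine ⟨c, (Finset.mem_sdiff.1 c_mem).1, ?_⟩
    rw [Finset.erase_eq, ← hc, Finset.sdiff_sdiff_eq_self h]

namespace Shape

variable {n : ℕ}

open Classical in
/-- The partitions obtained by adding a cell. -/
def above (mu : Shape n) : Finset (Shape (n + 1)) := {lam | Precedes mu lam}

open Classical in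
/-- The partitions obtained by removing a cell. -/
def below (lam : Shape (n + 1)) : Finset (Shape n) := {mu | Precedes mu lam}

theorem mem_above {mu : Shape n} {lam : Shape (n + 1)} : lam ∈ mu.above ↔ Precedes mu lam := by
  simp [above]

theorem mem_below {mu : Shape n} {lam : Shape (n + 1)} : mu ∈ lam.below ↔ Precedes mu lam := by
  simp [below]

/-- The rows from which a cell can be removed. -/
def removableRows (mu : Shape n) : Finset ℕ :=
  {r ∈ Finset.range n | mu.1.rowLen (r + 1) < mu.1.rowLen r}

theorem mem_removableRows {mu : Shape n} {r : ℕ} :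
    r ∈ mu.removableRows ↔ mu.1.rowLen (r + 1) < mu.1.rowLen r := by
  rw [removableRows, Finset.mem_filter, and_iff_right_iff_imp, Finset.mem_range]
  exact fun h => (fst_lt_card_of_mem_cells (rowEnd_mem_cells h)).trans_eq mu.2

/-- The rows to which a cell can be added: the first row, and each row below a removable one. -/
def addableRows (mu : Shape n) : Finset ℕ := insert 0 (mu.removableRows.image Nat.succ)

theorem mem_addableRows {mu : Shape n} {r : ℕ} :
    r ∈ mu.addableRows ↔ ∀ i < r, mu.1.rowLen r < mu.1.rowLen i := by
  rcases r with _ | r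
  · simp [addableRows]
  · simp only [addableRows, Finset.mem_insert, Nat.succ_ne_zero, Finset.mem_image, Nat.succ_inj,
      exists_eq_right, mem_removableRows, false_or]
    exact ⟨fun h i hi => h.trans_le (mu.1.rowLen_anti i r (Nat.le_of_lt_succ hi)),
      fun h => h r (Nat.lt_succ_self r)⟩

theorem card_addableRows (mu : Shape n) : mu.addableRows.card = mu.removableRows.card + 1 := by
  rw [addableRows, Finset.card_insert_of_notMem (by simp),
    Finset.card_image_of_injective _ Nat.succ_injective]

theorem exists_removableRows_of_precedes {rho : Shape n} {mu : Shape (n + 1)}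
    (h : Precedes rho mu) :
    ∃ r ∈ mu.removableRows, rho.1.cells = mu.1.cells.erase (r, mu.1.rowLen r - 1) := by
  obtain ⟨⟨r, j⟩, hc, hcells⟩ := h
  have maximal (c : ℕ × ℕ) (hcm : c ∈ mu.1.cells) (hle : (r, j) ≤ c) : c = (r, j) := by
    by_contra hne
    have : (r, j) ∈ rho.1.cells :=
      rho.1.isLowerSet hle (Finset.mem_coe.2 (hcells ▸ Finset.mem_erase.2 ⟨hne, hcm⟩))
    rw [hcells] at this
    exact Finset.notMem_erase _ _ this
  have hj : j < mu.1.rowLen r := mem_cells_iff_lt_rowLen.1 hc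
  have right_notMem : ¬ j + 1 < mu.1.rowLen r := fun h => by
    simpa using maximal (r, j + 1) (mem_cells_iff_lt_rowLen.2 h) ⟨le_rfl, Nat.le_succ j⟩
  have below_notMem : ¬ j < mu.1.rowLen (r + 1) := fun h => by
    simpa using maximal (r + 1, j) (mem_cells_iff_lt_rowLen.2 h) ⟨Nat.le_succ r, le_rfl⟩
  refine ⟨r, mem_removableRows.2 (by omega), ?_⟩
  rw [hcells, show mu.1.rowLen r - 1 = j by omega]

theorem exists_addableRows_of_precedes {mu : Shape n} {lam : Shape (n + 1)}
    (h : Precedes mu lam) :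
    ∃ r ∈ mu.addableRows, lam.1.cells = insert (r, mu.1.rowLen r) mu.1.cells := by
  obtain ⟨⟨r, j⟩, hc, hcells⟩ := h
  have mem_of_lt (c : ℕ × ℕ) (hle : c ≤ (r, j)) (hne : c ≠ (r, j)) : c ∈ mu.1.cells := by
    rw [hcells]
    exact Finset.mem_erase.2 ⟨hne, Finset.mem_coe.1 (lam.1.isLowerSet hle (Finset.mem_coe.2 hc))⟩
  have rowLen_le : mu.1.rowLen r ≤ j := le_of_not_gt fun h => by
    have := mem_cells_iff_lt_rowLen.2 h
    rw [hcells] at this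
    exact Finset.notMem_erase _ _ this
  have le_rowLen : j ≤ mu.1.rowLen r := le_of_not_gt fun h =>
    rowEnd_notMem_cells mu.1 r (mem_of_lt _ ⟨le_rfl, h.le⟩ (by simp [h.ne]))
  obtain rfl : j = mu.1.rowLen r := le_antisymm le_rowLen rowLen_le
  refine ⟨r, mem_addableRows.2 fun i hi => mem_cells_iff_lt_rowLen.1
    (mem_of_lt (i, mu.1.rowLen r) ⟨hi.le, le_rfl⟩ (by simp [hi.ne])), ?_⟩
  rw [hcells, Finset.insert_erase hc]

theorem card_below (mu : Shape (n + 1)) : mu.below.card = mu.removableRows.card := by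
  have row_end_mem {r : ℕ} (hr : r ∈ mu.removableRows) :=
    rowEnd_mem_cells (mem_removableRows.1 hr)
  have card_mu : mu.1.cells.card = n + 1 := mu.2
  have card_erase {r : ℕ} (hr : r ∈ mu.removableRows) :
      (mu.1.cells.erase (r, mu.1.rowLen r - 1)).card = n := by
    rw [Finset.card_erase_of_mem (row_end_mem hr), card_mu, Nat.add_sub_cancel]
  refine (Finset.card_bij (fun r hr => ⟨⟨mu.1.cells.erase (r, mu.1.rowLen r - 1),
    isLowerSet_erase_rowEnd (mem_removableRows.1 hr)⟩, card_erase hr⟩)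
    (fun r hr => ?_) (fun r hr r' hr' h => ?_) fun rho hrho => ?_).symm
  · exact mem_below.2 ⟨_, row_end_mem hr, rfl⟩
  · exact congrArg Prod.fst ((Finset.erase_inj _ (row_end_mem hr)).1
      (congrArg (fun nu : Shape n => nu.1.cells) h))
  · obtain ⟨r, hr, h⟩ := exists_removableRows_of_precedes (mem_below.1 hrho)
    exact ⟨r, hr, ext_cells h.symm⟩

theorem card_above (mu : Shape n) : mu.above.card = mu.addableRows.card := by
  have row_end_notMem (r : ℕ) := rowEnd_notMem_cells mu.1 r
  have card_mu : mu.1.cells.card = n := mu.2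
  have card_insert (r : ℕ) : (insert (r, mu.1.rowLen r) mu.1.cells).card = n + 1 := by
    rw [Finset.card_insert_of_notMem (row_end_notMem r), card_mu]
  refine (Finset.card_bij (fun r hr => ⟨⟨insert (r, mu.1.rowLen r) mu.1.cells,
    isLowerSet_insert_rowEnd (mem_addableRows.1 hr)⟩, card_insert r⟩)
    (fun r hr => ?_) (fun r hr r' hr' h => ?_) fun lam hlam => ?_).symm
  · exact mem_above.2 (precedes_iff_subset.2 (Finset.subset_insert _ _))
  · exact congrArg Prod.fst ((Finset.insert_inj (row_end_notMem r)).1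
      (congrArg (fun nu : Shape (n + 1) => nu.1.cells) h))
  · obtain ⟨r, hr, h⟩ := exists_addableRows_of_precedes (mem_above.1 hlam)
    exact ⟨r, hr, ext_cells h.symm⟩

theorem exists_above (mu : Shape n) : ∃ lam, Precedes mu lam := by
  obtain ⟨lam, h⟩ : mu.above.Nonempty := by
    rw [← Finset.card_pos, card_above, card_addableRows]
    exact Nat.succ_pos _
  exact ⟨lam, mem_above.1 h⟩

theorem exists_below (lam : Shape (n + 1)) : ∃ mu, Precedes mu lam := by
  have card_lam : lam.1.cells.card = n + 1 := lam.2
  obtain ⟨c, hc⟩ := lam.1.cells.exists_maximal (Finset.card_pos.1 (by omega))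
  refine ⟨⟨⟨lam.1.cells.erase c, fun d e hle hd => ?_⟩, ?_⟩, c, hc.1, rfl⟩
  · rw [Finset.mem_coe, Finset.mem_erase] at hd ⊢
    refine ⟨?_, Finset.mem_coe.1 (lam.1.isLowerSet hle (Finset.mem_coe.2 hd.2))⟩
    rintro rfl
    exact hd.1 (le_antisymm (hc.2 hd.2 hle) hle)
  · rw [YoungDiagram.card, Finset.card_erase_of_mem hc.1, card_lam, Nat.add_sub_cancel]

theorem card_union_lt_of_ne {mu kap : Shape n} (hne : mu ≠ kap) :
    n < (mu.1.cells ∪ kap.1.cells).card := by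
  refine mu.2.symm.trans_lt (Finset.card_lt_card (Finset.ssubset_iff_subset_ne.2
    ⟨Finset.subset_union_left, fun h => hne (eq_of_cells_subset ?_).symm⟩))
  rw [h]
  exact Finset.subset_union_right

theorem cells_eq_union_of_precedes {mu kap : Shape n} {lam : Shape (n + 1)} (hne : mu ≠ kap)
    (hmu : Precedes mu lam) (hkap : Precedes kap lam) :
    lam.1.cells = mu.1.cells ∪ kap.1.cells :=
  (Finset.eq_of_subset_of_card_le
    (Finset.union_subset (precedes_iff_subset.1 hmu) (precedes_iff_subset.1 hkap))
    (lam.2.trans_le (card_union_lt_of_ne hne))).symm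

theorem cells_eq_inter_of_precedes {mu kap : Shape (n + 1)} {rho : Shape n} (hne : mu ≠ kap)
    (hmu : Precedes rho mu) (hkap : Precedes rho kap) :
    rho.1.cells = mu.1.cells ∩ kap.1.cells := by
  have card_rho : rho.1.cells.card = n := rho.2
  have card_mu : mu.1.cells.card = n + 1 := mu.2
  have card_kap : kap.1.cells.card = n + 1 := kap.2
  have card_union := card_union_lt_of_ne hne
  have := Finset.card_union_add_card_inter mu.1.cells kap.1.cells
  exact Finset.eq_of_subset_of_card_le
    (Finset.subset_inter (precedes_iff_subset.1 hmu) (precedes_iff_subset.1 hkap)) (by omega)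

/-- The lattice of Young diagrams is modular: `mu ⊔ kap` covers both exactly if both cover
`mu ⊓ kap`. -/
theorem card_above_inter_above [DecidableEq (Shape n)] [DecidableEq (Shape (n + 1 + 1))]
    {mu kap : Shape (n + 1)} (hne : mu ≠ kap) :
    (mu.above ∩ kap.above).card = (mu.below ∩ kap.below).card := by
  have card_mu : mu.1.cells.card = n + 1 := mu.2
  have card_kap : kap.1.cells.card = n + 1 := kap.2
  have card_union_add := Finset.card_union_add_card_inter mu.1.cells kap.1.cells
  have cells_above : ∀ lam ∈ mu.above ∩ kap.above, lam.1.cells = mu.1.cells ∪ kap.1.cells := by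
    intro lam hlam
    rw [Finset.mem_inter, mem_above, mem_above] at hlam
    exact cells_eq_union_of_precedes hne hlam.1 hlam.2
  have cells_below : ∀ rho ∈ mu.below ∩ kap.below, rho.1.cells = mu.1.cells ∩ kap.1.cells := by
    intro rho hrho
    rw [Finset.mem_inter, mem_below, mem_below] at hrho
    exact cells_eq_inter_of_precedes hne hrho.1 hrho.2
  refine Finset.card_bij (fun lam hlam => ⟨mu.1 ⊓ kap.1, ?_⟩) (fun lam hlam => ?_)
    (fun lam hlam lam' hlam' _ => ?_) fun rho hrho => ?_
  · have card_lam : lam.1.cells.card = n + 1 + 1 := lam.2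
    rw [cells_above lam hlam] at card_lam
    rw [YoungDiagram.card, YoungDiagram.cells_inf]
    omega
  · rw [Finset.mem_inter, mem_below, mem_below, precedes_iff_subset, precedes_iff_subset]
    exact ⟨Finset.inter_subset_left, Finset.inter_subset_right⟩
  · exact ext_cells ((cells_above lam hlam).trans (cells_above lam' hlam').symm)
  · have card_rho : rho.1.cells.card = n := rho.2
    rw [cells_below rho hrho] at card_rho
    refine ⟨⟨mu.1 ⊔ kap.1, ?_⟩, ?_, ext_cells (cells_below rho hrho).symm⟩
    · rw [YoungDiagram.card, YoungDiagram.cells_sup]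
      omega
    · rw [Finset.mem_inter, mem_above, mem_above, precedes_iff_subset, precedes_iff_subset]
      exact ⟨Finset.subset_union_left, Finset.subset_union_right⟩

/-- The commutation relation `D U = U D + 1` of the branching graph. -/
theorem sum_above_sum_below {M : Type*} [AddCommMonoid M] (mu : Shape (n + 1))
    (d : Shape (n + 1) → M) :
    ∑ lam ∈ mu.above, ∑ kap ∈ lam.below, d kap =
      d mu + ∑ rho ∈ mu.below, ∑ kap ∈ rho.above, d kap := by
  classical
  have sum_above : ∑ lam ∈ mu.above, ∑ kap ∈ lam.below, d kap =
      ∑ kap, (mu.above ∩ kap.above).card • d kap := by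
    simp only [← Finset.sum_const]
    exact Finset.sum_comm' fun lam kap => by simp [mem_above, mem_below]
  have sum_below : ∑ rho ∈ mu.below, ∑ kap ∈ rho.above, d kap =
      ∑ kap, (mu.below ∩ kap.below).card • d kap := by
    simp only [← Finset.sum_const]
    exact Finset.sum_comm' fun lam kap => by simp [mem_above, mem_below]
  rw [sum_above, sum_below, ← Finset.add_sum_erase _ _ (Finset.mem_univ mu),
    ← Finset.add_sum_erase Finset.univ (fun kap => (mu.below ∩ kap.below).card • d kap)
      (Finset.mem_univ mu), ← add_assoc, Finset.inter_self, Finset.inter_self, card_above,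
    card_addableRows, card_below, succ_nsmul']
  congr 1
  refine Finset.sum_congr rfl fun kap hkap => ?_
  rw [card_above_inter_above (Finset.ne_of_mem_erase hkap).symm]

end Shape

section Coinduction

open Representation

/-- Frobenius reciprocity: the map to a coinduced representation that corresponds to a map from
the restriction. -/
def toCoind {k G H V W : Type*} [CommSemiring k] [Monoid G] [Monoid H] [AddCommMonoid V]
    [Module k V] [AddCommMonoid W] [Module k W] {φ : G →* H} {τ : Representation k H W}
    {ρ : Representation k G V} (p : IntertwiningMap (τ.comp φ) ρ) :
    τ.IntertwiningMap (coind φ ρ) where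
  toLinearMap := LinearMap.codRestrict (coindV φ ρ) (LinearMap.pi fun h => p.toLinearMap ∘ₗ τ h)
    fun w g h => by
      change p.toLinearMap (τ (φ g * h) w) = ρ g (p.toLinearMap (τ h w))
      rw [map_mul]
      exact LinearMap.congr_fun (p.isIntertwining' g) (τ h w)
  isIntertwining' h := by
    refine LinearMap.ext fun w => Subtype.ext (funext fun h' => ?_)
    change p.toLinearMap (τ h' (τ h w)) = p.toLinearMap (τ (h' * h) w)
    rw [map_mul, Module.End.mul_apply]

theorem toCoind_ne_zero {k G H V W : Type*} [CommSemiring k] [Monoid G] [Monoid H]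
    [AddCommMonoid V] [Module k V] [AddCommMonoid W] [Module k W] {φ : G →* H}
    {τ : Representation k H W} {ρ : Representation k G V} {p : IntertwiningMap (τ.comp φ) ρ}
    (hp : p ≠ 0) : toCoind p ≠ 0 := fun h => hp <| by
  ext w
  have p_comp : p.toLinearMap (τ 1 w) = 0 :=
    congrFun (congrArg Subtype.val (DFunLike.congr_fun h w)) 1
  rwa [map_one] at p_comp

theorem exists_eq_inclusion_mul_swap {n : ℕ} (σ : Equiv.Perm (Fin (n + 1))) :
    ∃ (τ : Equiv.Perm (Fin n)) (i : Fin (n + 1)),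
      σ = inclusion n τ * Equiv.swap i (Fin.last n) := by
  obtain ⟨τ, hτ⟩ := exists_inclusion_eq (σ := σ * Equiv.swap (σ⁻¹ (Fin.last n)) (Fin.last n))
    (by simp)
  exact ⟨τ, σ⁻¹ (Fin.last n), by rw [hτ, mul_assoc, Equiv.swap_mul_self, mul_one]⟩

theorem finrank_coindV_inclusion_le {k V : Type*} [Field k] [AddCommGroup V] [Module k V]
    [FiniteDimensional k V] {n : ℕ} (ρ : Representation k (Equiv.Perm (Fin n)) V) :
    Module.finrank k (coindV (inclusion n) ρ) ≤ (n + 1) * Module.finrank k V := by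
  let evalSwaps : coindV (inclusion n) ρ →ₗ[k] Fin (n + 1) → V :=
    LinearMap.funLeft k V (fun i => Equiv.swap i (Fin.last n)) ∘ₗ (coindV (inclusion n) ρ).subtype
  have evalSwaps_injective : Function.Injective evalSwaps := by
    rw [injective_iff_map_eq_zero]
    refine fun f hf => Subtype.ext (funext fun σ => ?_)
    obtain ⟨τ, i, rfl⟩ := exists_eq_inclusion_mul_swap σ
    exact (f.2 τ _).trans ((congrArg (ρ τ) (congrFun hf i)).trans (map_zero _))
  simpa [Module.finrank_pi_fintype] using
    LinearMap.finrank_le_finrank_of_injective evalSwaps_injective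

end Coinduction

section Branching

variable {n : ℕ} {mu : Shape n} {lam : Shape (n + 1)}

theorem isEmpty_spechtRep_equiv {n : ℕ} {p : Shape n → Prop} :
    Pairwise fun mu nu : {mu // p mu} => IsEmpty ((spechtRep mu.1).Equiv (spechtRep nu.1)) :=
  fun _ _ hne => ⟨fun e => hne (Subtype.ext (eq_of_spechtRep_equiv e))⟩

open Classical in
theorem toModule_spechtRes_injective
    {j : ∀ mu : {mu // Precedes mu lam}, (spechtRep mu.1).IntertwiningMap (spechtRes lam)}
    (hj : ∀ mu, j mu ≠ 0) :
    Function.Injective (DirectSum.toModule ℂ _ _ fun mu => (j mu).toLinearMap) :=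
  toModule_injective_of_isIrreducible hj isEmpty_spechtRep_equiv

/-- The dimension of the Specht module of shape `lam`. -/
def Shape.dim (lam : Shape n) : ℕ := Module.finrank ℂ (Specht lam)

theorem finrank_directSum_specht {p : Shape n → Prop} {s : Finset (Shape n)}
    (hs : ∀ mu, mu ∈ s ↔ p mu) :
    Module.finrank ℂ (⨁ mu : {mu // p mu}, Specht mu.1) = ∑ mu ∈ s, mu.dim := by
  have : Fintype {mu // p mu} := Fintype.ofFinite _
  rw [Module.finrank_directSum]
  exact (Finset.sum_subtype s hs Shape.dim).symm

theorem sum_below_dim_le (lam : Shape (n + 1)) : ∑ mu ∈ lam.below, mu.dim ≤ lam.dim := by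
  choose j hj using fun mu : {mu // Precedes mu lam} =>
    exists_intertwiningMap_spechtRes_ne_zero mu.2
  rw [← finrank_directSum_specht fun _ => Shape.mem_below]
  exact LinearMap.finrank_le_finrank_of_injective (toModule_spechtRes_injective hj)

theorem exists_intertwiningMap_spechtRep_ne_zero (hml : Precedes mu lam) :
    ∃ p : (spechtRes lam).IntertwiningMap (spechtRep mu), p ≠ 0 := by
  obtain ⟨j, hj⟩ := exists_intertwiningMap_spechtRes_ne_zero hml
  obtain ⟨p, hp⟩ := exists_comp_comp_eq j
  refine ⟨p, ?_⟩
  rintro rfl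
  exact hj (by rw [← hp]; ext; simp)

theorem sum_above_dim_le (mu : Shape n) : ∑ lam ∈ mu.above, lam.dim ≤ (n + 1) * mu.dim := by
  classical
  choose p hp using fun lam : {lam // Precedes mu lam} =>
    exists_intertwiningMap_spechtRep_ne_zero lam.2
  rw [← finrank_directSum_specht fun _ => Shape.mem_above]
  have injective := toModule_injective_of_isIrreducible
    (W := Representation.coindV (inclusion n) (spechtRep mu))
    (fun lam => toCoind_ne_zero (hp lam)) isEmpty_spechtRep_equiv
  exact (LinearMap.finrank_le_finrank_of_injective injective).trans
    (finrank_coindV_inclusion_le (spechtRep mu))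

theorem sum_dim_of_le (h : ∀ mu : Shape n, (n + 1) * mu.dim ≤
    ∑ lam ∈ mu.above, ∑ kap ∈ lam.below, kap.dim) :
    (∀ mu : Shape n, ∑ lam ∈ mu.above, lam.dim = (n + 1) * mu.dim) ∧
      ∀ lam : Shape (n + 1), ∑ mu ∈ lam.below, mu.dim = lam.dim := by
  have sum_below_le (mu : Shape n) : ∑ lam ∈ mu.above, ∑ kap ∈ lam.below, kap.dim ≤
      ∑ lam ∈ mu.above, lam.dim := Finset.sum_le_sum fun lam _ => sum_below_dim_le lam
  refine ⟨fun mu => le_antisymm (sum_above_dim_le mu) ((h mu).trans (sum_below_le mu)),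
    fun lam => ?_⟩
  obtain ⟨mu, hmu⟩ := lam.exists_below
  exact (Finset.sum_eq_sum_iff_of_le fun lam _ => sum_below_dim_le lam).1
    (le_antisymm (sum_below_le mu) ((sum_above_dim_le mu).trans (h mu))) lam
    (Shape.mem_above.2 hmu)

/-- The upper bounds `sum_above_dim_le` and `sum_below_dim_le` are sharp: by induction and the
commutation relation of the branching graph, going up from `mu` and back down reaches a total
dimension of at least `(n + 1) * mu.dim`. -/
theorem sum_dim (n : ℕ) : (∀ mu : Shape n, ∑ lam ∈ mu.above, lam.dim = (n + 1) * mu.dim) ∧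
    ∀ lam : Shape (n + 1), ∑ mu ∈ lam.below, mu.dim = lam.dim := by
  induction n with
  | zero =>
    refine sum_dim_of_le fun mu => ?_
    obtain ⟨lam, hlam⟩ := mu.exists_above
    calc (0 + 1) * mu.dim = mu.dim := by ring
      _ ≤ ∑ kap ∈ lam.below, kap.dim :=
        Finset.single_le_sum (fun _ _ => Nat.zero_le _) (Shape.mem_below.2 hlam)
      _ ≤ _ := Finset.single_le_sum (f := fun lam : Shape 1 => ∑ kap ∈ lam.below, kap.dim)
        (fun _ _ => Nat.zero_le _) (Shape.mem_above.2 hlam)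
  | succ n ih =>
    refine sum_dim_of_le fun mu => le_of_eq ?_
    rw [Shape.sum_above_sum_below, Finset.sum_congr rfl fun rho _ => ih.1 rho, ← Finset.mul_sum,
      ih.2 mu]
    ring

open Classical in
theorem toModule_spechtRes_bijective
    {j : ∀ mu : {mu // Precedes mu lam}, (spechtRep mu.1).IntertwiningMap (spechtRes lam)}
    (hj : ∀ mu, j mu ≠ 0) :
    Function.Bijective (DirectSum.toModule ℂ _ _ fun mu => (j mu).toLinearMap) := by
  have injective := toModule_spechtRes_injective hj
  have : Fintype {mu // Precedes mu lam} := Fintype.ofFinite _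
  have finrank_eq : Module.finrank ℂ (⨁ mu : {mu // Precedes mu lam}, Specht mu.1) =
      Module.finrank ℂ (Specht lam) :=
    (finrank_directSum_specht fun _ => Shape.mem_below).trans ((sum_dim n).2 lam)
  exact ⟨injective, (LinearMap.injective_iff_surjective_of_finrank_eq_finrank
    (V := ⨁ mu : {mu // Precedes mu lam}, Specht mu.1) finrank_eq).1 injective⟩

theorem eq_top_of_range_le {U : Submodule ℂ (Specht lam)}
    (hU : ∀ mu, Precedes mu lam →
      ∃ j : (spechtRep mu).IntertwiningMap (spechtRes lam), j ≠ 0 ∧ ∀ v, j v ∈ U) : U = ⊤ := by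
  classical
  choose j hj mem using fun mu : {mu // Precedes mu lam} => hU mu.1 mu.2
  rw [eq_top_iff, ← LinearMap.range_eq_top.2 (toModule_spechtRes_bijective hj).2]
  rintro _ ⟨v, rfl⟩
  induction v using DirectSum.induction_on with
  | zero => simp
  | of mu v =>
    rw [← DirectSum.lof_eq_of ℂ, DirectSum.toModule_lof]
    exact mem mu v
  | add v w hv hw => rw [map_add]; exact U.add_mem hv hw

/-- Otherwise `p`, with `j ∘ p ∘ j = j`, would vanish on a copy of each Specht module below `lam`:
on a combination of `f` and `j`, and on those below `lam` other than `mu`. -/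
theorem exists_eq_smul_of_intertwiningMap_spechtRes (hml : Precedes mu lam)
    {j : (spechtRep mu).IntertwiningMap (spechtRes lam)} (hj : j ≠ 0)
    (f : (spechtRep mu).IntertwiningMap (spechtRes lam)) : ∃ c : ℂ, f = c • j := by
  obtain ⟨p, hp⟩ := exists_comp_comp_eq j
  obtain ⟨a, ha⟩ := exists_eq_smul_of_intertwiningMap (p.comp j)
  obtain ⟨b, hb⟩ := exists_eq_smul_of_intertwiningMap (p.comp f)
  simp only [Representation.IntertwiningMap.comp_apply] at ha hb
  have j_p_j (v : Specht mu) : j (p (j v)) = j v := DFunLike.congr_fun hp v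
  have a_ne_zero : a ≠ 0 := by
    rintro rfl
    refine hj (Representation.IntertwiningMap.ext (LinearMap.ext fun v => ?_))
    change j v = 0
    rw [← j_p_j, ha, zero_smul, map_zero]
  refine ⟨b / a, sub_eq_zero.1 (by_contra fun g_ne_zero => hj ?_)⟩
  have ker_eq_top : p.toLinearMap.ker = ⊤ := eq_top_of_range_le fun nu hnu => by
    obtain rfl | hne := eq_or_ne nu mu
    · refine ⟨_, g_ne_zero, fun v => ?_⟩
      change p (f v - (b / a) • j v) = 0
      rw [map_sub, map_smul, ha, hb, smul_smul, div_mul_cancel₀ _ a_ne_zero, sub_self]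
    · obtain ⟨k, hk⟩ := exists_intertwiningMap_spechtRes_ne_zero hnu
      refine ⟨k, hk, fun v => ?_⟩
      have : p.comp k = 0 := not_ne_iff.1 (mt eq_of_intertwiningMap_ne_zero hne)
      exact DFunLike.congr_fun this v
  refine Representation.IntertwiningMap.ext (LinearMap.ext fun v => ?_)
  have : j v ∈ p.toLinearMap.ker := ker_eq_top ▸ Submodule.mem_top
  change j v = 0
  rw [← j_p_j, show p (j v) = 0 from this, map_zero]

end Branching

/-! ### Associators -/

section SignTwist

variable {n : ℕ} {V W X : Type*} [AddCommGroup V] [Module ℂ V] [AddCommGroup W] [Module ℂ W]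
  [AddCommGroup X] [Module ℂ X] {ρ : Representation ℂ (Equiv.Perm (Fin n)) V}
  {τ : Representation ℂ (Equiv.Perm (Fin n)) W} {κ : Representation ℂ (Equiv.Perm (Fin n)) X}

/-- The tensor product of a representation of `S_n` with the sign character. -/
def signTwist (ρ : Representation ℂ (Equiv.Perm (Fin n)) V) :
    Representation ℂ (Equiv.Perm (Fin n)) V where
  toFun σ := sgn σ • ρ σ
  map_one' := by simp [sgn]
  map_mul' σ τ := by rw [sgn_mul, map_mul, smul_mul_smul_comm]

theorem map_signTwist (T : ρ.IntertwiningMap (signTwist τ)) (σ : Equiv.Perm (Fin n)) (v : V) :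
    T (ρ σ v) = sgn σ • τ σ (T v) :=
  LinearMap.congr_fun (T.isIntertwining' σ) v

/-- The composite of two maps that are equivariant up to the sign character. -/
def signComp (S : τ.IntertwiningMap (signTwist κ)) (T : ρ.IntertwiningMap (signTwist τ)) :
    ρ.IntertwiningMap κ where
  toLinearMap := S.toLinearMap ∘ₗ T.toLinearMap
  isIntertwining' σ := LinearMap.ext fun v => by
    change S (T (ρ σ v)) = κ σ (S (T v))
    rw [map_signTwist, map_smul, map_signTwist, smul_smul, sgn_mul_self, one_smul]

/-- The equivariant map up to sign that sends the indicator function of the `σ`-translate of `f` to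
a multiple of `sgn σ • ρ σ v`. -/
def signedOrbitMap (ρ : Representation ℂ (Equiv.Perm (Fin n)) V) (f : Fin n → ℕ) (v : V) :
    (tabloidRep n).IntertwiningMap (signTwist ρ) where
  toLinearMap := ∑ σ : Equiv.Perm (Fin n),
    (LinearMap.proj (R := ℂ) (φ := fun _ : Fin n → ℕ => ℂ) (f ∘ ⇑σ⁻¹)).smulRight
      (sgn σ • ρ σ v)
  isIntertwining' τ := LinearMap.ext fun u => by
    simp only [LinearMap.comp_apply, LinearMap.sum_apply, LinearMap.smulRight_apply,
      LinearMap.proj_apply, map_sum, map_smul]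
    refine (Fintype.sum_equiv (Equiv.mulLeft τ) _ _ fun σ => ?_).symm
    change _ • _ • sgn τ • ρ τ (ρ σ v) = u ((f ∘ ⇑(τ * σ)⁻¹) ∘ τ) • sgn (τ * σ) • ρ (τ * σ) v
    rw [sgn_mul, map_mul, Module.End.mul_apply, smul_smul (sgn σ), mul_comm (sgn σ)]
    congr 2
    ext k
    simp

theorem signedOrbitMap_apply (f : Fin n → ℕ) (v : V) (u : TabloidSpace n) :
    signedOrbitMap ρ f v u = ∑ σ : Equiv.Perm (Fin n), u (f ∘ ⇑σ⁻¹) • sgn σ • ρ σ v := by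
  change (∑ σ : Equiv.Perm (Fin n), _ : TabloidSpace n →ₗ[ℂ] V) u = _
  simp [LinearMap.sum_apply]

end SignTwist

section Conjugate

variable {n : ℕ} {lam : Shape n}

theorem Shape.swap_mem_conj {c : ℕ × ℕ} : c.swap ∈ lam.conj.1.cells ↔ c ∈ lam.1.cells := by
  change c.swap ∈ lam.1.transpose ↔ c ∈ lam.1
  rw [YoungDiagram.mem_transpose, Prod.swap_swap]

theorem Shape.eq_conj_symm {kap : Shape n} (h : kap = lam.conj) : lam = kap.conj := by
  rw [h, conj_conj]

/-- The conjugate tableau. -/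
def Tableau.conj (t : Tableau lam) : Tableau lam.conj :=
  (((Equiv.prodComm ℕ ℕ).subtypeEquiv fun _ => Shape.swap_mem_conj.symm).symm).trans t

theorem spechtRep_spechtPolytabloid_of_mem_colStab {t : Tableau lam} {σ : Equiv.Perm (Fin n)}
    (hσ : σ ∈ t.colStab) :
    spechtRep lam σ (spechtPolytabloid t) = sgn σ • spechtPolytabloid t :=
  Subtype.ext <| funext fun f => by
    change polytabloid t (f ∘ σ) = sgn σ * polytabloid t f
    rw [← Tableau.antisymmetrizer_tabloid, Tableau.antisymmetrizer_tabloidRep_apply_comp _ _ _ hσ]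

/-- The map that sends the tabloid of `t` to a multiple of the polytabloid of `t.conj`. -/
def conjMap (t : Tableau lam) :
    (tabloidRep n).IntertwiningMap (signTwist (spechtRep lam.conj)) :=
  signedOrbitMap (spechtRep lam.conj) t.row (spechtPolytabloid t.conj)

theorem conjMap_tabloid (t : Tableau lam) :
    conjMap t t.tabloid = (t.conj.colStab.card : ℂ) • spechtPolytabloid t.conj := by
  have mem_colStab_iff (σ : Equiv.Perm (Fin n)) : t.row ∘ ⇑σ⁻¹ = t.row ↔ σ ∈ t.conj.colStab := by
    rw [Tableau.mem_colStab]
    change t.row ∘ ⇑σ⁻¹ = t.row ↔ t.row ∘ σ = t.row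
    constructor
    · exact fun h => funext fun k => by simpa using (congrFun h (σ k)).symm
    · exact fun h => funext fun k => by simpa using (congrFun h (σ⁻¹ k)).symm
  rw [conjMap, signedOrbitMap_apply, ← Finset.sum_subset (Finset.subset_univ t.conj.colStab)]
  · have term_eq : ∀ σ ∈ t.conj.colStab, t.tabloid (t.row ∘ ⇑σ⁻¹) • sgn σ •
        spechtRep lam.conj σ (spechtPolytabloid t.conj) = spechtPolytabloid t.conj := fun σ hσ => by
      rw [(mem_colStab_iff σ).2 hσ, spechtRep_spechtPolytabloid_of_mem_colStab hσ,
        Tableau.tabloid, Pi.single_eq_same, one_smul, smul_smul, sgn_mul_self, one_smul]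
    rw [Finset.sum_congr rfl term_eq, Finset.sum_const, Nat.cast_smul_eq_nsmul]
  · intro σ _ hσ
    rw [Tableau.tabloid, Pi.single_eq_of_ne (mt (mem_colStab_iff σ).1 hσ), zero_smul]

theorem conjMap_polytabloid_ne_zero (t : Tableau lam) : conjMap t (polytabloid t) ≠ 0 := by
  have apply_col : (conjMap t (polytabloid t) : TabloidSpace n) t.col =
      t.colStab.card * t.conj.colStab.card := by
    have term_eq : ∀ σ ∈ t.colStab,
        ((sgn σ • signTwist (spechtRep lam.conj) σ
          ((t.conj.colStab.card : ℂ) • spechtPolytabloid t.conj) : Specht lam.conj) :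
          TabloidSpace n) t.col = t.conj.colStab.card := fun σ hσ => by
      change sgn σ * (sgn σ * (_ * polytabloid t.conj (t.col ∘ σ))) = _
      rw [Tableau.mem_colStab.1 hσ, ← mul_assoc, sgn_mul_self, one_mul]
      exact (congrArg _ (polytabloid_apply_row t.conj)).trans (mul_one _)
    rw [← Tableau.antisymmetrizer_tabloid, Tableau.map_antisymmetrizer, conjMap_tabloid,
      Tableau.antisymmetrizer, LinearMap.sum_apply, AddSubmonoidClass.coe_finsetSum,
      Finset.sum_apply]
    simp only [LinearMap.smul_apply]
    rw [Finset.sum_congr rfl term_eq, Finset.sum_const, nsmul_eq_mul]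
  intro h
  rw [h] at apply_col
  exact mul_ne_zero t.card_colStab_ne_zero t.conj.card_colStab_ne_zero apply_col.symm

theorem exists_signTwist_conj_ne_zero (lam kap : Shape n) (h : kap = lam.conj) :
    ∃ T : (spechtRep lam).IntertwiningMap (signTwist (spechtRep kap)), T ≠ 0 := by
  subst h
  obtain ⟨t⟩ := (inferInstance : Nonempty (Tableau lam))
  exact ⟨(conjMap t).comp (spechtSubtype lam), fun h =>
    conjMap_polytabloid_ne_zero t (DFunLike.congr_fun h (spechtPolytabloid t))⟩

/-- Associators for the partitions of `n`. The conjugate partition is a parameter `kap`, so that no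
transport along `lam.conj.conj = lam` is needed. -/
structure LocalAssociators (n : ℕ) where
  φ : ∀ lam kap : Shape n, kap = lam.conj →
    (spechtRep lam).IntertwiningMap (signTwist (spechtRep kap))
  inverse : ∀ lam kap h h' v, φ kap lam h' (φ lam kap h v) = v

/-- Compatibility of associators with the restriction from `S_{n+1}` to `S_n`. -/
def LocalAssociators.Compatible (A : LocalAssociators n) (B : LocalAssociators (n + 1)) : Prop :=
  ∀ (mu : Shape n) (lam : Shape (n + 1)), Precedes mu lam → ∀ (hmu : mu = mu.conj)
    (hlam : lam = lam.conj) (j : (spechtRep mu).IntertwiningMap (spechtRes lam)) (v : Specht mu),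
    B.φ lam lam hlam (j v) = j (A.φ mu mu hmu v)

/-- The composites `S^lam → S^kap → S^lam` and `S^kap → S^lam → S^kap` are the same scalar, and
dividing by a square root of it makes the two maps inverse to each other. -/
theorem nonempty_localAssociators (n : ℕ) : Nonempty (LocalAssociators n) := by
  choose T hT using exists_signTwist_conj_ne_zero (n := n)
  have T_injective lam kap h : Function.Injective (T lam kap h) :=
    (Representation.IsIrreducible.injective_or_eq_zero _).resolve_right (hT lam kap h)
  choose c hc using fun lam kap h =>
    exists_eq_smul_of_intertwiningMap (signComp (T kap lam (Shape.eq_conj_symm h)) (T lam kap h))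
  replace hc lam kap h h' v : T kap lam h' (T lam kap h v) = c lam kap h • v := hc lam kap h v
  have T_ne_zero {lam : Shape n} (kap h) {v : Specht lam} (hv : v ≠ 0) : T lam kap h v ≠ 0 :=
    (map_ne_zero_iff _ (T_injective lam kap h)).2 hv
  have c_ne_zero lam kap h : c lam kap h ≠ 0 := fun h0 => by
    obtain ⟨v, hv⟩ := exists_ne (0 : Specht lam)
    refine T_ne_zero lam (Shape.eq_conj_symm h) (T_ne_zero kap h hv) ?_
    rw [hc, h0, zero_smul]
  have c_symm lam kap h h' : c kap lam h' = c lam kap h := by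
    obtain ⟨v, hv⟩ := exists_ne (0 : Specht lam)
    have eq := hc kap lam h' h (T lam kap h v)
    rw [hc lam kap h h' v, map_smul] at eq
    exact (smul_left_injective ℂ (T_ne_zero kap h hv) eq).symm
  choose r hr using IsAlgClosed.exists_eq_mul_self (k := ℂ)
  refine ⟨⟨fun lam kap h => (r (c lam kap h))⁻¹ • T lam kap h, fun lam kap h h' v => ?_⟩⟩
  change (r (c kap lam h'))⁻¹ • T kap lam h' ((r (c lam kap h))⁻¹ • T lam kap h v) = v
  rw [map_smul, hc, c_symm lam kap h h', smul_smul, smul_smul, ← mul_inv, ← hr,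
    inv_mul_cancel₀ (c_ne_zero _ _ _), one_smul]

theorem exists_diagonal_cell_of_precedes {mu : Shape n} {lam : Shape (n + 1)}
    (hmu : mu = mu.conj) (hlam : lam = lam.conj) (h : Precedes mu lam) :
    ∃ i, (i, i) ∈ lam.1.cells ∧ mu.1.cells = lam.1.cells.erase (i, i) := by
  obtain ⟨⟨i, k⟩, hc, hcells⟩ := h
  obtain rfl : i = k := by
    by_contra hne
    have swap_mem_lam : (k, i) ∈ lam.1.cells := by
      rw [hlam]
      exact Shape.swap_mem_conj.2 hc
    have swap_mem_mu : (k, i) ∈ mu.1.cells :=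
      hcells ▸ Finset.mem_erase.2 ⟨fun h => hne (congrArg Prod.snd h), swap_mem_lam⟩
    rw [hmu] at swap_mem_mu
    have mem_mu : (i, k) ∈ mu.1.cells := Shape.swap_mem_conj.1 swap_mem_mu
    rw [hcells] at mem_mu
    exact Finset.notMem_erase _ _ mem_mu
  exact ⟨i, hc, hcells⟩

theorem eq_of_precedes_of_eq_conj {mu nu : Shape n} {lam : Shape (n + 1)} (hlam : lam = lam.conj)
    (hmu : mu = mu.conj) (hnu : nu = nu.conj) (hml : Precedes mu lam) (hnl : Precedes nu lam) :
    mu = nu := by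
  obtain ⟨i, hi, mu_cells⟩ := exists_diagonal_cell_of_precedes hmu hlam hml
  obtain ⟨k, hk, nu_cells⟩ := exists_diagonal_cell_of_precedes hnu hlam hnl
  have eq_of_le {rho : Shape n} {a b : ℕ} (hcells : rho.1.cells = lam.1.cells.erase (a, a))
      (hb : (b, b) ∈ lam.1.cells) (hab : a ≤ b) : a = b := by
    by_contra hne
    have mem : (b, b) ∈ rho.1.cells :=
      hcells ▸ Finset.mem_erase.2 ⟨fun h => hne (congrArg Prod.fst h).symm, hb⟩
    have := Finset.mem_coe.1 (rho.1.isLowerSet (show (a, a) ≤ (b, b) from ⟨hab, hab⟩)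
      (Finset.mem_coe.2 mem))
    rw [hcells] at this
    exact Finset.notMem_erase _ _ this
  obtain rfl : i = k :=
    (le_total i k).elim (eq_of_le mu_cells hk) fun h => (eq_of_le nu_cells hi h).symm
  exact Shape.ext_cells (mu_cells.trans nu_cells.symm)

/-- Multiplicity one: `F ∘ j ∘ G` is a multiple of `j`, by a square root of `1`. -/
theorem exists_smul_map_eq_map {mu : Shape n} {lam : Shape (n + 1)} (hml : Precedes mu lam)
    {F : (spechtRep lam).IntertwiningMap (signTwist (spechtRep lam))}
    {G : (spechtRep mu).IntertwiningMap (signTwist (spechtRep mu))}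
    (hF : ∀ v, F (F v) = v) (hG : ∀ v, G (G v) = v) :
    ∃ s : ℂ, s * s = 1 ∧ ∀ (j : (spechtRep mu).IntertwiningMap (spechtRes lam)) (v : Specht mu),
      s • F (j v) = j (G v) := by
  obtain ⟨j, hj⟩ := exists_intertwiningMap_spechtRes_ne_zero hml
  have sgn_inclusion (σ : Equiv.Perm (Fin n)) : sgn (inclusion n σ) = sgn σ := by
    rw [sgn, sign_inclusion]
  let FjG : (spechtRep mu).IntertwiningMap (spechtRes lam) :=
    { toLinearMap := F.toLinearMap ∘ₗ j.toLinearMap ∘ₗ G.toLinearMap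
      isIntertwining' σ := LinearMap.ext fun v => by
        have map_j : j (spechtRep mu σ (G v)) = spechtRep lam (inclusion n σ) (j (G v)) :=
          LinearMap.congr_fun (j.isIntertwining' σ) (G v)
        change F (j (G (spechtRep mu σ v))) = spechtRep lam (inclusion n σ) (F (j (G v)))
        rw [map_signTwist, map_smul, map_smul, map_j, map_signTwist, smul_smul, sgn_inclusion,
          sgn_mul_self, one_smul] }
  obtain ⟨s, hs⟩ := exists_eq_smul_of_intertwiningMap_spechtRes hml hj FjG
  have F_j (v : Specht mu) : F (j v) = s • j (G v) := by
    have eq : F (j (G (G v))) = s • j (G v) := DFunLike.congr_fun hs (G v)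
    rwa [hG] at eq
  have s_mul_self : s * s = 1 := by
    obtain ⟨v, hv⟩ := DFunLike.ne_iff.1 hj
    have eq := hF (j v)
    rw [F_j, map_smul, F_j, hG, smul_smul] at eq
    exact smul_left_injective ℂ hv (eq.trans (one_smul ℂ _).symm)
  refine ⟨s, s_mul_self, fun k v => ?_⟩
  obtain ⟨c, rfl⟩ := exists_eq_smul_of_intertwiningMap_spechtRes hml hj k
  change s • F (c • j v) = c • j (G v)
  rw [map_smul, F_j, smul_comm c, smul_smul, s_mul_self, one_smul]

namespace LocalAssociators

theorem exists_compatible (A : LocalAssociators n) :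
    ∃ B : LocalAssociators (n + 1), A.Compatible B := by
  obtain ⟨B⟩ := nonempty_localAssociators (n + 1)
  have exists_sign (lam : Shape (n + 1)) : ∃ s : ℂ, s * s = 1 ∧ (lam ≠ lam.conj → s = 1) ∧
      ∀ mu, Precedes mu lam → ∀ (hmu : mu = mu.conj) (hlam : lam = lam.conj)
      (j : (spechtRep mu).IntertwiningMap (spechtRes lam)) (v : Specht mu),
      s • B.φ lam lam hlam (j v) = j (A.φ mu mu hmu v) := by
    by_cases hlam : lam = lam.conj
    · by_cases hmu : ∃ mu, Precedes mu lam ∧ mu = mu.conj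
      · obtain ⟨mu, hml, hmu⟩ := hmu
        obtain ⟨s, s_mul_self, hs⟩ := exists_smul_map_eq_map hml (B.inverse lam lam hlam hlam)
          (A.inverse mu mu hmu hmu)
        refine ⟨s, s_mul_self, fun h => (h hlam).elim, fun nu hnl hnu _ j v => ?_⟩
        obtain rfl := eq_of_precedes_of_eq_conj hlam hmu hnu hml hnl
        exact hs j v
      · exact ⟨1, one_mul 1, fun _ => rfl, fun mu hml h => (hmu ⟨mu, hml, h⟩).elim⟩
    · exact ⟨1, one_mul 1, fun _ => rfl, fun _ _ _ h => (hlam h).elim⟩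
  choose s s_mul_self s_eq_one hs using exists_sign
  refine ⟨⟨fun lam kap h => s lam • B.φ lam kap h, fun lam kap h h' v => ?_⟩,
    fun mu lam hml hmu hlam => hs lam mu hml hmu hlam⟩
  have s_mul_s : s kap * s lam = 1 := by
    by_cases hlam : lam = lam.conj
    · rw [h.trans hlam.symm, s_mul_self]
    · have hkap : kap ≠ kap.conj := fun hkap => hlam (h'.trans (hkap.symm.trans h))
      rw [s_eq_one lam hlam, s_eq_one kap hkap, one_mul]
  change s kap • B.φ kap lam h' (s lam • B.φ lam kap h v) = v
  rw [map_smul, B.inverse, smul_smul, s_mul_s, one_smul]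

theorem coe_φ (A : LocalAssociators n) {lam kap kap' : Shape n}
    (h : kap = lam.conj) (h' : kap' = lam.conj) (v : Specht lam) :
    (A.φ lam kap h v : TabloidSpace n) = A.φ lam kap' h' v := by
  subst h
  subst h'
  rfl

end LocalAssociators

/-- Associators for all partitions, chosen one level at a time. -/
def associatorSequence : ∀ n : ℕ, LocalAssociators n
  | 0 => (nonempty_localAssociators 0).some
  | n + 1 => (associatorSequence n).exists_compatible.choose

theorem associatorSequence_compatible (n : ℕ) :
    (associatorSequence n).Compatible (associatorSequence (n + 1)) :=
  (associatorSequence n).exists_compatible.choose_spec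

theorem nonempty_associators : Nonempty Associators := by
  refine ⟨⟨fun {n} lam => ((associatorSequence n).φ lam lam.conj rfl).toLinearMap, fun {n} lam =>
    map_signTwist ((associatorSequence n).φ lam lam.conj rfl), fun {n} lam v => ?_,
    fun {n} mu lam hml hmu hlam j hj v w hvw => ?_⟩⟩
  · exact ((associatorSequence n).coe_φ rfl lam.conj_conj.symm _).trans
      (congrArg Subtype.val ((associatorSequence n).inverse lam lam.conj rfl _ v))
  · refine ((associatorSequence (n + 1)).coe_φ rfl hlam _).trans ?_
    have := associatorSequence_compatible n mu lam hml hmu hlam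
      ⟨j, fun σ => LinearMap.ext (hj σ)⟩ v
    refine (congrArg Subtype.val this).trans
      (congrArg (fun u => (j u : TabloidSpace (n + 1))) (Subtype.ext ?_))
    rw [← hvw]
    exact (associatorSequence n).coe_φ hmu rfl v

/-- The associators for the partitions of `n`. -/
def Associators.toLocal (Φ : Associators) (n : ℕ) : LocalAssociators n where
  φ lam kap h :=
    { toLinearMap := (LinearEquiv.ofEq _ _ (congrArg Specht h.symm)).toLinearMap ∘ₗ Φ.φ lam
      isIntertwining' σ := by
        subst h
        exact LinearMap.ext (Φ.intertwine lam σ) }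
  inverse lam kap h h' v := by
    subst h
    exact Subtype.ext (Φ.inverse lam v)

theorem Associators.toLocal_compatible (Φ : Associators) (n : ℕ) :
    (Φ.toLocal n).Compatible (Φ.toLocal (n + 1)) := fun mu lam hml hmu hlam j v =>
  Subtype.ext (Φ.compatible mu lam hml hmu hlam j.toLinearMap
    (fun σ => LinearMap.congr_fun (j.isIntertwining' σ)) v _ rfl)

end Conjugate

/-! ### Even homomorphisms -/

theorem zmod_two_eq_zero_or_one : ∀ i : ZMod 2, i = 0 ∨ i = 1 := by decide

theorem eps_zero : eps 0 = 1 := if_pos rfl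

theorem eps_one : eps 1 = -1 := if_neg one_ne_zero

theorem eps_mul_self (i : ZMod 2) : eps i * eps i = 1 := by
  rw [eps]
  split_ifs <;> norm_num

theorem eps_add_one (i : ZMod 2) : eps (i + 1) = -eps i := by
  have parity_neg_one : parity (-1) = 1 := by decide
  simpa [parity_neg_one] using eps_add_parity i (-1)

namespace Supermodule

variable {G : Type} [Group G] {ε : G →* ℤˣ} {M N : Supermodule ε}

section ParityInvolution

/-- The involution of a supermodule that is `1` on the even component and `-1` on the odd one. -/
def parityInvolution (M : Supermodule ε) : Module.End ℂ M.V :=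
  LinearMap.ofIsCompl M.isCompl (M.grade 0).subtype (-(M.grade 1).subtype)

theorem parityInvolution_of_mem {i : ZMod 2} {v : M.V} (hv : v ∈ M.grade i) :
    M.parityInvolution v = eps i • v := by
  rcases zmod_two_eq_zero_or_one i with rfl | rfl
  · rw [eps_zero, one_smul]
    exact LinearMap.ofIsCompl_apply_left M.isCompl ⟨v, hv⟩
  · rw [eps_one, neg_one_smul]
    exact LinearMap.ofIsCompl_apply_right M.isCompl ⟨v, hv⟩

theorem exists_add_eq (v : M.V) : ∃ a ∈ M.grade 0, ∃ b ∈ M.grade 1, a + b = v :=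
  Submodule.mem_sup.1 (M.isCompl.sup_eq_top ▸ Submodule.mem_top)

theorem linearMap_ext {W : Type*} [AddCommGroup W] [Module ℂ W] {T S : M.V →ₗ[ℂ] W}
    (h : ∀ i, ∀ v ∈ M.grade i, T v = S v) : T = S := LinearMap.ext fun v => by
  obtain ⟨a, ha, b, hb, rfl⟩ := exists_add_eq v
  rw [map_add, map_add, h 0 a ha, h 1 b hb]

theorem parityInvolution_eq {T : Module.End ℂ M.V}
    (h : ∀ i, ∀ v ∈ M.grade i, T v = eps i • v) : M.parityInvolution = T :=
  linearMap_ext fun i v hv => (parityInvolution_of_mem hv).trans (h i v hv).symm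

theorem parityInvolution_parityInvolution (v : M.V) :
    M.parityInvolution (M.parityInvolution v) = v := by
  refine LinearMap.congr_fun (f := M.parityInvolution ∘ₗ M.parityInvolution) (g := LinearMap.id)
    (linearMap_ext fun i v hv => ?_) v
  rw [LinearMap.comp_apply, parityInvolution_of_mem hv, map_smul, parityInvolution_of_mem hv,
    smul_smul, eps_mul_self, one_smul, LinearMap.id_apply]

theorem parityInvolution_smul (g : G) (v : M.V) :
    M.parityInvolution (M.ρ g v) = ((ε g : ℤ) : ℂ) • M.ρ g (M.parityInvolution v) := by
  refine LinearMap.congr_fun (f := M.parityInvolution ∘ₗ M.ρ g)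
    (g := ((ε g : ℤ) : ℂ) • M.ρ g ∘ₗ M.parityInvolution) (linearMap_ext fun i v hv => ?_) v
  rw [LinearMap.comp_apply, parityInvolution_of_mem (M.map_grade g i v hv), eps_add_parity,
    LinearMap.smul_apply, LinearMap.comp_apply, parityInvolution_of_mem hv, map_smul, smul_smul]

theorem mem_grade_iff {i : ZMod 2} {v : M.V} :
    v ∈ M.grade i ↔ M.parityInvolution v = eps i • v := by
  have := IsAddTorsionFree.of_isTorsionFree ℂ M.V
  refine ⟨parityInvolution_of_mem, fun h => ?_⟩
  obtain ⟨a, ha, b, hb, rfl⟩ := exists_add_eq v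
  rw [map_add, parityInvolution_of_mem ha, parityInvolution_of_mem hb, eps_zero, eps_one,
    one_smul, neg_one_smul] at h
  rcases zmod_two_eq_zero_or_one i with rfl | rfl
  · have b_eq_zero : b = 0 := by
      rw [eps_zero, one_smul, add_right_inj] at h
      exact neg_eq_self.1 h
    rwa [b_eq_zero, add_zero]
  · have a_eq_zero : a = 0 := by
      rw [eps_one, neg_one_smul, neg_add, add_left_inj] at h
      exact self_eq_neg.1 h
    rwa [a_eq_zero, zero_add]

theorem parityInvolution_shift (M : Supermodule ε) :
    M.shift.parityInvolution = -M.parityInvolution :=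
  parityInvolution_eq (M := M.shift) fun i v hv => neg_eq_iff_eq_neg.2 <|
    (parityInvolution_of_mem (M := M) hv).trans <|
      (congrArg (fun c : ℂ => c • v) (eps_add_one i)).trans (neg_smul (eps i) v)

theorem IsSub.parityInvolution_mem {U : Submodule ℂ M.V} (hU : M.IsSub U) {v : M.V} (hv : v ∈ U) :
    M.parityInvolution v ∈ U := by
  rw [hU.2] at hv
  obtain ⟨a, ha, b, hb, rfl⟩ := Submodule.mem_sup.1 hv
  rw [map_add, parityInvolution_of_mem ha.2, parityInvolution_of_mem hb.2]
  exact U.add_mem (U.smul_mem _ ha.1) (U.smul_mem _ hb.1)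

theorem isSub_of_parityInvolution_mem {U : Submodule ℂ M.V} (hρ : ∀ g, ∀ v ∈ U, M.ρ g v ∈ U)
    (hP : ∀ v ∈ U, M.parityInvolution v ∈ U) : M.IsSub U := by
  refine ⟨hρ, le_antisymm (fun v hv => ?_) (sup_le inf_le_left inf_le_left)⟩
  obtain ⟨a, ha, b, hb, rfl⟩ := exists_add_eq v
  have hP := hP _ hv
  rw [map_add, parityInvolution_of_mem ha, parityInvolution_of_mem hb, eps_zero, eps_one] at hP
  refine Submodule.add_mem_sup ⟨?_, ha⟩ ⟨?_, hb⟩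
  · have a_eq : a = (1 / 2 : ℂ) • (a + b + ((1 : ℂ) • a + (-1 : ℂ) • b)) := by module
    exact a_eq ▸ U.smul_mem _ (U.add_mem hv hP)
  · have b_eq : b = (1 / 2 : ℂ) • (a + b - ((1 : ℂ) • a + (-1 : ℂ) • b)) := by module
    exact b_eq ▸ U.smul_mem _ (U.sub_mem hv hP)

end ParityInvolution

section Hom

/-- The action on a supermodule of the free monoid on the elements of `G` and one more generator,
which acts by the parity involution. Subsupermodules and even homomorphisms are the
subrepresentations and the intertwining maps for this action. -/
def gradedRep (M : Supermodule ε) : Representation ℂ (FreeMonoid (Option G)) M.V :=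
  FreeMonoid.lift fun x => x.elim M.parityInvolution M.ρ

/-- Even homomorphisms of supermodules. -/
abbrev Hom (M N : Supermodule ε) : Type := M.gradedRep.IntertwiningMap N.gradedRep

namespace Hom

theorem map_smul (f : Hom M N) (g : G) (v : M.V) : f (M.ρ g v) = N.ρ g (f v) :=
  LinearMap.congr_fun (f.isIntertwining' (FreeMonoid.of (some g))) v

theorem map_parityInvolution (f : Hom M N) (v : M.V) :
    f (M.parityInvolution v) = N.parityInvolution (f v) :=
  LinearMap.congr_fun (f.isIntertwining' (FreeMonoid.of none)) v

/-- An equivariant map that commutes with the parity involutions, as an even homomorphism. -/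
def ofParityInvolution (f : M.V →ₗ[ℂ] N.V) (hρ : ∀ g v, f (M.ρ g v) = N.ρ g (f v))
    (hP : ∀ v, f (M.parityInvolution v) = N.parityInvolution (f v)) : Hom M N where
  toLinearMap := f
  isIntertwining' x := by
    induction x using FreeMonoid.inductionOn' with
    | one => rfl
    | of_mul x xs ih =>
      have comm_of : f ∘ₗ M.gradedRep (.of x) = N.gradedRep (.of x) ∘ₗ f :=
        match x with
        | none => LinearMap.ext hP
        | some g => LinearMap.ext (hρ g)
      rw [map_mul, map_mul, Module.End.mul_eq_comp, Module.End.mul_eq_comp, ← LinearMap.comp_assoc,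
        comm_of, LinearMap.comp_assoc, ih, LinearMap.comp_assoc]

/-- An equivariant map that preserves the grading, as an even homomorphism. -/
def ofMapGrade (f : M.V →ₗ[ℂ] N.V) (hρ : ∀ g v, f (M.ρ g v) = N.ρ g (f v))
    (hf : ∀ i v, v ∈ M.grade i → f v ∈ N.grade i) : Hom M N :=
  ofParityInvolution f hρ <| LinearMap.congr_fun <|
    linearMap_ext (T := f ∘ₗ M.parityInvolution) (S := N.parityInvolution ∘ₗ f) fun i v hv => by
      rw [LinearMap.comp_apply, LinearMap.comp_apply, parityInvolution_of_mem hv,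
        LinearMap.map_smul, parityInvolution_of_mem (hf i v hv)]

/-- An even homomorphism `M → Π N`, as an even homomorphism `Π M → N`. -/
def ofShift (f : Hom M N.shift) : Hom M.shift N :=
  .ofParityInvolution (M := M.shift) f.toLinearMap f.map_smul fun v => by
    rw [parityInvolution_shift]
    refine (f.toLinearMap.map_neg _).trans (neg_eq_iff_eq_neg.2 ?_)
    exact (f.map_parityInvolution v).trans (LinearMap.congr_fun N.parityInvolution_shift (f v))

theorem map_grade (f : Hom M N) {i : ZMod 2} {v : M.V} (hv : v ∈ M.grade i) : f v ∈ N.grade i := by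
  rw [mem_grade_iff, ← map_parityInvolution, parityInvolution_of_mem hv]
  exact f.toLinearMap.map_smul _ v

end Hom

/-- The isomorphism given by a bijective even homomorphism. -/
def Iso.ofBijective (f : Hom M N) (hf : Function.Bijective f) : Iso M N where
  toLinearEquiv := .ofBijective f.toLinearMap hf
  map_smul := f.map_smul
  map_grade _ _ := f.map_grade

/-- The even homomorphism underlying an isomorphism. -/
def Iso.toHom (e : Iso M N) : Hom M N := .ofMapGrade e.toLinearEquiv e.map_smul e.map_grade

theorem Iso.map_parityInvolution (e : Iso M N) (v : M.V) :
    e.toLinearEquiv (M.parityInvolution v) = N.parityInvolution (e.toLinearEquiv v) :=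
  e.toHom.map_parityInvolution v

/-- The inverse of an isomorphism. -/
def Iso.symm (e : Iso M N) : Iso N M :=
  .ofBijective (.ofParityInvolution e.toLinearEquiv.symm
    (fun g v => (LinearEquiv.symm_apply_eq _).2 <| by
      rw [e.map_smul, LinearEquiv.coe_coe, LinearEquiv.apply_symm_apply])
    (fun v => (LinearEquiv.symm_apply_eq _).2 <| by
      rw [e.map_parityInvolution, LinearEquiv.coe_coe, LinearEquiv.apply_symm_apply]))
    e.toLinearEquiv.symm.bijective

/-- The composite of two isomorphisms. -/
def Iso.trans {L : Supermodule ε} (e : Iso M N) (e' : Iso N L) : Iso M L where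
  toLinearEquiv := e.toLinearEquiv.trans e'.toLinearEquiv
  map_smul g v := (congrArg _ (e.map_smul g v)).trans (e'.map_smul g _)
  map_grade i v hv := e'.map_grade i _ (e.map_grade i v hv)

theorem IsSimple.isIrreducible_gradedRep (hM : M.IsSimple) : M.gradedRep.IsIrreducible where
  exists_pair_ne := by
    have := hM.1
    exact ⟨⊥, ⊤, fun h => bot_ne_top (α := Submodule ℂ M.V)
      (congrArg Subrepresentation.toSubmodule h)⟩
  eq_bot_or_eq_top U := by
    have isSub : M.IsSub U.toSubmodule := isSub_of_parityInvolution_mem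
      (fun g v hv => U.apply_mem_toSubmodule (FreeMonoid.of (some g)) hv)
      (fun v hv => U.apply_mem_toSubmodule (FreeMonoid.of none) hv)
    exact (hM.2 U.toSubmodule isSub).imp
      (fun h => Subrepresentation.toSubmodule_injective h)
      (fun h => Subrepresentation.toSubmodule_injective h)

theorem IsSimple.shift (hM : M.IsSimple) : M.shift.IsSimple := by
  refine ⟨hM.1, fun U hU => hM.2 U (isSub_of_parityInvolution_mem hU.1 fun v hv => ?_)⟩
  have neg_mem : M.shift.parityInvolution v ∈ U := hU.parityInvolution_mem hv
  rw [parityInvolution_shift] at neg_mem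
  exact (Submodule.neg_mem_iff U).1 neg_mem

end Hom

section DirectSum

variable {ι κ : Type} {N : ι → Supermodule ε}

section DecidableEq

variable [DecidableEq ι]

/-- The inclusion of a summand. -/
def Hom.lof (N : ι → Supermodule ε) (i : ι) : Hom (N i) (directSum N) :=
  .ofMapGrade (N := directSum N)
    (DirectSum.lof ℂ ι (fun i => (N i).V) i)
    (fun g v => (DirectSum.lmap_lof (fun i => (N i).ρ g) i v).symm)
    (fun p v hv => (Submodule.mem_iInf (M := ⨁ i, (N i).V) _).2 fun j => by
      change DirectSum.component ℂ ι (fun i => (N i).V) j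
        (DirectSum.lof ℂ ι (fun i => (N i).V) i v) ∈ (N j).grade p
      by_cases hij : i = j
      · subst hij
        rwa [DirectSum.component.lof_self]
      · rw [DirectSum.component.of, dif_neg hij]
        exact Submodule.zero_mem _)

theorem directSum_linearMap_ext {W : Type*} [AddCommGroup W] [Module ℂ W]
    {T S : (directSum N).V →ₗ[ℂ] W} (h : ∀ i v, T (Hom.lof N i v) = S (Hom.lof N i v)) : T = S :=
  DirectSum.linearMap_ext ℂ fun i => LinearMap.ext (h i)

/-- The linear map on a direct sum with given restrictions to the summands. -/
def directSumLift {W : Type*} [AddCommGroup W] [Module ℂ W] (f : ∀ i, (N i).V →ₗ[ℂ] W) :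
    (directSum N).V →ₗ[ℂ] W :=
  DirectSum.toModule ℂ ι W f

theorem directSumLift_lof {W : Type*} [AddCommGroup W] [Module ℂ W] (f : ∀ i, (N i).V →ₗ[ℂ] W)
    (i : ι) (v : (N i).V) : directSumLift f (Hom.lof N i v) = f i v :=
  DirectSum.toModule_lof (φ := f) ℂ i v

theorem directSumLift_comm {T : Module.End ℂ (directSum N).V} {S : Module.End ℂ M.V}
    {t : ∀ i, Module.End ℂ (N i).V} {f : ∀ i, (N i).V →ₗ[ℂ] M.V}
    (hT : ∀ i v, T (Hom.lof N i v) = Hom.lof N i (t i v))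
    (hf : ∀ i v, f i (t i v) = S (f i v)) (x : (directSum N).V) :
    directSumLift f (T x) = S (directSumLift f x) := by
  refine LinearMap.congr_fun (f := directSumLift f ∘ₗ T) (g := S ∘ₗ directSumLift f)
    (directSum_linearMap_ext fun i v => ?_) x
  rw [LinearMap.comp_apply, LinearMap.comp_apply, hT, directSumLift_lof, directSumLift_lof, hf]

/-- The even homomorphism on a direct sum with given restrictions to the summands. -/
def Hom.directSumLift (f : ∀ i, Hom (N i) M) : Hom (directSum N) M :=
  .ofParityInvolution (Supermodule.directSumLift fun i => (f i).toLinearMap)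
    (fun g => directSumLift_comm (fun i v => ((Hom.lof N i).map_smul g v).symm)
      fun i => (f i).map_smul g)
    (directSumLift_comm (fun i v => ((Hom.lof N i).map_parityInvolution v).symm)
      fun i => (f i).map_parityInvolution)

end DecidableEq

theorem nonempty_iso_directSum (hN : ∀ i, (N i).IsSimple)
    (hiso : Pairwise fun i j => IsEmpty (Iso (N i) (N j))) {f : ∀ i, Hom (N i) M}
    (hf : ∀ i, f i ≠ 0) (hM : ⨆ i, LinearMap.range (f i).toLinearMap = ⊤) :
    Nonempty (Iso M (directSum N)) := by
  classical
  have irreducible i := (hN i).isIrreducible_gradedRep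
  have nonisomorphic : Pairwise fun i j => IsEmpty ((N i).gradedRep.Equiv (N j).gradedRep) :=
    fun i j hij => ⟨fun e => (hiso hij).false (.ofBijective e.toIntertwiningMap e.bijective)⟩
  have injective : Function.Injective (Hom.directSumLift f) :=
    toModule_injective_of_isIrreducible hf nonisomorphic
  have surjective : Function.Surjective (Hom.directSumLift f) := by
    refine LinearMap.range_eq_top.1 (top_le_iff.1 (hM ▸ iSup_le fun i => ?_))
    rintro _ ⟨v, rfl⟩
    exact ⟨Hom.lof N i v, directSumLift_lof _ i v⟩
  exact ⟨(Iso.ofBijective (Hom.directSumLift f) ⟨injective, surjective⟩).symm⟩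

/-- The inclusion of the first factor. -/
def Hom.inl (M N : Supermodule ε) : Hom M (M.prod N) :=
  .ofMapGrade (N := M.prod N) (LinearMap.inl ℂ M.V N.V)
    (fun g _ => Prod.ext rfl (map_zero (N.ρ g)).symm) fun _ _ hv => ⟨hv, Submodule.zero_mem _⟩

/-- The inclusion of the second factor. -/
def Hom.inr (M N : Supermodule ε) : Hom N (M.prod N) :=
  .ofMapGrade (N := M.prod N) (LinearMap.inr ℂ M.V N.V)
    (fun g _ => Prod.ext (map_zero (M.ρ g)).symm rfl) fun _ _ hv => ⟨Submodule.zero_mem _, hv⟩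

/-- The homomorphism that groups the summands indexed by the two copies of `κ` in pairs. -/
def Hom.directSumPairing [DecidableEq ι] [DecidableEq κ] (N : ι ⊕ κ ⊕ κ → Supermodule ε) :
    Hom (directSum N) ((directSum fun i => N (.inl i)).prod
      (directSum fun i => (N (.inr (.inl i))).prod (N (.inr (.inr i))))) :=
  Hom.directSumLift fun
    | .inl i => (Hom.inl _ _).comp (Hom.lof (fun i => N (.inl i)) i)
    | .inr (.inl i) => (Hom.inr _ _).comp <|
      (Hom.lof (fun i => (N (.inr (.inl i))).prod (N (.inr (.inr i)))) i).comp (Hom.inl _ _)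
    | .inr (.inr i) => (Hom.inr _ _).comp <|
      (Hom.lof (fun i => (N (.inr (.inl i))).prod (N (.inr (.inr i)))) i).comp (Hom.inr _ _)

theorem nonempty_iso_prod_directSum (N : ι ⊕ κ ⊕ κ → Supermodule ε) :
    Nonempty (Iso (directSum N) ((directSum fun i => N (.inl i)).prod
      (directSum fun i => (N (.inr (.inl i))).prod (N (.inr (.inr i)))))) := by
  classical
  let A i := N (.inl i)
  let B i := (N (.inr (.inl i))).prod (N (.inr (.inr i)))
  let F : Hom (directSum N) ((directSum A).prod (directSum B)) := Hom.directSumPairing N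
  let F₁ : (directSum A).V →ₗ[ℂ] (directSum N).V :=
    directSumLift fun i => (Hom.lof N (.inl i)).toLinearMap
  let F₂ : (directSum B).V →ₗ[ℂ] (directSum N).V := directSumLift fun i =>
    LinearMap.coprod (M := (N (.inr (.inl i))).V) (M₂ := (N (.inr (.inr i))).V)
      (Hom.lof N (.inr (.inl i))).toLinearMap (Hom.lof N (.inr (.inr i))).toLinearMap
  have F_inl i v : F (Hom.lof N (.inl i) v) = (Hom.lof A i v, 0) := directSumLift_lof _ _ v
  have F_inr_inl i v : F (Hom.lof N (.inr (.inl i)) v) = (0, Hom.lof B i (v, 0)) :=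
    directSumLift_lof _ _ v
  have F_inr_inr i v : F (Hom.lof N (.inr (.inr i)) v) = (0, Hom.lof B i (0, v)) :=
    directSumLift_lof _ _ v
  have F₁_lof i v : F₁ (Hom.lof A i v) = Hom.lof N (.inl i) v := directSumLift_lof _ i v
  have F₂_lof i v w : F₂ (Hom.lof B i (v, w)) =
      Hom.lof N (.inr (.inl i)) v + Hom.lof N (.inr (.inr i)) w :=
    directSumLift_lof (N := B) _ i (v, w)
  have left_inv : F₁.coprod F₂ ∘ₗ F.toLinearMap = LinearMap.id :=
    directSum_linearMap_ext fun i v => by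
      change F₁.coprod F₂ (F (Hom.lof N i v)) = Hom.lof N i v
      match i, v with
      | .inl i, v => rw [F_inl, LinearMap.coprod_apply, F₁_lof, map_zero, add_zero]
      | .inr (.inl i), v =>
        rw [F_inr_inl, LinearMap.coprod_apply, F₂_lof, map_zero, map_zero, zero_add, add_zero]
      | .inr (.inr i), v =>
        rw [F_inr_inr, LinearMap.coprod_apply, F₂_lof, map_zero, map_zero, zero_add, zero_add]
  have right_inv : F.toLinearMap ∘ₗ F₁.coprod F₂ = LinearMap.id := by
    refine LinearMap.prod_ext (directSum_linearMap_ext fun i v => ?_)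
      (directSum_linearMap_ext fun i v => ?_)
    · change F (F₁ (Hom.lof A i v) + F₂ 0) = (Hom.lof A i v, 0)
      rw [F₁_lof, map_zero, add_zero, F_inl]
    · obtain ⟨v, w⟩ := v
      change F (F₁ 0 + F₂ (Hom.lof B i (v, w))) = (0, Hom.lof B i (v, w))
      rw [F₂_lof, map_zero, zero_add, map_add, F_inr_inl, F_inr_inr]
      exact Prod.ext (add_zero 0) <| (map_add (Hom.lof B i).toLinearMap (v, 0) (0, w)).symm.trans <|
        congrArg (Hom.lof B i) (Prod.ext (add_zero v) (zero_add w))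
  exact ⟨.ofBijective F (Function.bijective_iff_has_inverse.2
    ⟨F₁.coprod F₂, LinearMap.congr_fun left_inv, LinearMap.congr_fun right_inv⟩)⟩

end DirectSum

end Supermodule

/-! ### Restriction of supermodules -/

section Residue

variable {n : ℕ} {mu nu : Shape n} {lam : Shape (n + 1)}

theorem Precedes.conj (h : Precedes mu lam) : Precedes mu.conj lam.conj := by
  rw [precedes_iff_subset] at h ⊢
  intro c hc
  rw [← c.swap_swap, Shape.swap_mem_conj] at hc ⊢
  exact h hc

theorem eq_conj_of_precedes (hne : mu ≠ mu.conj) (h : Precedes mu lam)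
    (h' : Precedes mu.conj lam) : lam = lam.conj := by
  have mu_precedes_conj : Precedes mu lam.conj := by simpa only [Shape.conj_conj] using h'.conj
  exact Shape.ext_cells ((Shape.cells_eq_union_of_precedes hne h h').trans
    (Shape.cells_eq_union_of_precedes hne mu_precedes_conj h.conj).symm)

theorem eq_of_precedes_of_ne_conj (hlam : lam ≠ lam.conj) (hmu : Precedes mu lam)
    (hnu : Precedes nu lam) (h : mu = nu ∨ mu = nu.conj) : mu = nu := by
  refine h.elim id fun h => ?_
  subst h
  by_contra hne
  exact hlam (eq_conj_of_precedes (Ne.symm hne) hnu hmu)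

theorem res_conj (mu : Shape n) (lam : Shape (n + 1)) : res mu.conj lam.conj = -res mu lam := by
  rw [res, res, ← Finset.sum_neg_distrib]
  refine (Finset.sum_equiv (Equiv.prodComm ℕ ℕ) (fun c => ?_) fun c _ => ?_).symm
  · rw [Finset.mem_sdiff, Finset.mem_sdiff, Equiv.prodComm_apply, Shape.swap_mem_conj,
      Shape.swap_mem_conj]
  · exact neg_sub (c.2 : ℤ) c.1

theorem eq_conj_of_res_eq_zero (hlam : lam = lam.conj) (hml : Precedes mu lam)
    (hres : res mu lam = 0) : mu = mu.conj := by
  obtain ⟨c, hc, h⟩ := hml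
  rw [res, h, Finset.sdiff_erase hc, Finset.sdiff_self, insert_empty_eq,
    Finset.sum_singleton, sub_eq_zero, Nat.cast_inj] at hres
  refine (Shape.eq_of_cells_subset fun d hd => ?_).symm
  rw [← d.swap_swap, Shape.swap_mem_conj, h, Finset.mem_erase] at hd
  rw [h, Finset.mem_erase]
  refine ⟨fun hdc => hd.1 ?_, ?_⟩
  · rw [hdc]
    exact Prod.ext hres hres.symm
  · rw [hlam, ← d.swap_swap, Shape.swap_mem_conj]
    exact hd.2

theorem eq_of_res_nonneg (hlam : lam = lam.conj) (hnu : Precedes nu lam) (hmu₀ : 0 ≤ res mu lam)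
    (hnu₀ : 0 ≤ res nu lam) (h : mu = nu ∨ mu = nu.conj) : mu = nu := by
  refine h.elim id fun h => h.trans (eq_conj_of_res_eq_zero hlam hnu ?_).symm
  have res_mu : res mu lam = -res nu lam := by rw [← res_conj, ← h, ← hlam]
  omega

end Residue

/-- The equivariant map underlying an isomorphism. -/
def Supermodule.Iso.toIntertwiningMap {G : Type} [Group G] {ε : G →* ℤˣ} {M N : Supermodule ε}
    (e : Iso M N) : M.ρ.IntertwiningMap N.ρ :=
  ⟨e.toLinearEquiv, fun g => LinearMap.ext (e.map_smul g)⟩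

/-- An equivariant projection of `S^lam ⊕ S^kap` onto `U` is diagonal by Schur's lemma, so it
fixes `S^lam` pointwise as soon as it fixes a vector with nonzero component in `S^lam`. -/
theorem inl_mem_of_fst_ne_zero {n : ℕ} {lam kap : Shape n} (hne : lam ≠ kap)
    {U : Subrepresentation ((spechtRep lam).prod (spechtRep kap))} {a : Specht lam}
    {b : Specht kap} (hab : (a, b) ∈ U.toSubmodule) (ha : a ≠ 0) (u : Specht lam) :
    (u, 0) ∈ U.toSubmodule := by
  obtain ⟨q, q_mem, q_eq⟩ := exists_projection_subrepresentation U
  obtain ⟨c, hc⟩ := exists_eq_smul_of_intertwiningMap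
    ((Representation.IntertwiningMap.fst ℂ _ _).comp
      (q.comp (Representation.IntertwiningMap.inl ℂ (spechtRep lam) (spechtRep kap))))
  have fst_q_inr : (Representation.IntertwiningMap.fst ℂ _ _).comp
      (q.comp (Representation.IntertwiningMap.inr ℂ (spechtRep lam) (spechtRep kap))) = 0 :=
    not_not.1 fun h => hne (eq_of_intertwiningMap_ne_zero h).symm
  have snd_q_inl : (Representation.IntertwiningMap.snd ℂ _ _).comp
      (q.comp (Representation.IntertwiningMap.inl ℂ (spechtRep lam) (spechtRep kap))) = 0 :=
    not_not.1 fun h => hne (eq_of_intertwiningMap_ne_zero h)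
  have q_inl (u : Specht lam) : q (u, 0) = (c • u, 0) :=
    Prod.ext (hc u) (DFunLike.congr_fun snd_q_inl u)
  have c_eq_one : c = 1 := by
    have fst_q : (q (a, b)).1 = c • a := by
      have ab_eq : ((a, b) : Specht lam × Specht kap) = (a, 0) + (0, b) := by simp
      rw [ab_eq, map_add, Prod.fst_add, q_inl]
      exact (congrArg _ (DFunLike.congr_fun fst_q_inr b)).trans (add_zero _)
    rw [q_eq _ hab] at fst_q
    exact smul_left_injective ℂ ha (fst_q.symm.trans (one_smul ℂ a).symm)
  have := q_mem (u, 0)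
  rwa [q_inl, c_eq_one, one_smul] at this

namespace Associators

open Supermodule

variable (Φ : Associators) {n : ℕ} {lam kap mu nu : Shape n}

theorem parityInvolution_typeM (h : lam = lam.conj) (v : Specht lam) :
    (Φ.typeM lam h).parityInvolution v = (Φ.toLocal n).φ lam lam h v := by
  let φ : Module.End ℂ (Φ.typeM lam h).V := ((Φ.toLocal n).φ lam lam h).toLinearMap
  refine LinearMap.congr_fun (parityInvolution_eq (T := φ) fun i (v : Specht lam) hv => ?_) v
  have sub_eq_zero' : (Φ.φ lam v : TabloidSpace n) - eps i • (v : TabloidSpace n) = 0 := hv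
  exact Subtype.ext (sub_eq_zero.1 sub_eq_zero')

theorem parityInvolution_typeQ (u : Specht lam) (w : Specht lam.conj) :
    (Φ.typeQ lam).parityInvolution (u, w) =
      ((Φ.toLocal n).φ lam.conj lam lam.conj_conj.symm w,
        (Φ.toLocal n).φ lam lam.conj rfl u) := by
  let φ := ((Φ.toLocal n).φ lam lam.conj rfl).toLinearMap
  let φ' := ((Φ.toLocal n).φ lam.conj lam lam.conj_conj.symm).toLinearMap
  let T : Module.End ℂ (Φ.typeQ lam).V :=
    (φ' ∘ₗ LinearMap.snd ℂ _ _).prod (φ ∘ₗ LinearMap.fst ℂ _ _)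
  refine LinearMap.congr_fun (parityInvolution_eq (T := T) fun i v hv => ?_) (u, w)
  obtain ⟨u, w⟩ := v
  obtain rfl : w = eps i • φ u := (LinearMap.mem_graph_iff _ _).1 hv
  refine Prod.ext ?_ ?_
  · change φ' (eps i • φ u) = eps i • u
    rw [map_smul]
    exact congrArg _ ((Φ.toLocal n).inverse lam lam.conj rfl _ u)
  · change φ u = eps i • eps i • φ u
    rw [smul_smul, eps_mul_self, one_smul]

theorem isSimple_typeM (h : lam = lam.conj) : (Φ.typeM lam h).IsSimple := by
  refine ⟨inferInstanceAs (Nontrivial (Specht lam)), fun U hU => ?_⟩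
  let S : Subrepresentation (spechtRep lam) := ⟨U, hU.1⟩
  exact (IsSimpleOrder.eq_bot_or_eq_top S).imp
    (congrArg Subrepresentation.toSubmodule) (congrArg Subrepresentation.toSubmodule)

theorem isSimple_typeQ (h : lam ≠ lam.conj) : (Φ.typeQ lam).IsSimple := by
  let P := (Φ.typeQ lam).parityInvolution
  let φ := (Φ.toLocal n).φ lam lam.conj rfl
  let φ' := (Φ.toLocal n).φ lam.conj lam lam.conj_conj.symm
  have P_apply (u : Specht lam) (w : Specht lam.conj) : P (u, w) = (φ' w, φ u) :=
    Φ.parityInvolution_typeQ u w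
  have φ_φ' (w : Specht lam.conj) : φ (φ' w) = w := (Φ.toLocal n).inverse _ _ _ _ w
  refine ⟨inferInstanceAs (Nontrivial (Specht lam × Specht lam.conj)),
    fun (U : Submodule ℂ (Specht lam × Specht lam.conj)) hU => ?_⟩
  have P_mem {v : Specht lam × Specht lam.conj} (hv : v ∈ U) : P v ∈ U := hU.parityInvolution_mem hv
  let S : Subrepresentation ((spechtRep lam).prod (spechtRep lam.conj)) := ⟨U, hU.1⟩
  have eq_top_of_mem (a : Specht lam) (b : Specht lam.conj) (hab : (a, b) ∈ U) (ha : a ≠ 0) :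
      U = ⊤ := by
    have inl_mem (u : Specht lam) : (u, 0) ∈ U := inl_mem_of_fst_ne_zero (U := S) h hab ha u
    have inr_mem (w : Specht lam.conj) : (0, w) ∈ U := by
      have P_inl_mem := P_mem (inl_mem (φ' w))
      rwa [P_apply, map_zero, φ_φ'] at P_inl_mem
    refine eq_top_iff.2 fun ⟨u, w⟩ _ => ?_
    have := U.add_mem (inl_mem u) (inr_mem w)
    rwa [Prod.mk_add_mk, add_zero, zero_add] at this
  refine or_iff_not_imp_left.2 fun hbot => ?_
  obtain ⟨⟨a, b⟩, hab, hne⟩ := U.exists_mem_ne_zero_of_ne_bot hbot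
  by_cases ha : a = 0
  · refine eq_top_of_mem (φ' b) (φ a) (P_apply a b ▸ P_mem hab) fun hb => hne ?_
    rw [← φ_φ' b, hb, ha, map_zero]
    rfl
  · exact eq_top_of_mem a b hab ha

theorem ofPartition_of_eq_conj (h : lam = lam.conj) : Φ.ofPartition lam = Φ.typeM lam h := dif_pos h

theorem ofPartition_of_ne_conj (h : lam ≠ lam.conj) : Φ.ofPartition lam = Φ.typeQ lam := dif_neg h

theorem isSimple_ofPartition (lam : Shape n) : (Φ.ofPartition lam).IsSimple := by
  by_cases h : lam = lam.conj
  · exact Φ.ofPartition_of_eq_conj h ▸ Φ.isSimple_typeM h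
  · exact Φ.ofPartition_of_ne_conj h ▸ Φ.isSimple_typeQ h

variable (R : Set (Shape n))

theorem W_eq_or_eq (lam : Shape n) :
    Φ.W R lam = Φ.ofPartition lam ∨ Φ.W R lam = Φ.ofPartition lam.conj := by
  classical exact ite_eq_or_eq ..

theorem W_of_eq_conj (h : lam = lam.conj) : Φ.W R lam = Φ.typeM lam h := by
  rw [W, ← h, ite_self, Φ.ofPartition_of_eq_conj h]

theorem isSimple_W (lam : Shape n) : (Φ.W R lam).IsSimple := by
  rcases Φ.W_eq_or_eq R lam with h | h <;> exact h ▸ Φ.isSimple_ofPartition _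

theorem exists_injective_intertwiningMap_ofPartition (lam : Shape n) :
    ∃ j : (spechtRep lam).IntertwiningMap (Φ.ofPartition lam).ρ, Function.Injective j := by
  by_cases h : lam = lam.conj
  · rw [Φ.ofPartition_of_eq_conj h]
    exact ⟨.id (spechtRep lam), fun _ _ => id⟩
  · rw [Φ.ofPartition_of_ne_conj h]
    exact ⟨.inl ℂ (spechtRep lam) (spechtRep lam.conj), LinearMap.inl_injective⟩

theorem eq_or_eq_conj_of_intertwiningMap_ofPartition_ne_zero
    (j : (spechtRep kap).IntertwiningMap (Φ.ofPartition lam).ρ) (hj : j ≠ 0) :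
    kap = lam ∨ kap = lam.conj := by
  revert j hj
  by_cases h : lam = lam.conj
  · rw [Φ.ofPartition_of_eq_conj h]
    exact fun j hj => .inl (eq_of_intertwiningMap_ne_zero (mu := lam) hj)
  · rw [Φ.ofPartition_of_ne_conj h]
    intro j hj
    obtain ⟨v, hv⟩ := DFunLike.ne_iff.1 hj
    by_cases hv₁ : (j v).1 = 0
    · refine .inr (eq_of_intertwiningMap_ne_zero (T := .comp (.snd ℂ _ _) j) fun h₀ => hv ?_)
      exact Prod.ext hv₁ (DFunLike.congr_fun h₀ v)
    · exact .inl (eq_of_intertwiningMap_ne_zero (T := .comp (.fst ℂ _ _) j) fun h₀ =>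
        hv₁ (DFunLike.congr_fun h₀ v))

theorem eq_or_eq_conj_of_injective (f : (Φ.W R mu).ρ.IntertwiningMap (Φ.W R nu).ρ)
    (hf : Function.Injective f) : mu = nu ∨ mu = nu.conj := by
  have eq_or_eq_conj {kap rho : Shape n} (hmu : Φ.W R mu = Φ.ofPartition kap)
      (hnu : Φ.W R nu = Φ.ofPartition rho) : kap = rho ∨ kap = rho.conj := by
    revert f hf
    rw [hmu, hnu]
    intro f hf
    obtain ⟨j, hj⟩ := Φ.exists_injective_intertwiningMap_ofPartition kap
    refine Φ.eq_or_eq_conj_of_intertwiningMap_ofPartition_ne_zero (f.comp j) fun h₀ => ?_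
    obtain ⟨v, hv⟩ := exists_ne (0 : Specht kap)
    refine hv (hj (hf ((DFunLike.congr_fun h₀ v).trans ?_)))
    exact (((f.comp j).toLinearMap.map_zero).symm : (0 : (Φ.ofPartition rho).V) = f (j 0))
  have conj_involutive : Function.Involutive (Shape.conj (n := n)) := Shape.conj_conj
  rcases Φ.W_eq_or_eq R mu with hmu | hmu <;> rcases Φ.W_eq_or_eq R nu with hnu | hnu <;>
    have := eq_or_eq_conj hmu hnu
  · exact this
  · rwa [Shape.conj_conj, or_comm] at this
  · rwa [conj_involutive.eq_iff, conj_involutive.injective.eq_iff, or_comm] at this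
  · rwa [conj_involutive.injective.eq_iff, conj_involutive.injective.eq_iff] at this

theorem eq_or_eq_conj_of_iso (e : Iso (Φ.W R mu) (Φ.W R nu)) : mu = nu ∨ mu = nu.conj :=
  Φ.eq_or_eq_conj_of_injective R e.toIntertwiningMap e.toLinearEquiv.injective

theorem eq_or_eq_conj_of_iso_shift (e : Iso (Φ.W R mu) (Φ.W R nu).shift) :
    mu = nu ∨ mu = nu.conj :=
  Φ.eq_or_eq_conj_of_injective R e.toIntertwiningMap e.toLinearEquiv.injective

theorem isEmpty_iso_typeM_shift (h : lam = lam.conj) :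
    IsEmpty (Iso (Φ.typeM lam h) (Φ.typeM lam h).shift) := ⟨fun e => by
  let φ := (Φ.toLocal n).φ lam lam h
  let T : (spechtRep lam).IntertwiningMap (spechtRep lam) := e.toIntertwiningMap
  obtain ⟨c, hc⟩ := exists_eq_smul_of_intertwiningMap T
  have map_φ (v : Specht lam) : T (φ v) = -φ (T v) := by
    have map_P := e.map_parityInvolution v
    rw [parityInvolution_shift] at map_P
    exact (congrArg T (Φ.parityInvolution_typeM h v)).symm.trans
      (map_P.trans (congrArg (fun x : Specht lam => -x) (Φ.parityInvolution_typeM h (T v))))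
  have := IsAddTorsionFree.of_isTorsionFree ℂ (Specht lam)
  obtain ⟨v, hv⟩ := exists_ne (0 : Specht lam)
  have φ_v_eq_zero : φ v = 0 := by
    have eq_neg := map_φ v
    rw [hc v, map_smul, ← hc] at eq_neg
    have T_φ : T (φ v) = 0 := self_eq_neg.1 eq_neg
    exact e.toLinearEquiv.injective (T_φ.trans (map_zero T).symm)
  exact hv (((Φ.toLocal n).inverse lam lam h h v).symm.trans
    ((congrArg φ φ_v_eq_zero).trans (map_zero φ)))⟩

end Associators

theorem mem_sup_of_add_mem_of_sub_mem {K V : Type*} [Field K] [CharZero K]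
    [AddCommGroup V] [Module K V] {U U' : Submodule K V} {v w : V} (hadd : v + w ∈ U)
    (hsub : v - w ∈ U') :
    v ∈ U ⊔ U' ∧ w ∈ U ⊔ U' := by
  have hadd := Submodule.mem_sup_left (T := U') (U.smul_mem (1 / 2 : K) hadd)
  have hsub := Submodule.mem_sup_right (S := U) (U'.smul_mem (1 / 2 : K) hsub)
  have v_eq : v = (1 / 2 : K) • (v + w) + (1 / 2 : K) • (v - w) := by module
  have w_eq : w = (1 / 2 : K) • (v + w) - (1 / 2 : K) • (v - w) := by module
  exact ⟨v_eq ▸ add_mem hadd hsub, w_eq ▸ sub_mem hadd hsub⟩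

namespace Associators

open Supermodule

variable (Φ : Associators) {n : ℕ} {mu kap : Shape n}
  {M : Supermodule (Equiv.Perm.sign (α := Fin n))}

/-- The equivariant map `S^kap → M` obtained from `j : S^mu → M` and `φ^kap : S^kap → S^mu`, where
the sign is absorbed by the parity involution of `M`. -/
def parityConj (h : mu = kap.conj) (j : (spechtRep mu).IntertwiningMap M.ρ) :
    (spechtRep kap).IntertwiningMap M.ρ where
  toLinearMap := M.parityInvolution ∘ₗ j.toLinearMap ∘ₗ ((Φ.toLocal n).φ kap mu h).toLinearMap
  isIntertwining' σ := LinearMap.ext fun u => by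
    have map_j (v : Specht mu) : j (spechtRep mu σ v) = M.ρ σ (j v) :=
      LinearMap.congr_fun (j.isIntertwining' σ) v
    change M.parityInvolution (j ((Φ.toLocal n).φ kap mu h (spechtRep kap σ u))) =
      M.ρ σ (M.parityInvolution (j ((Φ.toLocal n).φ kap mu h u)))
    rw [map_signTwist, map_smul, map_smul, map_j, parityInvolution_smul, smul_smul]
    exact (congrArg (· • _) (sgn_mul_self σ)).trans (one_smul ℂ _)

theorem parityConj_φ (h : mu = kap.conj) (h' : kap = mu.conj)
    (j : (spechtRep mu).IntertwiningMap M.ρ) (u : Specht mu) :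
    Φ.parityConj h j ((Φ.toLocal n).φ mu kap h' u) = M.parityInvolution (j u) :=
  congrArg (fun v => M.parityInvolution (j v)) ((Φ.toLocal n).inverse mu kap h' h u)

theorem parityInvolution_parityConj (h : mu = kap.conj) (j : (spechtRep mu).IntertwiningMap M.ρ)
    (u : Specht kap) :
    M.parityInvolution (Φ.parityConj h j u) = j ((Φ.toLocal n).φ kap mu h u) :=
  parityInvolution_parityInvolution _

theorem parityConj_ne_zero (h : mu = kap.conj) {j : (spechtRep mu).IntertwiningMap M.ρ}
    (hj : j ≠ 0) : Φ.parityConj h j ≠ 0 := fun h₀ => hj <| DFunLike.ext _ _ fun u => by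
  have P_j_eq_zero : M.parityInvolution (j u) = 0 :=
    (Φ.parityConj_φ h (Shape.eq_conj_symm h) j u).symm.trans (DFunLike.congr_fun h₀ _)
  rw [← M.parityInvolution_parityInvolution (j u), P_j_eq_zero, map_zero]
  rfl

/-- The even homomorphism on `S^mu ⊕ S^mu'` that extends a given equivariant map on `S^mu`. -/
def homTypeQ (j : (spechtRep mu).IntertwiningMap M.ρ) : Hom (Φ.typeQ mu) M :=
  .ofParityInvolution (M := Φ.typeQ mu)
    (j.toLinearMap.coprod (Φ.parityConj mu.conj_conj.symm j).toLinearMap)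
    (fun σ v => by
      change j (spechtRep mu σ v.1) + Φ.parityConj _ j (spechtRep mu.conj σ v.2) =
        M.ρ σ (j v.1 + Φ.parityConj _ j v.2)
      rw [map_add]
      exact congrArg₂ _ (LinearMap.congr_fun (j.isIntertwining' σ) v.1)
        (LinearMap.congr_fun ((Φ.parityConj _ j).isIntertwining' σ) v.2))
    (fun ⟨u, w⟩ => by
      refine (congrArg _ (Φ.parityInvolution_typeQ u w)).trans ?_
      change j ((Φ.toLocal n).φ mu.conj mu mu.conj_conj.symm w) +
        Φ.parityConj _ j ((Φ.toLocal n).φ mu mu.conj rfl u) =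
          M.parityInvolution (j u + Φ.parityConj _ j w)
      rw [map_add, parityConj_φ, parityInvolution_parityConj, add_comm])

theorem mem_range_homTypeQ (j : (spechtRep mu).IntertwiningMap M.ρ) (u : Specht mu) :
    j u ∈ LinearMap.range (Φ.homTypeQ j).toLinearMap := by
  refine ⟨(u, 0), ?_⟩
  change j u + Φ.parityConj mu.conj_conj.symm j 0 = j u
  rw [map_zero, add_zero]

theorem parityInvolution_mem_range_homTypeQ (j : (spechtRep mu).IntertwiningMap M.ρ)
    (u : Specht mu) : M.parityInvolution (j u) ∈ LinearMap.range (Φ.homTypeQ j).toLinearMap := by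
  refine ⟨(0, (Φ.toLocal n).φ mu mu.conj rfl u), ?_⟩
  change j 0 + Φ.parityConj mu.conj_conj.symm j ((Φ.toLocal n).φ mu mu.conj rfl u) = _
  rw [map_zero, zero_add, parityConj_φ]

theorem exists_hom_W_of_ne (R : Set (Shape n)) (hmu : mu ≠ mu.conj)
    (j : (spechtRep mu).IntertwiningMap M.ρ) :
    ∃ f : Hom (Φ.W R mu) M, (∀ u, j u ∈ LinearMap.range f.toLinearMap) ∧
      ∀ u, M.parityInvolution (j u) ∈ LinearMap.range f.toLinearMap := by
  rcases Φ.W_eq_or_eq R mu with hW | hW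
  · rw [hW, Φ.ofPartition_of_ne_conj hmu]
    exact ⟨Φ.homTypeQ j, Φ.mem_range_homTypeQ j, Φ.parityInvolution_mem_range_homTypeQ j⟩
  · have hconj : mu.conj ≠ mu.conj.conj := by rwa [Shape.conj_conj, ne_comm]
    rw [hW, Φ.ofPartition_of_ne_conj hconj]
    let k := Φ.parityConj mu.conj_conj.symm j
    have k_φ (u : Specht mu) := Φ.parityConj_φ mu.conj_conj.symm rfl j u
    refine ⟨Φ.homTypeQ k, fun u => ?_, fun u => k_φ u ▸ Φ.mem_range_homTypeQ k _⟩
    rw [← M.parityInvolution_parityInvolution (j u), ← k_φ]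
    exact Φ.parityInvolution_mem_range_homTypeQ k _

/-- The even homomorphism `u ↦ j u + P (j (φ u))`, where `P` is the parity involution of `M`. -/
def homTypeM (h : mu = mu.conj) (j : (spechtRep mu).IntertwiningMap M.ρ) :
    Hom (Φ.typeM mu h) M :=
  .ofParityInvolution (M := Φ.typeM mu h) (j.toLinearMap + (Φ.parityConj h j).toLinearMap)
    (fun σ v => by
      change j (spechtRep mu σ v) + Φ.parityConj h j (spechtRep mu σ v) =
        M.ρ σ (j v + Φ.parityConj h j v)
      rw [map_add]
      exact congrArg₂ _ (LinearMap.congr_fun (j.isIntertwining' σ) v)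
        (LinearMap.congr_fun ((Φ.parityConj h j).isIntertwining' σ) v))
    (fun (v : Specht mu) => by
      refine (congrArg _ (Φ.parityInvolution_typeM h v)).trans ?_
      change j _ + Φ.parityConj h j ((Φ.toLocal n).φ mu mu h v) =
        M.parityInvolution (j v + Φ.parityConj h j v)
      rw [map_add, parityConj_φ, parityInvolution_parityConj, add_comm])

theorem exists_hom_W_of_eq (R : Set (Shape n)) (hmu : mu = mu.conj)
    (j : (spechtRep mu).IntertwiningMap M.ρ) :
    ∃ (f : Hom (Φ.W R mu) M) (g : Hom (Φ.W R mu).shift M),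
      (∀ u, j u + Φ.parityConj hmu j u ∈ LinearMap.range f.toLinearMap) ∧
        ∀ u, j u - Φ.parityConj hmu j u ∈ LinearMap.range g.toLinearMap := by
  rw [Φ.W_of_eq_conj R hmu]
  refine ⟨Φ.homTypeM hmu j, .ofShift (Φ.homTypeM (M := M.shift) hmu j), fun u => ⟨u, rfl⟩,
    fun u => ⟨u, ?_⟩⟩
  refine (congrArg (j u + ·) ?_).trans (sub_eq_add_neg _ _).symm
  exact LinearMap.congr_fun M.parityInvolution_shift _

end Associators

namespace Associators

open Supermodule

variable (Φ : Associators) {n : ℕ} {mu : Shape n} {lam : Shape (n + 1)} (R : Set (Shape n))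

theorem exists_hom_W_down_typeM (hlam : lam = lam.conj) (hml : Precedes mu lam)
    (j : (spechtRep mu).IntertwiningMap (spechtRes lam)) :
    ∃ f : Hom (Φ.W R mu) (down (Φ.typeM lam hlam)),
      (∀ u, j u ∈ LinearMap.range f.toLinearMap) ∧
        ∀ u, (Φ.toLocal (n + 1)).φ lam lam hlam (j u) ∈ LinearMap.range f.toLinearMap := by
  have φ_eq (v : Specht lam) : (down (Φ.typeM lam hlam)).parityInvolution v =
    (Φ.toLocal (n + 1)).φ lam lam hlam v := Φ.parityInvolution_typeM hlam v
  by_cases hmu : mu = mu.conj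
  · rw [Φ.W_of_eq_conj R hmu]
    have φ_j := Φ.toLocal_compatible n mu lam hml hmu hlam j
    let f : Hom (Φ.typeM mu hmu) (down (Φ.typeM lam hlam)) :=
      .ofParityInvolution (M := Φ.typeM mu hmu) j.toLinearMap
        (fun σ => LinearMap.congr_fun (j.isIntertwining' σ)) fun u =>
          (congrArg j (Φ.parityInvolution_typeM hmu u)).trans
            ((φ_j u).symm.trans (φ_eq (j u)).symm)
    exact ⟨f, fun u => ⟨u, rfl⟩, fun u => ⟨(Φ.toLocal n).φ mu mu hmu u, (φ_j u).symm⟩⟩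
  · obtain ⟨f, hf, hPf⟩ := Φ.exists_hom_W_of_ne (M := down (Φ.typeM lam hlam)) R hmu j
    exact ⟨f, hf, fun u => φ_eq (j u) ▸ hPf u⟩

theorem isEmpty_iso_W_of_res_nonneg (hlam : lam = lam.conj) :
    Pairwise fun mu nu : {mu : Shape n // Precedes mu lam ∧ 0 ≤ res mu lam} =>
      IsEmpty (Iso (Φ.W R mu.1) (Φ.W R nu.1)) ∧ IsEmpty (Iso (Φ.W R mu.1) (Φ.W R nu.1).shift) :=
  fun mu nu hne => by
    have not_eq_or_eq_conj : ¬(mu.1 = nu.1 ∨ mu.1 = nu.1.conj) := fun h =>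
      hne (Subtype.ext (eq_of_res_nonneg hlam nu.2.1 mu.2.2 nu.2.2 h))
    exact ⟨⟨fun e => not_eq_or_eq_conj (Φ.eq_or_eq_conj_of_iso R e)⟩,
      ⟨fun e => not_eq_or_eq_conj (Φ.eq_or_eq_conj_of_iso_shift R e)⟩⟩

theorem nonempty_iso_down_typeM (hlam : lam = lam.conj) :
    Nonempty (Iso (down (Φ.typeM lam hlam))
      (directSum fun mu : {mu : Shape n // Precedes mu lam ∧ 0 ≤ res mu lam} => Φ.W R mu.1)) := by
  choose j hj using fun mu : {mu : Shape n // Precedes mu lam ∧ 0 ≤ res mu lam} =>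
    exists_intertwiningMap_spechtRes_ne_zero mu.2.1
  choose f hf hφf using fun mu : {mu : Shape n // Precedes mu lam ∧ 0 ≤ res mu lam} =>
    Φ.exists_hom_W_down_typeM R hlam mu.2.1 (j mu)
  have range_le_iSup mu := le_iSup (fun mu => LinearMap.range (f mu).toLinearMap) mu
  refine nonempty_iso_directSum (fun mu => Φ.isSimple_W R mu.1)
    (fun mu nu hne => (Φ.isEmpty_iso_W_of_res_nonneg R hlam hne).1) (f := f) (fun mu h₀ => ?_)
    (eq_top_of_range_le fun mu hml => ?_)
  · refine hj mu (DFunLike.ext _ _ fun u => ?_)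
    obtain ⟨w, hw⟩ := hf mu u
    exact hw.symm.trans (DFunLike.congr_fun h₀ w)
  · by_cases hres : 0 ≤ res mu lam
    · exact ⟨j ⟨mu, hml, hres⟩, hj _, fun u => range_le_iSup _ (hf ⟨mu, hml, hres⟩ u)⟩
    · have hml' : Precedes mu.conj lam := hlam ▸ hml.conj
      have hres' : 0 ≤ res mu.conj lam := by
        have := res_conj mu lam
        rw [← hlam] at this
        omega
      let i : {mu : Shape n // Precedes mu lam ∧ 0 ≤ res mu lam} := ⟨mu.conj, hml', hres'⟩
      -- The copy of `S^mu` in `S^lam` is the image of the copy of `S^mu'` under `φ^lam`.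
      refine ⟨Φ.parityConj (M := down (Φ.typeM lam hlam)) rfl (j i),
        Φ.parityConj_ne_zero rfl (hj i), fun u => range_le_iSup i ?_⟩
      have := hφf i ((Φ.toLocal n).φ mu mu.conj rfl u)
      rwa [← Φ.parityInvolution_typeM hlam] at this

/-- The summands of the restriction of `S^lam ⊕ S^lam'`. -/
def restrictionSummand (lam : Shape (n + 1)) :
    {mu : Shape n // Precedes mu lam ∧ mu ≠ mu.conj} ⊕
        {mu : Shape n // Precedes mu lam ∧ mu = mu.conj} ⊕
        {mu : Shape n // Precedes mu lam ∧ mu = mu.conj} →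
      Supermodule (Equiv.Perm.sign (α := Fin n))
  | .inl mu => Φ.W R mu.1
  | .inr (.inl mu) => Φ.W R mu.1
  | .inr (.inr mu) => (Φ.W R mu.1).shift

theorem isSimple_restrictionSummand (lam : Shape (n + 1)) :
    ∀ i, (Φ.restrictionSummand R lam i).IsSimple
  | .inl mu => Φ.isSimple_W R mu.1
  | .inr (.inl mu) => Φ.isSimple_W R mu.1
  | .inr (.inr mu) => (Φ.isSimple_W R mu.1).shift

theorem isEmpty_iso_W_shift (h : mu = mu.conj) : IsEmpty (Iso (Φ.W R mu) (Φ.W R mu).shift) := by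
  rw [Φ.W_of_eq_conj R h]
  exact Φ.isEmpty_iso_typeM_shift h

theorem isEmpty_iso_restrictionSummand (hlam : lam ≠ lam.conj) :
    Pairwise fun i k => IsEmpty
      (Iso (Φ.restrictionSummand R lam i) (Φ.restrictionSummand R lam k)) := by
  intro i k hik
  refine ⟨fun e => ?_⟩
  have eq_of_iso {mu nu : Shape n} (hmu : Precedes mu lam) (hnu : Precedes nu lam)
      (e : (Φ.W R mu).ρ.IntertwiningMap (Φ.W R nu).ρ) (he : Function.Injective e) : mu = nu :=
    eq_of_precedes_of_ne_conj hlam hmu hnu (Φ.eq_or_eq_conj_of_injective R e he)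
  have e_injective := e.toLinearEquiv.injective
  rcases i with ⟨mu, hml, hmu⟩ | ⟨mu, hml, hmu⟩ | ⟨mu, hml, hmu⟩ <;>
    rcases k with ⟨nu, hnl, hnu⟩ | ⟨nu, hnl, hnu⟩ | ⟨nu, hnl, hnu⟩ <;>
    obtain rfl := eq_of_iso hml hnl e.toIntertwiningMap e_injective
  · exact hik rfl
  · exact hmu hnu
  · exact hmu hnu
  · exact hnu hmu
  · exact hik rfl
  · exact (Φ.isEmpty_iso_W_shift R hmu).false e
  · exact hnu hmu
  · exact (Φ.isEmpty_iso_W_shift R hmu).false e.symm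
  · exact hik rfl

theorem eq_top_of_range_le_typeQ {U : Submodule ℂ (Specht lam × Specht lam.conj)}
    (hU : ∀ mu, Precedes mu lam →
      ∃ j : (spechtRep mu).IntertwiningMap (spechtRes lam), j ≠ 0 ∧ ∀ u,
        (j u, 0) ∈ U ∧ (0, (Φ.toLocal (n + 1)).φ lam lam.conj rfl (j u)) ∈ U) : U = ⊤ := by
  let φ := (Φ.toLocal (n + 1)).φ lam lam.conj rfl
  have comap_inl : U.comap (LinearMap.inl ℂ _ _) = ⊤ := eq_top_of_range_le fun mu hml =>
    (hU mu hml).imp fun j hj => ⟨hj.1, fun u => (hj.2 u).1⟩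
  have comap_inr_φ : U.comap (LinearMap.inr ℂ _ _ ∘ₗ φ.toLinearMap) = ⊤ :=
    eq_top_of_range_le fun mu hml => (hU mu hml).imp fun j hj => ⟨hj.1, fun u => (hj.2 u).2⟩
  refine eq_top_iff.2 fun ⟨u, w⟩ _ => ?_
  let w' := (Φ.toLocal (n + 1)).φ lam.conj lam lam.conj_conj.symm w
  have φ_w' : φ w' = w := (Φ.toLocal (n + 1)).inverse _ _ _ _ w
  have inl_mem : (u, 0) ∈ U := comap_inl.ge (Submodule.mem_top (x := u))
  have inr_mem : (0, φ w') ∈ U := comap_inr_φ.ge (Submodule.mem_top (x := w'))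
  have add_mem := U.add_mem inl_mem inr_mem
  rwa [Prod.mk_add_mk, add_zero, zero_add, φ_w'] at add_mem

/-- The embedding of `S^mu` in the restriction of `S^lam ⊕ S^lam'` given by an embedding in
`S^lam`. -/
def inlDownTypeQ (j : (spechtRep mu).IntertwiningMap (spechtRes lam)) :
    (spechtRep mu).IntertwiningMap (down (Φ.typeQ lam)).ρ :=
  (Representation.IntertwiningMap.inl ℂ (spechtRes lam) (spechtRes lam.conj)).comp j

theorem parityInvolution_inlDownTypeQ (j : (spechtRep mu).IntertwiningMap (spechtRes lam))
    (u : Specht mu) : (down (Φ.typeQ lam)).parityInvolution (Φ.inlDownTypeQ j u) =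
      (0, (Φ.toLocal (n + 1)).φ lam lam.conj rfl (j u)) :=
  (Φ.parityInvolution_typeQ (j u) 0).trans (Prod.ext (map_zero _) rfl)

theorem parityConj_inlDownTypeQ (hmu : mu = mu.conj)
    (j : (spechtRep mu).IntertwiningMap (spechtRes lam)) (u : Specht mu) :
    Φ.parityConj hmu (Φ.inlDownTypeQ j) u = (0, (Φ.toLocal (n + 1)).φ lam lam.conj rfl
      (j ((Φ.toLocal n).φ mu mu hmu u))) :=
  Φ.parityInvolution_inlDownTypeQ j _

theorem exists_hom_restrictionSummand_ne (hml : Precedes mu lam) (hmu : mu ≠ mu.conj) :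
    ∃ f : Hom (Φ.W R mu) (down (Φ.typeQ lam)), f ≠ 0 ∧
      ∃ j : (spechtRep mu).IntertwiningMap (spechtRes lam), j ≠ 0 ∧ ∀ u,
        (j u, 0) ∈ LinearMap.range f.toLinearMap ∧
          (0, (Φ.toLocal (n + 1)).φ lam lam.conj rfl (j u)) ∈ LinearMap.range f.toLinearMap := by
  obtain ⟨j, hj⟩ := exists_intertwiningMap_spechtRes_ne_zero hml
  obtain ⟨f, hf, hPf⟩ := Φ.exists_hom_W_of_ne R hmu (Φ.inlDownTypeQ j)
  refine ⟨f, ?_, j, hj, fun u => ⟨hf u, Φ.parityInvolution_inlDownTypeQ j u ▸ hPf u⟩⟩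
  rintro rfl
  refine hj (DFunLike.ext _ _ fun u => ?_)
  obtain ⟨w, hw⟩ := hf u
  exact congrArg Prod.fst hw.symm

theorem exists_hom_restrictionSummand_eq (hml : Precedes mu lam) (hmu : mu = mu.conj) :
    ∃ (f : Hom (Φ.W R mu) (down (Φ.typeQ lam))) (g : Hom (Φ.W R mu).shift (down (Φ.typeQ lam))),
      f ≠ 0 ∧ g ≠ 0 ∧ ∃ j : (spechtRep mu).IntertwiningMap (spechtRes lam), j ≠ 0 ∧ ∀ u,
        (j u, 0) ∈ LinearMap.range f.toLinearMap ⊔ LinearMap.range g.toLinearMap ∧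
          (0, (Φ.toLocal (n + 1)).φ lam lam.conj rfl (j u)) ∈
            LinearMap.range f.toLinearMap ⊔ LinearMap.range g.toLinearMap := by
  obtain ⟨j, hj⟩ := exists_intertwiningMap_spechtRes_ne_zero hml
  obtain ⟨f, g, hf, hg⟩ := Φ.exists_hom_W_of_eq R hmu (Φ.inlDownTypeQ j)
  have fst_parityConj (u : Specht mu) :
      (Φ.parityConj hmu (Φ.inlDownTypeQ j) u : Specht lam × Specht lam.conj).1 = 0 :=
    congrArg Prod.fst (Φ.parityConj_inlDownTypeQ hmu j u)
  refine ⟨f, g, ?_, ?_, j, hj, fun u => ⟨?_, ?_⟩⟩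
  · rintro rfl
    refine hj (DFunLike.ext _ _ fun u => ?_)
    obtain ⟨w, hw⟩ := hf u
    exact (add_zero _).symm.trans <| (congrArg (j u + ·) (fst_parityConj u)).symm.trans
      (congrArg Prod.fst hw.symm)
  · rintro rfl
    refine hj (DFunLike.ext _ _ fun u => ?_)
    obtain ⟨w, hw⟩ := hg u
    exact (sub_zero _).symm.trans <| (congrArg (j u - ·) (fst_parityConj u)).symm.trans
      (congrArg Prod.fst hw.symm)
  · exact (mem_sup_of_add_mem_of_sub_mem (hf u) (hg u)).1
  · have := (mem_sup_of_add_mem_of_sub_mem (hf ((Φ.toLocal n).φ mu mu hmu u))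
      (hg ((Φ.toLocal n).φ mu mu hmu u))).2
    rwa [parityConj_φ, parityInvolution_inlDownTypeQ] at this

theorem nonempty_iso_down_typeQ (hlam : lam ≠ lam.conj) :
    Nonempty (Iso (down (Φ.typeQ lam)) (directSum (Φ.restrictionSummand R lam))) := by
  choose f hf j hj hjf using fun mu : {mu : Shape n // Precedes mu lam ∧ mu ≠ mu.conj} =>
    Φ.exists_hom_restrictionSummand_ne R mu.2.1 mu.2.2
  choose g g' hg hg' k hk hkg using fun mu : {mu : Shape n // Precedes mu lam ∧ mu = mu.conj} =>
    Φ.exists_hom_restrictionSummand_eq R mu.2.1 mu.2.2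
  let F : ∀ i, Hom (Φ.restrictionSummand R lam i) (down (Φ.typeQ lam))
    | .inl mu => f mu
    | .inr (.inl mu) => g mu
    | .inr (.inr mu) => g' mu
  have F_ne_zero : ∀ i, F i ≠ 0
    | .inl mu => hf mu
    | .inr (.inl mu) => hg mu
    | .inr (.inr mu) => hg' mu
  have range_le_iSup i := le_iSup (fun i => LinearMap.range (F i).toLinearMap) i
  refine nonempty_iso_directSum (Φ.isSimple_restrictionSummand R lam)
    (Φ.isEmpty_iso_restrictionSummand R hlam) F_ne_zero
    (Φ.eq_top_of_range_le_typeQ fun mu hml => ?_)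
  by_cases hmu : mu = mu.conj
  · let i : {mu : Shape n // Precedes mu lam ∧ mu = mu.conj} := ⟨mu, hml, hmu⟩
    have sup_le_iSup := sup_le (range_le_iSup (.inr (.inl i))) (range_le_iSup (.inr (.inr i)))
    exact ⟨k i, hk i, fun u => (hkg i u).imp (@sup_le_iSup _) (@sup_le_iSup _)⟩
  · let i : {mu : Shape n // Precedes mu lam ∧ mu ≠ mu.conj} := ⟨mu, hml, hmu⟩
    exact ⟨j i, hj i, fun u =>
      (hjf i u).imp (@range_le_iSup (.inl i) _) (@range_le_iSup (.inl i) _)⟩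

end Associators

end SuperSym

end

open SuperSym SuperSym.Supermodule in
theorem mainTheorem5 :
    Nonempty Associators ∧
    ∀ (Φ : Associators) (R : ∀ n : ℕ, Set (Shape n)) (_hR : ∀ n, IsTransversal (R n))
      (n : ℕ) (_hn : 2 ≤ n + 1) (lam : Shape (n + 1)) (_hlam : lam ∈ R (n + 1)),
      (lam ≠ lam.conj →
        Nonempty (Iso (down (Φ.W (R (n + 1)) lam))
          (Supermodule.prod
            (directSum fun mu : {mu : Shape n // Precedes mu lam ∧ mu ≠ mu.conj} =>
              Φ.W (R n) mu.1)
            (directSum fun mu : {mu : Shape n // Precedes mu lam ∧ mu = mu.conj} =>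
              Supermodule.prod (Φ.W (R n) mu.1) (shift (Φ.W (R n) mu.1)))))) ∧
      (lam = lam.conj →
        Nonempty (Iso (down (Φ.W (R (n + 1)) lam))
          (directSum fun mu : {mu : Shape n // Precedes mu lam ∧ 0 ≤ res mu lam} =>
            Φ.W (R n) mu.1))) ∧
      IsMultiplicityFree (down (Φ.W (R (n + 1)) lam)) ∧
      (lam = lam.conj →
        IsHomogeneouslyMultiplicityFree (down (Φ.W (R (n + 1)) lam))) := by
  refine ⟨nonempty_associators, fun Φ R _ n _ lam hlam => ?_⟩
  have W_eq : Φ.W (R (n + 1)) lam = Φ.ofPartition lam := if_pos hlam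
  rw [W_eq]
  have iso_of_ne : lam ≠ lam.conj → Nonempty (Iso (down (Φ.ofPartition lam))
      (directSum (Φ.restrictionSummand (R n) lam))) := fun hlam => by
    rw [Φ.ofPartition_of_ne_conj hlam]
    exact Φ.nonempty_iso_down_typeQ (R n) hlam
  have iso_of_eq : lam = lam.conj → Nonempty (Iso (down (Φ.ofPartition lam))
      (directSum fun mu : {mu : Shape n // Precedes mu lam ∧ 0 ≤ res mu lam} =>
        Φ.W (R n) mu.1)) := fun hlam => by
    rw [Φ.ofPartition_of_eq_conj hlam]
    exact Φ.nonempty_iso_down_typeM (R n) hlam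
  refine ⟨fun hlam => ?_, iso_of_eq, ?_, fun hlam => ?_⟩
  · obtain ⟨e⟩ := iso_of_ne hlam
    obtain ⟨f⟩ := nonempty_iso_prod_directSum (Φ.restrictionSummand (R n) lam)
    exact ⟨e.trans f⟩
  · by_cases hlam : lam = lam.conj
    · exact ⟨_, _, fun mu => Φ.isSimple_W (R n) mu.1, fun _ _ hne =>
        (Φ.isEmpty_iso_W_of_res_nonneg (R n) hlam hne).1, iso_of_eq hlam⟩
    · exact ⟨_, _, Φ.isSimple_restrictionSummand (R n) lam, fun _ _ hne =>
        Φ.isEmpty_iso_restrictionSummand (R n) hlam hne, iso_of_ne hlam⟩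
  · exact ⟨_, _, fun mu => Φ.isSimple_W (R n) mu.1, fun _ _ hne =>
      Φ.isEmpty_iso_W_of_res_nonneg (R n) hlam hne, iso_of_eq hlam⟩
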